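/- Let $Y=g_0(Z)+\varepsilon$ with $\mathrm E(\varepsilon\mid W)=0$ a.s., where $Y,Z$ are real random variables and $W$ takes values in $\mathbb R^p$, and let $(Y_i,Z_i,W_i)_{i\ge 1}$ be i.i.d. copies of $(Y,Z,W)$. **Function spaces.** Let $\mathcal G$ be the set of differentiable $g:[0,1]\to\mathbb R$ whose derivative $g'$ is absolutely continuous with $\int_0^1|g''|^2<\infty$, and let $\mathcal H=\{h\in\mathcal G: h(0)=h'(0)=0\}$ with inner product $\langle h_1,h_2\rangle_{\mathcal H}=\int_0^1h_1''h_2''$. **Assumptions.** (1) $\mathrm E Y^2<\infty$; $Z$ has a bounded density on $[0,1]$; $\mu$ is a symmetric probability measure on $\mathbb R^p$ with support $\mathbb R^p$; at least one component of $W$ has a continuous (atomless) distribution. (2) $g_0\in\mathcal G$, and $g\in\mathcal G\mapsto \mathrm E\{g(Z)\mid W\}$ is injective (functions in $\mathcal G$ being regarded as functions on $[0,1]$). (3) There is $\eta>0$ with $g_0'(z)\ge\eta$ for all $z\in[0,1]$. (4) $\lambda=\lambda_n$ is a deterministic sequence with $\lambda_n\to0$ and $n\lambda_n\to\infty$. **The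 estimator.** Put $\omega(w)=\int\cos(t^\top w)\,d\mu(t)$, $\Omega=[n^{-2}\omega(W_i-W_j)]_{i,j}$, $E=[\tfrac1{12}|Z_i-Z_j|^3]_{i,j}$, let $\mathbf Z$ be the $n\times2$ matrix with rows $(1,Z_i)$, and $$S=\begin{pmatrix}E+\lambda\Omega^{-1}&\mathbf Z\\ \mathbf Z^\top&0\end{pmatrix}^{-1}.$$ For $v\in\mathbb R^n$ let $\begin{pmatrix}\delta\\ a\end{pmatrix}=S\begin{pmatrix}v\\0\end{pmatrix}$ and $g_v(z)=a_0+a_1z+\frac1{12}\sum_{i=1}^n\delta_i|z-Z_i|^3$; the unconstrained smoothing spline estimator is $\widehat g=g_Y$. Consider the programme of minimizing $n-\sum_{i=1}^n(np_i)^{1/2}$ over $(p_1,\dots,p_n)$ subject to $\sum_ip_i=1$, $p_i\ge0$ and $g_{(p_jY_j)_j}'(Z_i)\ge0$ for $i=1,\dots,n$. Let $p^*$ be a solution (arbitrary when there is none), and let $\widehat g^{*}=g_v$ with $v=(n\,p^*_iY_i)_{i=1}^n$ be the monotonicity-constrained estimator. **Conclusion.** With probability tending to one the programme has exactly one solution,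 and $$\sup_{z\in[0,1]}|\widehat g^{*}(z)-g_0(z)|=o_P(1),\qquad \sup_{z\in[0,1]}|\widehat g^{*\prime}(z)-g_0'(z)|=o_P(1).$$ **Rates.** In $L^2_\mu$ (complex-valued functions of $t\in\mathbb R^p$, square integrable for $\mu$) let $(Ah)(t)=\mathrm E\{h(Z)e^{\mathbf iW^\top t}\}$ for $h\in\mathcal H$ and $(B\beta)(t)=\mathrm E\{(\beta_0+\beta_1Z)e^{\mathbf iW^\top t}\}$ for $\beta\in\mathbb R^2$, let $M$ be the orthogonal projection onto the orthogonal complement of the span of the range of $B$, let $T=MA$ with singular system $(\sigma_j,\varphi_j,\psi_j)_j$, and let $h_0(z)=g_0(z)-g_0(0)-g_0'(0)z$. If moreover, for some $\gamma>0$, $\sum_j\sigma_j^{-2\gamma}|\langle h_0,\varphi_j\rangle_{\mathcal H}|^2<\infty$, then $$\sup_{z\in[0,1]}|\widehat g^{*}(z)-g_0(z)|=O_P\Big(\frac1{\sqrt{n\lambda}}+\lambda^{\frac{\gamma\wedge2}2}\Big),\qquad \sup_{z\in[0,1]}|\widehat g^{*\prime}(z)-g_0'(z)|=O_P\Big(\frac1{\sqrt{n\lambda}}+\lambda^{\frac{\gamma\wedge2}2}\Big).$$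 -/

import Mathlib

open MeasureTheory ProbabilityTheory Filter Topology
open scoped ENNReal Matrix

namespace NPIV

noncomputable section

/-! ### The function spaces on `[0,1]` -/

/-- First derivative of `g` on `[0,1]` (one-sided at the endpoints). -/
def d1 (g : ℝ → ℝ) : ℝ → ℝ := derivWithin g (Set.Icc 0 1)

/-- Second derivative of `g` on `[0,1]`; for `g` with absolutely continuous `d1 g` this is the
almost everywhere defined second derivative. -/
def d2 (g : ℝ → ℝ) : ℝ → ℝ := derivWithin (d1 g) (Set.Icc 0 1)

/-- The space `𝒢`: differentiable functions on `[0,1]` with absolutely continuous first derivative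
and square integrable second derivative. Only the values on `[0,1]` matter. -/
structure MemG (g : ℝ → ℝ) : Prop where
  differentiableOn : DifferentiableOn ℝ g (Set.Icc 0 1)
  absolutelyContinuous : AbsolutelyContinuousOnInterval (d1 g) 0 1
  memLp_d2 : MemLp (d2 g) 2 (volume.restrict (Set.Icc 0 1))

/-- The space `ℋ` of those `h ∈ 𝒢` with `h(0) = h'(0) = 0`. -/
structure MemH (h : ℝ → ℝ) : Prop extends MemG h where
  apply_zero : h 0 = 0
  d1_zero : d1 h 0 = 0

/-- The inner product `⟨h₁, h₂⟩ = ∫₀¹ h₁'' h₂''` of `ℋ`. -/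
def innerH (h₁ h₂ : ℝ → ℝ) : ℝ := ∫ z in (0 : ℝ)..1, d2 h₁ z * d2 h₂ z

/-- The component in `ℋ` of `g ∈ 𝒢`: `h(z) = g(z) - g(0) - g'(0) z`. -/
def hPart (g : ℝ → ℝ) : ℝ → ℝ := fun z => g z - g 0 - d1 g 0 * z

/-- The supremum over `[0,1]` of `|f|`, with values in `[0,∞]`. -/
def supNorm (f : ℝ → ℝ) : ℝ≥0∞ := ⨆ z ∈ Set.Icc (0 : ℝ) 1, ‖f z‖ₑ

/-! ### Stochastic orders (with outer probabilities) -/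

section Orders

variable {Ω : Type*} [MeasurableSpace Ω]

/-- `X_n = o_P(1)`. -/
def IsLittleOPOne (P : Measure Ω) (X : ℕ → Ω → ℝ≥0∞) : Prop :=
  ∀ ε : ℝ, 0 < ε → Tendsto (fun n => P {ω | ENNReal.ofReal ε < X n ω}) atTop (𝓝 0)

/-- `X_n = O_P(r_n)`. -/
def IsBigOP (P : Measure Ω) (X : ℕ → Ω → ℝ≥0∞) (r : ℕ → ℝ) : Prop :=
  ∀ ε : ℝ, 0 < ε → ∃ C : ℝ, ∀ᶠ n in atTop,
    P {ω | ENNReal.ofReal (C * r n) < X n ω} ≤ ENNReal.ofReal ε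

end Orders

/-! ### The smoothing spline, its reweighted version and the tilting programme -/

section Estimator

variable {p n : ℕ}

/-- `ω(w) = ∫ cos(tᵀ w) dμ(t)`. -/
def omegaFun (μ : Measure (EuclideanSpace ℝ (Fin p))) (w : EuclideanSpace ℝ (Fin p)) : ℝ :=
  ∫ t, Real.cos (inner ℝ t w) ∂μ

/-- The matrix `Ω` with entries `n⁻² ω(W_i - W_j)`. -/
def omegaMatrix (μ : Measure (EuclideanSpace ℝ (Fin p)))
    (w : Fin n → EuclideanSpace ℝ (Fin p)) : Matrix (Fin n) (Fin n) ℝ :=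
  Matrix.of fun i j => ((n : ℝ) ^ 2)⁻¹ * omegaFun μ (w i - w j)

/-- The matrix `E` with entries `|Z_i - Z_j|³ / 12`. -/
def cubicMatrix (z : Fin n → ℝ) : Matrix (Fin n) (Fin n) ℝ :=
  Matrix.of fun i j => (1 / 12 : ℝ) * |z i - z j| ^ 3

/-- The `n × 2` matrix `Z` with rows `(1, Z_i)`. -/
def designMatrix (z : Fin n → ℝ) : Matrix (Fin n) (Fin 2) ℝ :=
  Matrix.of fun i => ![1, z i]

/-- The matrix `S`, the inverse of the bordered matrix with blocks `E + lam Ω⁻¹`, `Z`, `Zᵀ`, `0`. -/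
def smootherMatrix (μ : Measure (EuclideanSpace ℝ (Fin p))) (lam : ℝ) (z : Fin n → ℝ)
    (w : Fin n → EuclideanSpace ℝ (Fin p)) : Matrix (Fin n ⊕ Fin 2) (Fin n ⊕ Fin 2) ℝ :=
  (Matrix.fromBlocks (cubicMatrix z + lam • (omegaMatrix μ w)⁻¹) (designMatrix z)
    (designMatrix z)ᵀ 0)⁻¹

/-- The spline coefficients `(δ, a) = S (v, 0)` associated with the response vector `v`. -/
def splineCoef (μ : Measure (EuclideanSpace ℝ (Fin p))) (lam : ℝ) (z : Fin n → ℝ)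
    (w : Fin n → EuclideanSpace ℝ (Fin p)) (v : Fin n → ℝ) : Fin n ⊕ Fin 2 → ℝ :=
  smootherMatrix μ lam z w *ᵥ Sum.elim v 0

/-- The smoothing spline `x ↦ a₀ + a₁ x + (1/12) ∑ᵢ δᵢ |x - Z_i|³` with `(δ, a) = S (v, 0)`; for
`v = Y` it is the unconstrained estimator. -/
def splineFit (μ : Measure (EuclideanSpace ℝ (Fin p))) (lam : ℝ) (z : Fin n → ℝ)
    (w : Fin n → EuclideanSpace ℝ (Fin p)) (v : Fin n → ℝ) : ℝ → ℝ := fun x =>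
  splineCoef μ lam z w v (Sum.inr 0) + splineCoef μ lam z w v (Sum.inr 1) * x
    + (1 / 12 : ℝ) * ∑ i, splineCoef μ lam z w v (Sum.inl i) * |x - z i| ^ 3

/-- The weights `q` that are admissible in the tilting programme: probability weights for which the
spline fitted to the reweighted responses `q ∘ Y` has nonnegative derivative at each `Z_i`. -/
structure IsFeasible (μ : Measure (EuclideanSpace ℝ (Fin p))) (lam : ℝ) (y z : Fin n → ℝ)
    (w : Fin n → EuclideanSpace ℝ (Fin p)) (q : Fin n → ℝ) : Prop where
  sum_eq_one : ∑ i, q i = 1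
  nonneg : ∀ i, 0 ≤ q i
  deriv_nonneg : ∀ i, 0 ≤ deriv (splineFit μ lam z w (fun j => q j * y j)) (z i)

/-- The objective `n - ∑ᵢ (n qᵢ)^{1/2}`. -/
def tiltObjective (q : Fin n → ℝ) : ℝ := (n : ℝ) - ∑ i, Real.sqrt ((n : ℝ) * q i)

/-- `q` solves the tilting programme. -/
def IsTiltingSolution (μ : Measure (EuclideanSpace ℝ (Fin p))) (lam : ℝ) (y z : Fin n → ℝ)
    (w : Fin n → EuclideanSpace ℝ (Fin p)) (q : Fin n → ℝ) : Prop :=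
  IsFeasible μ lam y z w q ∧
    ∀ q', IsFeasible μ lam y z w q' → tiltObjective q ≤ tiltObjective q'

/-- The reweighted estimator: the spline fitted to the responses `n qᵢ Y_i`, so that uniform
weights `qᵢ = 1/n` give back the unconstrained estimator. -/
def reweightedFit (μ : Measure (EuclideanSpace ℝ (Fin p))) (lam : ℝ) (y z : Fin n → ℝ)
    (w : Fin n → EuclideanSpace ℝ (Fin p)) (q : Fin n → ℝ) : ℝ → ℝ :=
  splineFit μ lam z w (fun i => (n : ℝ) * q i * y i)

end Estimator

/-! ### Population operators, completeness, source condition -/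

section Population

variable {Ω : Type*} [MeasurableSpace Ω] {p : ℕ}

/-- The map `g ∈ 𝒢 ↦ E[g(Z) | W]` is injective (functions in `𝒢` being functions on `[0,1]`). -/
def Completeness (P : Measure Ω) (Z : Ω → ℝ) (W : Ω → EuclideanSpace ℝ (Fin p)) : Prop :=
  ∀ g₁ g₂ : ℝ → ℝ, MemG g₁ → MemG g₂ →
    P[fun ω => g₁ (Z ω) | MeasurableSpace.comap W inferInstance] =ᵐ[P]
      P[fun ω => g₂ (Z ω) | MeasurableSpace.comap W inferInstance] →
    Set.EqOn g₁ g₂ (Set.Icc 0 1)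

/-- The function `t ↦ E[V exp(i Wᵀ t)]`. -/
def charMoment (P : Measure Ω) (W : Ω → EuclideanSpace ℝ (Fin p)) (V : Ω → ℝ) :
    EuclideanSpace ℝ (Fin p) → ℂ := fun t =>
  ∫ ω, (V ω : ℂ) * Complex.exp (Complex.I * ((inner ℝ (W ω) t : ℝ) : ℂ)) ∂P

theorem charMoment_memLp (P : Measure Ω) {W : Ω → EuclideanSpace ℝ (Fin p)} (hW : Measurable W)
    (V : Ω → ℝ) (μ : Measure (EuclideanSpace ℝ (Fin p))) [IsProbabilityMeasure μ] :
    MemLp (charMoment P W V) 2 μ := by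
  have hnorm : ∀ t ω, ‖(V ω : ℂ) * Complex.exp (Complex.I * ((inner ℝ (W ω) t : ℝ) : ℂ))‖
      = ‖V ω‖ := by
    intro t ω
    rw [norm_mul, mul_comm Complex.I, Complex.norm_exp_ofReal_mul_I, mul_one, Complex.norm_real]
  by_cases hV : Integrable V P
  · have hcont : Continuous (charMoment P W V) := by
      refine continuous_of_dominated (bound := fun ω => ‖V ω‖) ?_ ?_ hV.norm ?_
      · intro t
        refine (Complex.continuous_ofReal.comp_aestronglyMeasurable hV.1).mul ?_
        have : Measurable fun ω => Complex.exp (Complex.I * ((inner ℝ (W ω) t : ℝ) : ℂ)) := by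
          fun_prop
        exact this.aestronglyMeasurable
      · intro t
        exact Eventually.of_forall fun ω => (hnorm t ω).le
      · refine Eventually.of_forall fun ω => ?_
        fun_prop
    refine MemLp.of_bound hcont.aestronglyMeasurable (∫ ω, ‖V ω‖ ∂P) ?_
    refine Eventually.of_forall fun t => ?_
    refine (norm_integral_le_integral_norm _).trans (le_of_eq ?_)
    exact integral_congr_ae (Eventually.of_forall fun ω => hnorm t ω)
  · have h0 : charMoment P W V = 0 := by
      funext t
      refine integral_undef fun h => hV ?_
      have hexp : Measurable
          fun ω => Complex.exp (-(Complex.I * ((inner ℝ (W ω) t : ℝ) : ℂ))) := by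
        fun_prop
      have hVm : AEStronglyMeasurable V P := by
        have h2 := Complex.continuous_re.comp_aestronglyMeasurable
          (h.1.mul hexp.aestronglyMeasurable)
        refine h2.congr (Eventually.of_forall fun ω => ?_)
        simp only [Pi.mul_apply]
        rw [mul_assoc, ← Complex.exp_add, add_neg_cancel, Complex.exp_zero, mul_one,
          Complex.ofReal_re]
      exact h.norm.mono' hVm (Eventually.of_forall fun ω => (hnorm t ω).ge)
    rw [h0]
    exact MemLp.zero'

/-- The element `E[V exp(i Wᵀ ·)]` of `L²_μ`. -/
def charVec (P : Measure Ω) {W : Ω → EuclideanSpace ℝ (Fin p)} (hW : Measurable W)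
    (μ : Measure (EuclideanSpace ℝ (Fin p))) [IsProbabilityMeasure μ] (V : Ω → ℝ) : Lp ℂ 2 μ :=
  (charMoment_memLp P hW V μ).toLp (charMoment P W V)

/-- The operator `A h = E[h(Z) exp(i Wᵀ ·)]`. -/
def opA (P : Measure Ω) (Z : Ω → ℝ) {W : Ω → EuclideanSpace ℝ (Fin p)} (hW : Measurable W)
    (μ : Measure (EuclideanSpace ℝ (Fin p))) [IsProbabilityMeasure μ] (h : ℝ → ℝ) : Lp ℂ 2 μ :=
  charVec P hW μ fun ω => h (Z ω)

/-- The operator `B β = E[(1, Z) β exp(i Wᵀ ·)]`. -/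
def opB (P : Measure Ω) (Z : Ω → ℝ) {W : Ω → EuclideanSpace ℝ (Fin p)} (hW : Measurable W)
    (μ : Measure (EuclideanSpace ℝ (Fin p))) [IsProbabilityMeasure μ] (β : Fin 2 → ℝ) :
    Lp ℂ 2 μ :=
  charVec P hW μ fun ω => β 0 + β 1 * Z ω

/-- The operator `T = M A`, where `M` is the orthogonal projection of `L²_μ` onto the orthogonal
complement of the span of `B`. -/
def opT (P : Measure Ω) (Z : Ω → ℝ) {W : Ω → EuclideanSpace ℝ (Fin p)} (hW : Measurable W)
    (μ : Measure (EuclideanSpace ℝ (Fin p))) [IsProbabilityMeasure μ] (h : ℝ → ℝ) : Lp ℂ 2 μ :=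
  (Submodule.span ℂ (Set.range (opB P Z hW μ)))ᗮ.starProjection (opA P Z hW μ h)

/-- `(σ_j, φ_j, ψ_j)` is a singular system of `T : ℋ → L²_μ`: `(φ_j)` is orthonormal in `ℋ`,
`(ψ_j)` is orthonormal in `L²_μ`, `σ_j > 0`, and `T h = ∑_j σ_j ⟨h, φ_j⟩ ψ_j` for all `h ∈ ℋ`. -/
structure IsSingularSystem (P : Measure Ω) (Z : Ω → ℝ) {W : Ω → EuclideanSpace ℝ (Fin p)}
    (hW : Measurable W) (μ : Measure (EuclideanSpace ℝ (Fin p))) [IsProbabilityMeasure μ]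
    (σ : ℕ → ℝ) (φ : ℕ → ℝ → ℝ) (ψ : ℕ → Lp ℂ 2 μ) : Prop where
  pos : ∀ j, 0 < σ j
  memH : ∀ j, MemH (φ j)
  orthonormal_left : ∀ j k, innerH (φ j) (φ k) = if j = k then 1 else 0
  orthonormal_right : Orthonormal ℂ ψ
  expansion : ∀ h, MemH h →
    HasSum (fun j => ((σ j * innerH h (φ j) : ℝ) : ℂ) • ψ j) (opT P Z hW μ h)

/-- The source condition with exponent `γ`: `∑_j σ_j^{-2γ} |⟨h₀, φ_j⟩|² < ∞`, where
`h₀(z) = g₀(z) - g₀(0) - g₀'(0) z`. -/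
def SourceCondition (P : Measure Ω) (Z : Ω → ℝ) {W : Ω → EuclideanSpace ℝ (Fin p)}
    (hW : Measurable W) (μ : Measure (EuclideanSpace ℝ (Fin p))) [IsProbabilityMeasure μ]
    (g₀ : ℝ → ℝ) (γ : ℝ) : Prop :=
  ∃ (σ : ℕ → ℝ) (φ : ℕ → ℝ → ℝ) (ψ : ℕ → Lp ℂ 2 μ), IsSingularSystem P Z hW μ σ φ ψ ∧
    Summable fun j => σ j ^ (-2 * γ) * |innerH (hPart g₀) (φ j)| ^ 2

end Population

end

end NPIV

/-!
The proof treats the estimators as elements of a Hilbert space. A function `g ∈ 𝒢` is identified with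
the triple `(g(0), g'(0), g'')` in `Sob = ℝ² × L²[0,1]`; there the evaluations of `g` and `g'` at
points of `[0,1]` are inner products with vectors of norm at most `2`, so that all uniform errors are
controlled by the norm of `Sob` (`Sob.abs_toFun_le`, `Sob.abs_dFun_le`).

**Reduction to the unconstrained spline.** As `2 (n - ∑ √(n qᵢ)) = ∑ (√(n qᵢ) - 1)²` for probability
weights, uniform weights are the only minimizers of the objective without the derivative constraints.
Hence, as soon as the unconstrained spline is nondecreasing at the design points, they are the only
solution of the programme (`isTiltingSolution_iff`), and the constrained estimator is the
unconstrained one. As `g₀' ≥ η > 0`, monotonicity holds once the unconstrained spline is close to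
`g₀` in `Sob`.

**The unconstrained spline as a Tikhonov regularization.** The matrix `Ω` is the Gram matrix of the
functions `n⁻¹ exp(i Wⱼᵀ ·)` in `L²_μ` (`inner_empVec`), and a natural cubic spline represents a
combination of point evaluations for `∫ s'' g''` (`inner_splineSob_snd`). The linear system that
defines the estimator thus expresses the normal equations of minimizing
`‖n⁻¹ ∑ⱼ (Yⱼ - g(Zⱼ)) exp(i Wⱼᵀ ·)‖² + lam ∫ (g'')²` over `𝒢` (`splineFit_normal_equations`). The
population version of this problem has the operator `opK : g ↦ E[g(Z) exp(i Wᵀ ·)]`, which is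
injective by completeness (`injective_opK`); as the penalty only misses the two-dimensional space of
affine functions, `‖g‖² ≤ c² (‖opK g‖² + ‖g''‖²)` (`exists_coercive`).

**Error bound.** Comparing the two normal equations bounds the distance of the spline from the
population regularization of `g₀` by a constant times `r / √lam`, when the empirical operator and
noise deviate from their expectations by at most `r` (`norm_splineSob_error_le`). A second moment
computation for averages in a Hilbert space gives `r = O_P(n^{-1/2})`
(`exists_measure_samplingError_le`). The remaining deterministic bias tends to zero because the range
of the adjoint of `opK` is dense (`IsTikhonovBias.tendsto_zero`).

**Rates.** For symmetric `μ` the functions `E[V exp(i Wᵀ ·)]` have real inner products, so that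
eliminating the affine part by the complex projection `M` agrees with the normal equations in the
affine directions. Completeness then makes `(φⱼ'')` a Hilbert basis of `L²[0,1]`, in which the bias has
the coefficients `lam / (σⱼ² + lam) ⟨h₀, φⱼ⟩`; this gives the bias `O(lam^{(γ ∧ 2)/2})`
(`exists_norm_bias_le`, `IsTikhonovBias.norm_le_rpow`).
-/

namespace NPIV

noncomputable section

/-! ### Tikhonov regularization in Hilbert spaces -/

section Tikhonov

variable {G V F : Type*} [NormedAddCommGroup G] [InnerProductSpace ℝ G]
  [NormedAddCommGroup V] [InnerProductSpace ℝ V]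
  [NormedAddCommGroup F] [InnerProductSpace ℝ F]

/-- `u` is the bias of Tikhonov regularization with parameter `lam` and penalty `‖D g‖²` for the
equation with exact data `K γ`: the regularized solution is `γ - u`. -/
def IsTikhonovBias (K : G →L[ℝ] F) (D : G →L[ℝ] V) (γ : G) (lam : ℝ) (u : G) : Prop :=
  ∀ g, inner ℝ (K u) (K g) + lam * inner ℝ (D u) (D g) = lam * inner ℝ (D γ) (D g)

/-- Existence of the regularized solution, by the Lax–Milgram theorem. -/
theorem exists_isTikhonovBias [CompleteSpace G] [CompleteSpace V] [CompleteSpace F]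
    {K : G →L[ℝ] F} {D : G →L[ℝ] V} {c : ℝ}
    (hc : ∀ g, ‖g‖ ^ 2 ≤ c ^ 2 * (‖K g‖ ^ 2 + ‖D g‖ ^ 2)) (γ : G) {lam : ℝ} (hlam : 0 < lam) :
    ∃ u, IsTikhonovBias K D γ lam u := by
  let N : G →L[ℝ] G := K.adjoint ∘L K + lam • (D.adjoint ∘L D)
  let B : G →L[ℝ] G →L[ℝ] ℝ := (innerSL ℝ) ∘L N
  have hB : ∀ u g, B u g = inner ℝ (K u) (K g) + lam * inner ℝ (D u) (D g) := by
    intro u g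
    change inner ℝ (K.adjoint (K u) + lam • D.adjoint (D u)) g = _
    rw [inner_add_left, real_inner_smul_left, ContinuousLinearMap.adjoint_inner_left,
      ContinuousLinearMap.adjoint_inner_left]
  have hco : IsCoercive B := by
    set m := min 1 lam with hm
    have hm0 : 0 < m := lt_min one_pos hlam
    refine ⟨m / (c ^ 2 + 1), by positivity, fun u => ?_⟩
    rw [hB, real_inner_self_eq_norm_sq, real_inner_self_eq_norm_sq]
    have h1 : m * (‖K u‖ ^ 2 + ‖D u‖ ^ 2) ≤ ‖K u‖ ^ 2 + lam * ‖D u‖ ^ 2 := by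
      have := mul_le_mul_of_nonneg_right (min_le_left 1 lam) (sq_nonneg ‖K u‖)
      have := mul_le_mul_of_nonneg_right (min_le_right 1 lam) (sq_nonneg ‖D u‖)
      rw [← hm] at *
      linarith
    have h2 : ‖u‖ ^ 2 ≤ (c ^ 2 + 1) * (‖K u‖ ^ 2 + ‖D u‖ ^ 2) :=
      (hc u).trans (by gcongr; linarith)
    rw [mul_assoc, ← sq, div_mul_eq_mul_div, div_le_iff₀ (by positivity)]
    calc m * ‖u‖ ^ 2 ≤ m * ((c ^ 2 + 1) * (‖K u‖ ^ 2 + ‖D u‖ ^ 2)) := by gcongr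
      _ = (m * (‖K u‖ ^ 2 + ‖D u‖ ^ 2)) * (c ^ 2 + 1) := by ring
      _ ≤ _ := by gcongr
  refine ⟨hco.continuousLinearEquivOfBilin.symm (lam • D.adjoint (D γ)), fun g => ?_⟩
  rw [← hB, ← hco.continuousLinearEquivOfBilin_apply, ContinuousLinearEquiv.apply_symm_apply,
    real_inner_smul_left, ContinuousLinearMap.adjoint_inner_left]

namespace IsTikhonovBias

variable {K : G →L[ℝ] F} {D : G →L[ℝ] V} {γ u : G} {lam : ℝ}

theorem energy (h : IsTikhonovBias K D γ lam u) :
    ‖K u‖ ^ 2 + lam * ‖D u‖ ^ 2 = lam * inner ℝ (D γ) (D u) := by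
  rw [← h u, real_inner_self_eq_norm_sq, real_inner_self_eq_norm_sq]

theorem norm_D_le (h : IsTikhonovBias K D γ lam u) (hlam : 0 < lam) : ‖D u‖ ≤ ‖D γ‖ := by
  by_contra! hlt
  have h1 : lam * ‖D u‖ ^ 2 ≤ lam * (‖D γ‖ * ‖D u‖) := by
    have := h.energy
    have h2 := mul_le_mul_of_nonneg_left (real_inner_le_norm (D γ) (D u)) hlam.le
    nlinarith [sq_nonneg ‖K u‖]
  have h3 := le_of_mul_le_mul_left h1 hlam
  nlinarith [norm_nonneg (D γ), norm_nonneg (D u)]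

theorem norm_K_le (h : IsTikhonovBias K D γ lam u) (hlam : 0 < lam) :
    ‖K u‖ ≤ √lam * ‖D γ‖ := by
  refine abs_le_of_sq_le_sq' ?_ (by positivity) |>.2
  rw [mul_pow, Real.sq_sqrt hlam.le]
  have h1 := h.energy
  have h2 := mul_le_mul_of_nonneg_left (real_inner_le_norm (D γ) (D u)) hlam.le
  have h3 := mul_le_mul_of_nonneg_left
    (mul_le_mul_of_nonneg_left (h.norm_D_le hlam) (norm_nonneg (D γ))) hlam.le
  nlinarith [mul_nonneg hlam.le (sq_nonneg ‖D u‖)]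

theorem norm_le {c : ℝ} (hc0 : 0 ≤ c) (hc : ∀ g, ‖g‖ ^ 2 ≤ c ^ 2 * (‖K g‖ ^ 2 + ‖D g‖ ^ 2))
    (h : IsTikhonovBias K D γ lam u) (hlam : 0 < lam) (hlam1 : lam ≤ 1) :
    ‖u‖ ≤ 2 * c * ‖D γ‖ := by
  refine abs_le_of_sq_le_sq' ?_ (by positivity) |>.2
  have h1 : ‖K u‖ ≤ ‖D γ‖ := (h.norm_K_le hlam).trans
    (mul_le_of_le_one_left (norm_nonneg _) (Real.sqrt_le_one.2 hlam1))
  have h2 := h.norm_D_le hlam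
  calc ‖u‖ ^ 2 ≤ c ^ 2 * (‖K u‖ ^ 2 + ‖D u‖ ^ 2) := hc u
    _ ≤ c ^ 2 * (‖D γ‖ ^ 2 + ‖D γ‖ ^ 2) := by gcongr
    _ ≤ _ := by nlinarith [sq_nonneg (c * ‖D γ‖)]

/-- The bias vanishes in the limit, without any source condition. The energy identity reduces the
claim to `⟨D γ, D u⟩ → 0`, and this holds because `K u → 0`
and the range of the adjoint of an injective `K` is dense. -/
theorem tendsto_zero [CompleteSpace G] [CompleteSpace V] [CompleteSpace F]
    {c : ℝ} (hc0 : 0 ≤ c)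
    (hc : ∀ g, ‖g‖ ^ 2 ≤ c ^ 2 * (‖K g‖ ^ 2 + ‖D g‖ ^ 2)) (hK : Function.Injective K)
    {lam : ℕ → ℝ} (hlam0 : ∀ᶠ n in atTop, 0 < lam n) (hlam : Tendsto lam atTop (𝓝 0))
    {u : ℕ → G} (hu : ∀ᶠ n in atTop, IsTikhonovBias K D γ (lam n) (u n)) :
    Tendsto (fun n => ‖u n‖) atTop (𝓝 0) := by
  have hlam1 : ∀ᶠ n in atTop, lam n ≤ 1 := hlam.eventually_le_const one_pos
  have hKu : Tendsto (fun n => ‖K (u n)‖) atTop (𝓝 0) := by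
    have h1 : Tendsto (fun n => √(lam n) * ‖D γ‖) atTop (𝓝 0) := by
      simpa using (Real.continuous_sqrt.tendsto 0 |>.comp hlam).mul_const ‖D γ‖
    refine squeeze_zero' (Eventually.of_forall fun _ => norm_nonneg _) ?_ h1
    filter_upwards [hlam0, hu] with n h0 hn using hn.norm_K_le h0
  have hdense : ∀ x : G, x ∈ closure (Set.range K.adjoint) := by
    have h1 : K.adjoint.rangeᗮ = ⊥ := by
      rw [ContinuousLinearMap.orthogonal_range, ContinuousLinearMap.adjoint_adjoint]
      exact LinearMap.ker_eq_bot.2 hK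
    have h2 := (Submodule.topologicalClosure_eq_top_iff (K := K.adjoint.range)).2 h1
    intro x
    have h3 : x ∈ K.adjoint.range.topologicalClosure := h2 ▸ Submodule.mem_top
    exact h3
  have hinner : Tendsto (fun n => inner ℝ (D γ) (D (u n))) atTop (𝓝 0) := by
    rw [Metric.tendsto_nhds]
    intro ε hε
    set R := 2 * c * ‖D γ‖ + 1 with hR
    have hR0 : 0 < R := by positivity
    obtain ⟨_, ⟨f, rfl⟩, hf⟩ := Metric.mem_closure_iff.1 (hdense (D.adjoint (D γ))) (ε / (2 * R))
      (by positivity)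
    have h2 : Tendsto (fun n => ‖f‖ * ‖K (u n)‖) atTop (𝓝 0) := by
      simpa using hKu.const_mul ‖f‖
    filter_upwards [h2.eventually_lt_const (show 0 < ε / 2 by positivity), hlam0, hlam1, hu]
      with n h3 h0 h1 hn
    have hun : ‖u n‖ ≤ R := (hn.norm_le hc0 hc h0 h1).trans (by linarith)
    rw [Real.dist_eq, sub_zero, ← ContinuousLinearMap.adjoint_inner_left,
      ← sub_add_cancel (D.adjoint (D γ)) (K.adjoint f), inner_add_left,
      ContinuousLinearMap.adjoint_inner_left K]
    rw [dist_eq_norm] at hf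
    have h4 : |inner ℝ (D.adjoint (D γ) - K.adjoint f) (u n)| ≤ ε / (2 * R) * R :=
      (abs_real_inner_le_norm _ _).trans (by gcongr)
    have h5 : ε / (2 * R) * R = ε / 2 := by field_simp
    have h6 := abs_real_inner_le_norm f (K (u n))
    refine (abs_add_le _ _).trans_lt ?_
    linarith
  have hsq : Tendsto (fun n => c ^ 2 * (‖K (u n)‖ ^ 2 + |inner ℝ (D γ) (D (u n))|)) atTop (𝓝 0) := by
    simpa using ((hKu.pow 2).add hinner.abs).const_mul (c ^ 2)
  have hsq2 : Tendsto (fun n => ‖u n‖ ^ 2) atTop (𝓝 0) := by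
    refine squeeze_zero' (Eventually.of_forall fun _ => by positivity) ?_ hsq
    filter_upwards [hlam0, hu] with n h0 hn
    refine (hc _).trans ?_
    gcongr
    have h1 := hn.energy
    have h2 := mul_le_mul_of_nonneg_left (le_abs_self (inner ℝ (D γ) (D (u n)))) h0.le
    exact le_of_mul_le_mul_left (by nlinarith [sq_nonneg ‖K (u n)‖]) h0
  have := (Real.continuous_sqrt.tendsto 0).comp hsq2
  simpa [Function.comp_def, Real.sqrt_sq (norm_nonneg _)] using this

/-- Stability of Tikhonov regularization: `g` solves the normal equations with the operator `K'` and
the data `K' γ + ε`, where `K'` is `δ`-close to `K`. -/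
theorem norm_perturbation_le {c : ℝ} (hc0 : 0 ≤ c)
    (hc : ∀ g, ‖g‖ ^ 2 ≤ c ^ 2 * (‖K g‖ ^ 2 + ‖D g‖ ^ 2))
    (hu : IsTikhonovBias K D γ lam u) (hlam : 0 < lam) (hlam1 : lam ≤ 1)
    {K' : G →L[ℝ] F} {δ : ℝ} (hδ0 : 0 ≤ δ) (hδ : ∀ g, ‖K' g - K g‖ ≤ δ * ‖g‖)
    (hδc : 4 * c ^ 2 * δ ^ 2 ≤ 1) {ε : F} {g : G}
    (hg : ∀ x, inner ℝ (K' g - (K' γ + ε)) (K' x) + lam * inner ℝ (D g) (D x) = 0) :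
    √lam * ‖(γ - g) - u‖ ≤ 2 * c * (‖ε‖ + 4 * c * ‖D γ‖ * δ) := by
  set e := (γ - g) - u with he
  set Q := ‖K' e‖ ^ 2 + lam * ‖D e‖ ^ 2 with hQ
  have hQ0 : 0 ≤ Q := by positivity
  -- the difference of the two normal equations, tested with `e`
  have hid : Q = -inner ℝ ε (K' e) - inner ℝ (K' u - K u) (K' e)
      - inner ℝ (K u) (K' e - K e) := by
    have h1 := hg e
    have h2 := hu e
    rw [hQ, ← real_inner_self_eq_norm_sq, ← real_inner_self_eq_norm_sq]
    have h3 : inner ℝ (K' e) (K' e)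
        = inner ℝ (K' γ) (K' e) - inner ℝ (K' g) (K' e) - inner ℝ (K' u) (K' e) := by
      rw [← inner_sub_left, ← inner_sub_left, ← map_sub, ← map_sub]
    have h4 : inner ℝ (D e) (D e)
        = inner ℝ (D γ) (D e) - inner ℝ (D g) (D e) - inner ℝ (D u) (D e) := by
      rw [← inner_sub_left, ← inner_sub_left, ← map_sub, ← map_sub]
    rw [h3, h4]
    simp only [inner_sub_left, inner_sub_right, inner_add_left] at h1 h2 ⊢
    linarith
  -- `K'` inherits the coercivity of `K`, as `δ` is small
  have hcoer : lam * ‖e‖ ^ 2 ≤ (2 * c) ^ 2 * Q := by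
    have h1 : ‖K e‖ ^ 2 ≤ 2 * ‖K' e‖ ^ 2 + 2 * (δ * ‖e‖) ^ 2 := by
      have h2 : ‖K e‖ ≤ ‖K' e‖ + δ * ‖e‖ := by
        have h3 : ‖K e‖ ≤ ‖K' e‖ + ‖K' e - K e‖ := by
          rw [norm_sub_rev]; simpa using norm_add_le (K' e) (K e - K' e)
        linarith [hδ e]
      have h4 := pow_le_pow_left₀ (norm_nonneg (K e)) h2 2
      nlinarith [sq_nonneg (‖K' e‖ - δ * ‖e‖)]
    have h5 : ‖e‖ ^ 2 ≤ 4 * c ^ 2 * (‖K' e‖ ^ 2 + ‖D e‖ ^ 2) := by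
      have h6 := hc e
      have h7 := mul_le_mul_of_nonneg_left h1 (sq_nonneg c)
      have h8 := mul_le_mul_of_nonneg_right hδc (sq_nonneg ‖e‖)
      nlinarith [mul_nonneg (sq_nonneg c) (sq_nonneg ‖D e‖)]
    have h9 : lam * ‖K' e‖ ^ 2 ≤ ‖K' e‖ ^ 2 := mul_le_of_le_one_left (sq_nonneg _) hlam1
    have h10 := mul_le_mul_of_nonneg_left h5 hlam.le
    have h11 := mul_le_mul_of_nonneg_left h9 (show 0 ≤ 4 * c ^ 2 by positivity)
    rw [hQ]
    nlinarith
  have hle : √lam * ‖e‖ ≤ 2 * c * √Q := by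
    refine abs_le_of_sq_le_sq' ?_ (by positivity) |>.2
    rw [mul_pow, mul_pow, Real.sq_sqrt hlam.le, Real.sq_sqrt hQ0]
    exact hcoer
  have hK'e : ‖K' e‖ ≤ √Q := by
    apply Real.le_sqrt_of_sq_le
    rw [hQ]
    nlinarith [mul_nonneg hlam.le (sq_nonneg ‖D e‖)]
  have hu1 := hu.norm_le hc0 hc hlam hlam1
  have hu2 := hu.norm_K_le hlam
  have hmain : Q ≤ (‖ε‖ + 4 * c * ‖D γ‖ * δ) * √Q := by
    have h1 : -inner ℝ ε (K' e) ≤ ‖ε‖ * √Q :=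
      (neg_le_abs _).trans ((abs_real_inner_le_norm _ _).trans (by gcongr))
    have h2 : -inner ℝ (K' u - K u) (K' e) ≤ (δ * (2 * c * ‖D γ‖)) * √Q :=
      (neg_le_abs _).trans ((abs_real_inner_le_norm _ _).trans
        (mul_le_mul ((hδ u).trans (by gcongr)) hK'e (norm_nonneg _) (by positivity)))
    have h3 : -inner ℝ (K u) (K' e - K e) ≤ ‖D γ‖ * δ * (2 * c * √Q) := by
      refine (neg_le_abs _).trans ((abs_real_inner_le_norm _ _).trans ?_)
      calc ‖K u‖ * ‖K' e - K e‖ ≤ (√lam * ‖D γ‖) * (δ * ‖e‖) := by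
            gcongr; exact hδ e
        _ = ‖D γ‖ * δ * (√lam * ‖e‖) := by ring
        _ ≤ _ := by gcongr
    rw [hid] at *
    linarith
  have hfin : √Q ≤ ‖ε‖ + 4 * c * ‖D γ‖ * δ := by
    by_contra! hlt
    have h0 : 0 < √Q := lt_of_le_of_lt (by positivity) hlt
    have := mul_lt_mul_of_pos_right hlt h0
    rw [Real.mul_self_sqrt hQ0] at this
    linarith
  exact hle.trans (by gcongr)

end IsTikhonovBias

end Tikhonov

/-! ### The Hilbert space model of `𝒢` -/

/-- Lebesgue measure on `[0,1]`. -/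
abbrev unitVol : Measure ℝ := volume.restrict (Set.Icc (0 : ℝ) 1)

instance : IsProbabilityMeasure unitVol := ⟨by simp [unitVol]⟩

/-- The Hilbert space model `ℝ² × L²[0,1]` of `𝒢`: the triple `(g(0), g'(0), g'')` stands for `g`. -/
abbrev Sob : Type := WithLp 2 (EuclideanSpace ℝ (Fin 2) × Lp ℝ 2 unitVol)

/-- The map `g ↦ g''`. -/
abbrev sobD : Sob →L[ℝ] Lp ℝ 2 unitVol := WithLp.sndL 2 ℝ _ _

/-- The truncated power `s ↦ (z - s)₊` in `L²[0,1]`. -/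
def ramp (z : ℝ) : Lp ℝ 2 unitVol :=
  MemLp.toLp (fun s => max (z - s) 0) (MemLp.of_bound (by fun_prop) (|z| + 1) (by
    refine (ae_restrict_iff' measurableSet_Icc).2 (Eventually.of_forall fun s hs => ?_)
    rw [Real.norm_eq_abs, abs_of_nonneg (le_max_right _ _)]
    have := le_abs_self z
    exact max_le (by linarith [hs.1]) (by positivity)))

theorem ramp_ae (z : ℝ) : ramp z =ᵐ[unitVol] fun s => max (z - s) 0 := MemLp.coeFn_toLp _

/-- The indicator of `s < z` in `L²[0,1]`, the derivative of `ramp`. -/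
def step (z : ℝ) : Lp ℝ 2 unitVol :=
  MemLp.toLp ((Set.Iio z).indicator fun _ => (1 : ℝ))
    ((memLp_const (1 : ℝ)).indicator measurableSet_Iio)

theorem step_ae (z : ℝ) : step z =ᵐ[unitVol] (Set.Iio z).indicator fun _ => (1 : ℝ) :=
  MemLp.coeFn_toLp _

theorem norm_lp_unitVol_le {C : ℝ} (hC : 0 ≤ C) (f : Lp ℝ 2 unitVol)
    (hf : ∀ᵐ s ∂unitVol, ‖f s‖ ≤ C) : ‖f‖ ≤ C := by
  have h1 : measureUnivNNReal unitVol = 1 := by simp [measureUnivNNReal]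
  simpa [h1] using Lp.norm_le_of_ae_bound hC hf

/-- The representer of the evaluation `g ↦ g(z)`. -/
def sobEval (z : ℝ) : Sob := WithLp.toLp 2 (!₂[1, z], ramp z)

/-- The representer of `g ↦ g'(z)`. -/
def sobDeriv (z : ℝ) : Sob := WithLp.toLp 2 (!₂[0, 1], step z)

/-- The function represented by an element of `Sob`. -/
def Sob.toFun (g : Sob) (z : ℝ) : ℝ := inner ℝ (sobEval z) g

/-- The derivative of the function represented by an element of `Sob`. -/
def Sob.dFun (g : Sob) (z : ℝ) : ℝ := inner ℝ (sobDeriv z) g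

theorem sob_norm_sq (g : Sob) : ‖g‖ ^ 2 = ‖g.fst‖ ^ 2 + ‖g.snd‖ ^ 2 :=
  WithLp.prod_norm_sq_eq_of_L2 g

theorem norm_ramp_le {z : ℝ} (hz : z ∈ Set.Icc (0 : ℝ) 1) : ‖ramp z‖ ≤ 1 := by
  refine norm_lp_unitVol_le zero_le_one _ ?_
  filter_upwards [ramp_ae z, ae_restrict_mem measurableSet_Icc] with s hs hs'
  rw [hs, Real.norm_eq_abs, abs_of_nonneg (le_max_right _ _)]
  exact max_le (by linarith [hs'.1, hz.2]) zero_le_one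

theorem norm_step_le (z : ℝ) : ‖step z‖ ≤ 1 := by
  refine norm_lp_unitVol_le zero_le_one _ ?_
  filter_upwards [step_ae z] with s hs
  rw [hs]
  by_cases h : s ∈ Set.Iio z <;> simp [h]

theorem norm_sobEval_le {z : ℝ} (hz : z ∈ Set.Icc (0 : ℝ) 1) : ‖sobEval z‖ ≤ 2 := by
  refine abs_le_of_sq_le_sq' ?_ (by norm_num) |>.2
  rw [sob_norm_sq]
  have h1 : ‖(sobEval z).snd‖ ≤ 1 := norm_ramp_le hz
  have h2 : ‖(sobEval z).fst‖ ^ 2 = 1 + z ^ 2 := by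
    simp [sobEval, EuclideanSpace.norm_sq_eq]
  rw [h2]
  nlinarith [hz.1, hz.2, norm_nonneg (sobEval z).snd]

theorem norm_sobDeriv_le (z : ℝ) : ‖sobDeriv z‖ ≤ 2 := by
  refine abs_le_of_sq_le_sq' ?_ (by norm_num) |>.2
  rw [sob_norm_sq]
  have h1 : ‖(sobDeriv z).snd‖ ≤ 1 := norm_step_le z
  have h2 : ‖(sobDeriv z).fst‖ ^ 2 = 1 := by
    simp [sobDeriv, EuclideanSpace.norm_sq_eq]
  rw [h2]
  nlinarith [norm_nonneg (sobDeriv z).snd]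

theorem Sob.abs_toFun_le (g : Sob) {z : ℝ} (hz : z ∈ Set.Icc (0 : ℝ) 1) :
    |g.toFun z| ≤ 2 * ‖g‖ :=
  (abs_real_inner_le_norm _ _).trans (by gcongr; exact norm_sobEval_le hz)

theorem Sob.abs_dFun_le (g : Sob) (z : ℝ) : |g.dFun z| ≤ 2 * ‖g‖ :=
  (abs_real_inner_le_norm _ _).trans (by gcongr; exact norm_sobDeriv_le z)

theorem Sob.toFun_add (g h : Sob) (z : ℝ) : (g + h).toFun z = g.toFun z + h.toFun z :=
  inner_add_right _ _ _

theorem Sob.toFun_sub (g h : Sob) (z : ℝ) : (g - h).toFun z = g.toFun z - h.toFun z :=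
  inner_sub_right _ _ _

theorem Sob.dFun_sub (g h : Sob) (z : ℝ) : (g - h).dFun z = g.dFun z - h.dFun z :=
  inner_sub_right _ _ _

theorem Sob.toFun_smul (c : ℝ) (g : Sob) (z : ℝ) : (c • g).toFun z = c * g.toFun z :=
  inner_smul_right _ _ _

theorem continuous_sobEval : Continuous sobEval := by
  have h1 : LipschitzWith 1 ramp := by
    refine LipschitzWith.of_dist_le_mul fun x y => ?_
    rw [NNReal.coe_one, one_mul, dist_eq_norm, Real.dist_eq]
    refine norm_lp_unitVol_le (abs_nonneg _) _ ?_
    filter_upwards [Lp.coeFn_sub (ramp x) (ramp y), ramp_ae x, ramp_ae y] with s h h1 h2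
    rw [h, Pi.sub_apply, h1, h2, Real.norm_eq_abs]
    refine (abs_max_sub_max_le_abs (x - s) (y - s) 0).trans (le_of_eq ?_)
    congr 1; ring
  have h2 : Continuous fun z : ℝ => (!₂[1, z] : EuclideanSpace ℝ (Fin 2)) := by fun_prop
  exact (WithLp.prod_continuous_toLp 2 _ _).comp (h2.prodMk h1.continuous)

theorem Sob.continuous_toFun (g : Sob) : Continuous g.toFun :=
  continuous_sobEval.inner continuous_const

theorem inner_unitVol (f g : Lp ℝ 2 unitVol) : inner ℝ f g = ∫ s in Set.Icc (0 : ℝ) 1, f s * g s := by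
  rw [L2.inner_def]
  exact integral_congr_ae (Eventually.of_forall fun s => by simp [mul_comm])

theorem Sob.toFun_eq (g : Sob) (z : ℝ) : g.toFun z =
    g.fst 0 + g.fst 1 * z + ∫ s in Set.Icc (0 : ℝ) 1, max (z - s) 0 * g.snd s := by
  rw [Sob.toFun, WithLp.prod_inner_apply]
  congr 1
  · simp [sobEval, PiLp.inner_apply, Fin.sum_univ_two]
  · rw [inner_unitVol]
    refine integral_congr_ae ?_
    filter_upwards [ramp_ae z] with s hs
    change ramp z s * g.snd s = _
    rw [hs]

theorem integrableOn_snd (f : Lp ℝ 2 unitVol) : IntegrableOn f (Set.Icc (0 : ℝ) 1) :=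
  (Lp.memLp f).integrable one_le_two

theorem intervalIntegrable_snd (f : Lp ℝ 2 unitVol) : IntervalIntegrable f volume 0 1 := by
  rw [intervalIntegrable_iff_integrableOn_Icc_of_le zero_le_one]
  exact integrableOn_snd f

theorem Sob.dFun_eq (g : Sob) {z : ℝ} (hz : z ∈ Set.Icc (0 : ℝ) 1) :
    g.dFun z = g.fst 1 + ∫ s in (0 : ℝ)..z, g.snd s := by
  rw [Sob.dFun, WithLp.prod_inner_apply]
  congr 1
  · simp [sobDeriv, PiLp.inner_apply, Fin.sum_univ_two]
  · rw [inner_unitVol, intervalIntegral.integral_of_le hz.1]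
    have h1 : ∀ᵐ s ∂unitVol, (sobDeriv z).ofLp.2 s * g.ofLp.2 s
        = (Set.Iio z).indicator (fun s => g.snd s) s := by
      filter_upwards [step_ae z] with s hs
      change step z s * _ = _
      rw [hs]
      by_cases h : s ∈ Set.Iio z <;> simp [h]
    rw [integral_congr_ae h1, integral_indicator measurableSet_Iio,
      Measure.restrict_restrict measurableSet_Iio, integral_Ioc_eq_integral_Ioo,
      ← integral_Ico_eq_integral_Ioo]
    congr 2
    ext s
    simp only [Set.mem_inter_iff, Set.mem_Iio, Set.mem_Icc, Set.mem_Ico]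
    constructor
    · rintro ⟨h1, h2, -⟩; exact ⟨h2, h1⟩
    · rintro ⟨h1, h2⟩; exact ⟨h2, h1, h2.le.trans hz.2⟩

/-- The twofold primitive as an integral against `ramp z`, by integration by parts. -/
theorem integral_ramp_mul {f : ℝ → ℝ} (hf : IntervalIntegrable f volume 0 1) {z : ℝ}
    (hz : z ∈ Set.Icc (0 : ℝ) 1) :
    ∫ s in Set.Icc (0 : ℝ) 1, max (z - s) 0 * f s = ∫ x in (0 : ℝ)..z, ∫ s in (0 : ℝ)..x, f s := by
  have hsub : Set.uIcc 0 z ⊆ Set.uIcc (0 : ℝ) 1 := by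
    rw [Set.uIcc_of_le hz.1, Set.uIcc_of_le zero_le_one]; exact Set.Icc_subset_Icc_right hz.2
  have hfz : IntervalIntegrable f volume 0 z := hf.mono_set hsub
  have hac := hfz.absolutelyContinuousOnInterval_intervalIntegral (c := 0) (by simp)
  have hac2 : AbsolutelyContinuousOnInterval (fun x : ℝ => x - z) 0 z :=
    (LipschitzWith.of_dist_le_mul (K := 1) fun x y => by simp).lipschitzOnWith
      |>.absolutelyContinuousOnInterval
  have h1 := hac.integral_mul_deriv_eq_deriv_mul hac2
  have h2 : deriv (fun x : ℝ => x - z) = fun _ => 1 := by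
    funext x; simp
  rw [h2] at h1
  simp only [mul_one, sub_self, mul_zero, intervalIntegral.integral_same, zero_mul, zero_sub] at h1
  rw [h1, ← intervalIntegral.integral_neg]
  have h3 : ∫ s in Set.Icc (0 : ℝ) 1, max (z - s) 0 * f s
      = ∫ s in Set.Icc (0 : ℝ) z, max (z - s) 0 * f s := by
    refine setIntegral_eq_of_subset_of_forall_sdiff_eq_zero measurableSet_Icc
      (Set.Icc_subset_Icc_right hz.2) fun s hs => ?_
    have : z < s := by
      by_contra! h; exact hs.2 ⟨hs.1.1, h⟩
    rw [max_eq_right (by linarith), zero_mul]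
  rw [h3, integral_Icc_eq_integral_Ioc, ← intervalIntegral.integral_of_le hz.1]
  refine intervalIntegral.integral_congr_ae ?_
  filter_upwards [hfz.ae_hasDerivAt_integral] with s hs hmem
  rw [(hs (Set.uIoc_subset_uIcc hmem) 0 (by simp)).deriv]
  rw [Set.uIoc_of_le hz.1] at hmem
  rw [max_eq_left (by linarith [hmem.2])]
  ring

theorem continuousOn_primitive {f : ℝ → ℝ} (hf : IntervalIntegrable f volume 0 1) :
    ContinuousOn (fun z => ∫ s in (0 : ℝ)..z, f s) (Set.Icc 0 1) := by
  have := hf.absolutelyContinuousOnInterval_intervalIntegral (c := 0) (by simp)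
  simpa [Set.uIcc_of_le (zero_le_one (α := ℝ))] using this.continuousOn

theorem hasDerivWithinAt_primitive {f : ℝ → ℝ} (hf : ContinuousOn f (Set.Icc 0 1)) {z : ℝ}
    (hz : z ∈ Set.Icc (0 : ℝ) 1) :
    HasDerivWithinAt (fun z => ∫ s in (0 : ℝ)..z, f s) (f z) (Set.Icc 0 1) z := by
  have : Fact (z ∈ Set.Icc (0 : ℝ) 1) := ⟨hz⟩
  refine intervalIntegral.integral_hasDerivWithinAt_right (s := Set.Icc 0 1) (t := Set.Icc 0 1)
    ?_ ?_ ?_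
  · exact (hf.mono (by rw [Set.uIcc_of_le hz.1]; exact Set.Icc_subset_Icc_right hz.2)).intervalIntegrable
  · exact hf.stronglyMeasurableAtFilter_nhdsWithin measurableSet_Icc z
  · exact hf z hz

theorem Sob.continuousOn_dFun (g : Sob) : ContinuousOn g.dFun (Set.Icc 0 1) :=
  ((continuousOn_const (c := g.fst 1)).add
    (continuousOn_primitive (intervalIntegrable_snd g.snd))).congr fun _ hz => g.dFun_eq hz

theorem Sob.toFun_eq_integral (g : Sob) {z : ℝ} (hz : z ∈ Set.Icc (0 : ℝ) 1) :
    g.toFun z = g.fst 0 + ∫ x in (0 : ℝ)..z, g.dFun x := by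
  have hsub : Set.uIcc 0 z ⊆ Set.Icc (0 : ℝ) 1 := by
    rw [Set.uIcc_of_le hz.1]; exact Set.Icc_subset_Icc_right hz.2
  rw [g.toFun_eq, integral_ramp_mul (intervalIntegrable_snd g.snd) hz,
    intervalIntegral.integral_congr (g := fun x => g.fst 1 + ∫ s in (0 : ℝ)..x, g.snd s)
      fun x hx => g.dFun_eq (hsub hx), intervalIntegral.integral_add]
  · simp; ring
  · simp
  · exact ((continuousOn_primitive (intervalIntegrable_snd g.snd)).mono hsub).intervalIntegrable

theorem Sob.hasDerivWithinAt_toFun (g : Sob) {z : ℝ} (hz : z ∈ Set.Icc (0 : ℝ) 1) :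
    HasDerivWithinAt g.toFun (g.dFun z) (Set.Icc 0 1) z :=
  ((hasDerivWithinAt_primitive g.continuousOn_dFun hz).const_add (g.fst 0)).congr
    (fun _ hx => g.toFun_eq_integral hx) (g.toFun_eq_integral hz)

theorem d1_congr {f g : ℝ → ℝ} (h : Set.EqOn f g (Set.Icc 0 1)) :
    Set.EqOn (d1 f) (d1 g) (Set.Icc 0 1) := fun _ hz => derivWithin_congr h (h hz)

theorem Sob.d1_toFun (g : Sob) : Set.EqOn (d1 g.toFun) g.dFun (Set.Icc 0 1) := fun z hz =>
  (g.hasDerivWithinAt_toFun hz).derivWithin (uniqueDiffOn_Icc zero_lt_one z hz)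

theorem ae_unitVol_mem_Ioo : ∀ᵐ z ∂unitVol, z ∈ Set.Ioo (0 : ℝ) 1 := by
  rw [unitVol, ← restrict_Ioo_eq_restrict_Icc]
  exact ae_restrict_mem measurableSet_Ioo

/-- The last component is the second derivative, by Lebesgue's differentiation theorem. -/
theorem Sob.d2_toFun (g : Sob) : d2 g.toFun =ᵐ[unitVol] g.snd := by
  have h1 := (intervalIntegrable_snd g.snd).ae_hasDerivAt_integral
  filter_upwards [ae_unitVol_mem_Ioo, ae_restrict_of_ae h1] with z hz h2
  have hz' := Set.Ioo_subset_Icc_self hz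
  have h3 := h2 (by rwa [Set.uIcc_of_le zero_le_one]) 0 (by simp)
  have h4 : HasDerivWithinAt g.dFun (g.snd z) (Set.Icc 0 1) z :=
    (h3.hasDerivWithinAt.const_add (g.fst 1)).congr (fun _ hx => g.dFun_eq hx) (g.dFun_eq hz')
  rw [d2, derivWithin_congr g.d1_toFun (g.d1_toFun hz')]
  exact h4.derivWithin (uniqueDiffOn_Icc zero_lt_one z hz')

theorem absolutelyContinuousOnInterval_congr {f g : ℝ → ℝ} {a b : ℝ}
    (hf : AbsolutelyContinuousOnInterval f a b) (h : Set.EqOn f g (Set.uIcc a b)) :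
    AbsolutelyContinuousOnInterval g a b := by
  rw [absolutelyContinuousOnInterval_iff] at hf ⊢
  intro ε hε
  obtain ⟨δ, hδ, H⟩ := hf ε hε
  refine ⟨δ, hδ, fun E hE hlt => ?_⟩
  convert! H E hE hlt using 1
  refine Finset.sum_congr rfl fun i hi => ?_
  rw [h (hE.1 i hi).1, h (hE.1 i hi).2]

theorem Sob.memG_toFun (g : Sob) : MemG g.toFun where
  differentiableOn := fun z hz => (g.hasDerivWithinAt_toFun hz).differentiableWithinAt
  absolutelyContinuous := by
    have h1 := (intervalIntegrable_snd g.snd).absolutelyContinuousOnInterval_intervalIntegral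
      (c := 0) (by simp)
    have h2 : AbsolutelyContinuousOnInterval (fun _ : ℝ => g.fst 1) 0 1 :=
      (LipschitzWith.const (g.fst 1)).lipschitzOnWith.absolutelyContinuousOnInterval
    refine absolutelyContinuousOnInterval_congr (h2.add h1) fun z hz => ?_
    rw [Set.uIcc_of_le zero_le_one] at hz
    rw [g.d1_toFun hz, g.dFun_eq hz]
    rfl
  memLp_d2 := (Lp.memLp g.snd).ae_eq g.d2_toFun.symm

theorem MemG.hasDerivWithinAt {g : ℝ → ℝ} (hg : MemG g) {z : ℝ} (hz : z ∈ Set.Icc (0 : ℝ) 1) :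
    HasDerivWithinAt g (d1 g z) (Set.Icc 0 1) z :=
  (hg.differentiableOn z hz).hasDerivWithinAt

/-- The element `(g(0), g'(0), g'')` of `Sob` associated with `g ∈ 𝒢`. -/
def MemG.lift {g : ℝ → ℝ} (hg : MemG g) : Sob :=
  WithLp.toLp 2 (!₂[g 0, d1 g 0], hg.memLp_d2.toLp (d2 g))

theorem MemG.lift_snd {g : ℝ → ℝ} (hg : MemG g) : hg.lift.snd =ᵐ[unitVol] d2 g :=
  hg.memLp_d2.coeFn_toLp

theorem MemG.dFun_lift {g : ℝ → ℝ} (hg : MemG g) : Set.EqOn hg.lift.dFun (d1 g) (Set.Icc 0 1) := by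
  intro z hz
  have hac : AbsolutelyContinuousOnInterval (d1 g) 0 z := hg.absolutelyContinuous.mono (by
    rw [Set.uIcc_of_le hz.1, Set.uIcc_of_le zero_le_one]; exact Set.Icc_subset_Icc_right hz.2)
  have h2 : ∫ s in (0 : ℝ)..z, hg.lift.snd s = ∫ s in (0 : ℝ)..z, deriv (d1 g) s := by
    rw [intervalIntegral.integral_of_le hz.1, intervalIntegral.integral_of_le hz.1]
    refine integral_congr_ae ?_
    have hsub : volume.restrict (Set.Ioc 0 z) ≤ unitVol :=
      Measure.restrict_mono
        (Set.Ioc_subset_Icc_self.trans (Set.Icc_subset_Icc_right hz.2)) le_rfl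
    refine ae_mono hsub ?_
    filter_upwards [hg.lift_snd, ae_unitVol_mem_Ioo] with s hs hs'
    rw [hs, d2]
    exact derivWithin_of_mem_nhds (Icc_mem_nhds hs'.1 hs'.2)
  rw [Sob.dFun_eq _ hz, h2, hac.integral_deriv_eq_sub]
  simp [MemG.lift]

/-- `𝒢` embeds into `Sob`, by the fundamental theorem of calculus for absolutely continuous
functions. -/
theorem MemG.toFun_lift {g : ℝ → ℝ} (hg : MemG g) : Set.EqOn hg.lift.toFun g (Set.Icc 0 1) := by
  intro z hz
  have hsub : Set.Icc 0 z ⊆ Set.Icc (0 : ℝ) 1 := Set.Icc_subset_Icc_right hz.2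
  have hcont : ContinuousOn (d1 g) (Set.uIcc 0 z) := by
    rw [Set.uIcc_of_le hz.1]
    have := hg.absolutelyContinuous.continuousOn
    rw [Set.uIcc_of_le zero_le_one] at this
    exact this.mono hsub
  have h1 : ∫ x in (0 : ℝ)..z, hg.lift.dFun x = ∫ x in (0 : ℝ)..z, d1 g x := by
    refine intervalIntegral.integral_congr fun x hx => hg.dFun_lift ?_
    rw [Set.uIcc_of_le hz.1] at hx
    exact hsub hx
  rw [Sob.toFun_eq_integral _ hz, h1, intervalIntegral.integral_eq_sub_of_hasDerivAt_of_le hz.1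
    (fun x hx => (hg.differentiableOn x (hsub hx)).continuousWithinAt.mono hsub)
    (fun x hx => (hg.hasDerivWithinAt (hsub (Set.Ioo_subset_Icc_self hx))).hasDerivAt
      (Icc_mem_nhds hx.1 (hx.2.trans_le hz.2))) hcont.intervalIntegrable]
  simp [MemG.lift]

theorem MemG.of_hasDerivAt {g g₁ g₂ : ℝ → ℝ} (h₁ : ∀ x, HasDerivAt g (g₁ x) x)
    (h₂ : ∀ x, HasDerivAt g₁ (g₂ x) x) (hg₂ : Continuous g₂) :
    MemG g ∧ Set.EqOn (d1 g) g₁ (Set.Icc 0 1) ∧ Set.EqOn (d2 g) g₂ (Set.Icc 0 1) := by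
  have hd1 : Set.EqOn (d1 g) g₁ (Set.Icc 0 1) := fun z hz =>
    (h₁ z).hasDerivWithinAt.derivWithin (uniqueDiffOn_Icc zero_lt_one z hz)
  have hd2 : Set.EqOn (d2 g) g₂ (Set.Icc 0 1) := fun z hz => by
    rw [d2, derivWithin_congr hd1 (hd1 hz)]
    exact (h₂ z).hasDerivWithinAt.derivWithin (uniqueDiffOn_Icc zero_lt_one z hz)
  refine ⟨⟨fun z _ => (h₁ z).differentiableAt.differentiableWithinAt, ?_, ?_⟩, hd1, hd2⟩
  · have hC1 : ContDiff ℝ 1 g₁ := by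
      rw [contDiff_one_iff_deriv]
      refine ⟨fun x => (h₂ x).differentiableAt, ?_⟩
      rwa [show deriv g₁ = g₂ from funext fun x => (h₂ x).deriv]
    refine absolutelyContinuousOnInterval_congr
      hC1.contDiffOn.absolutelyContinuousOnInterval fun z hz => ?_
    rw [Set.uIcc_of_le zero_le_one] at hz
    exact (hd1 hz).symm
  · obtain ⟨C, hC⟩ := isCompact_Icc.exists_bound_of_continuousOn (hg₂.continuousOn (s := Set.Icc 0 1))
    refine (MemLp.of_bound (f := g₂) hg₂.aestronglyMeasurable C ?_).ae_eq ?_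
    · filter_upwards [ae_restrict_mem measurableSet_Icc] with z hz using hC z hz
    · filter_upwards [ae_restrict_mem measurableSet_Icc] with z hz using (hd2 hz).symm

/-- An element of `Sob` is determined by its function on `[0,1]`. -/
theorem Sob.eq_zero_of_eqOn {g : Sob} (h : Set.EqOn g.toFun 0 (Set.Icc 0 1)) : g = 0 := by
  have hd1 : Set.EqOn (d1 g.toFun) 0 (Set.Icc 0 1) := fun z hz => by
    rw [d1_congr h hz, d1]; exact congrFun (derivWithin_zero _) z
  have hd : Set.EqOn g.dFun 0 (Set.Icc 0 1) := fun z hz => (g.d1_toFun hz).symm.trans (hd1 hz)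
  have hmem : (0 : ℝ) ∈ Set.Icc (0 : ℝ) 1 := by simp
  have h0 : g.fst 0 = 0 := by
    have := g.toFun_eq_integral hmem
    rw [h hmem] at this
    simpa using this.symm
  have h1 : g.fst 1 = 0 := by
    have := g.dFun_eq hmem
    rw [hd hmem] at this
    simpa using this.symm
  have h2 : g.snd = 0 := by
    refine Lp.ext ?_
    filter_upwards [g.d2_toFun, Lp.coeFn_zero ℝ 2 unitVol, ae_restrict_mem measurableSet_Icc]
      with z hz hz' hm
    rw [← hz, hz', d2, derivWithin_congr hd1 (hd1 hm)]
    exact congrFun (derivWithin_zero _) z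
  have h3 : g.fst = 0 := by
    ext i
    fin_cases i
    · exact h0
    · exact h1
  rw [← norm_eq_zero, ← sq_eq_zero_iff, sob_norm_sq, h2, h3]
  simp

theorem inner_lift_snd {g h : ℝ → ℝ} (hg : MemG g) (hh : MemG h) :
    inner ℝ hg.lift.snd hh.lift.snd = innerH g h := by
  rw [inner_unitVol, innerH, intervalIntegral.integral_of_le zero_le_one,
    ← integral_Icc_eq_integral_Ioc]
  refine integral_congr_ae ?_
  filter_upwards [hg.lift_snd, hh.lift_snd] with s h1 h2
  rw [h1, h2]

/-! ### Mean square errors of averages of independent variables -/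

section MeanSquare

variable {Ω S T H : Type*} [MeasurableSpace Ω] [MeasurableSpace S] [MeasurableSpace T]
  [NormedAddCommGroup H] [InnerProductSpace ℝ H]

theorem integrable_inner_of_memLp {P : Measure Ω} {f g : Ω → H} (hf : MemLp f 2 P)
    (hg : MemLp g 2 P) : Integrable (fun ω => inner ℝ (f ω) (g ω)) P := by
  refine Integrable.mono' (hf.integrable_norm_pow two_ne_zero |>.add
    (hg.integrable_norm_pow two_ne_zero)) (hf.1.inner hg.1) (Eventually.of_forall fun ω => ?_)
  have h1 : ‖inner ℝ (f ω) (g ω)‖ ≤ ‖f ω‖ * ‖g ω‖ := norm_inner_le_norm _ _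
  simp only [Pi.add_apply]
  nlinarith [sq_nonneg (‖f ω‖ - ‖g ω‖), sq_nonneg (‖f ω‖), sq_nonneg (‖g ω‖)]

variable [CompleteSpace H]

/-- The variance of an average of `n` independent copies of `Φ` is at most `E‖Φ‖² / n`. -/
theorem lintegral_average_sub_mean_sq_le {P : Measure Ω} [IsProbabilityMeasure P] {ξ : ℕ → Ω → S}
    (hξ : ∀ i, Measurable (ξ i)) (hind : Pairwise fun i j => IndepFun (ξ i) (ξ j) P)
    {ν : Measure S} (hν : ∀ i, P.map (ξ i) = ν) {Φ : S → H} (hΦ : MemLp Φ 2 ν) {n : ℕ} (hn : 0 < n) :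
    ∫⁻ ω, ‖(n : ℝ)⁻¹ • ∑ i : Fin n, Φ (ξ i ω) - ∫ s, Φ s ∂ν‖ₑ ^ 2 ∂P
      ≤ (n : ℝ≥0∞)⁻¹ * ∫⁻ s, ‖Φ s‖ₑ ^ 2 ∂ν := by
  have hνp : IsProbabilityMeasure ν := by
    rw [← hν 0]; exact Measure.isProbabilityMeasure_map (hξ 0).aemeasurable
  set m := ∫ s, Φ s ∂ν with hm
  have hΦ1 : Integrable Φ ν := hΦ.integrable one_le_two
  have hΨ : MemLp (fun s => Φ s - m) 2 ν := hΦ.sub (memLp_const m)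
  have hΨξ : ∀ i, MemLp (fun ω => Φ (ξ i ω) - m) 2 P := fun i => by
    have : MemLp (fun s => Φ s - m) 2 (P.map (ξ i)) := by rwa [hν i]
    exact this.comp_of_map (hξ i).aemeasurable
  have hmean : ∫ s, (Φ s - m) ∂ν = 0 := by
    rw [integral_sub hΦ1 (integrable_const _)]; simp [hm]
  -- distinct centred copies are uncorrelated
  have hcross : ∀ i j, ∫ ω, inner ℝ (Φ (ξ i ω) - m) (Φ (ξ j ω) - m) ∂P
      = if i = j then ∫ s, ‖Φ s - m‖ ^ 2 ∂ν else 0 := by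
    intro i j
    split_ifs with h
    · subst h
      simp_rw [real_inner_self_eq_norm_sq]
      have h2 : AEStronglyMeasurable (fun s => ‖Φ s - m‖ ^ 2) ν := hΨ.1.norm.pow 2
      rw [← hν i] at h2 ⊢
      rw [integral_map (hξ i).aemeasurable h2]
    · have hint : ∀ k, Integrable (fun s => Φ s - m) (P.map (ξ k)) := fun k => by
        rw [hν k]; exact hΨ.integrable one_le_two
      have h1 := (hind h).integral_bilin_comp_comp (hξ i).aemeasurable (hξ j).aemeasurable
        (hint i) (hint j) (innerSL ℝ)
      have h0 : ∫ ω, (Φ (ξ i ω) - m) ∂P = 0 := by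
        rw [← integral_map (hξ i).aemeasurable (hint i).1, hν i, hmean]
      rw [h0, map_zero, zero_apply] at h1
      exact h1
  have hvar : ∫ s, ‖Φ s - m‖ ^ 2 ∂ν ≤ ∫ s, ‖Φ s‖ ^ 2 ∂ν := by
    have h1 : ∀ s, ‖Φ s - m‖ ^ 2 = ‖Φ s‖ ^ 2 - 2 * inner ℝ (Φ s) m + ‖m‖ ^ 2 :=
      fun s => norm_sub_sq_real _ _
    have h3 : ∫ s, inner ℝ (Φ s) m ∂ν = ‖m‖ ^ 2 := by
      simp_rw [real_inner_comm m]
      rw [integral_inner hΦ1, ← hm, real_inner_self_eq_norm_sq]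
    simp_rw [h1]
    have h4 : Integrable (fun s => inner ℝ (Φ s) m) ν := hΦ1.inner_const m
    have h5 : Integrable (fun s => ‖Φ s‖ ^ 2 - 2 * inner ℝ (Φ s) m) ν :=
      (hΦ.integrable_norm_pow two_ne_zero).sub (h4.const_mul 2)
    rw [integral_add h5 (integrable_const _), integral_sub (hΦ.integrable_norm_pow two_ne_zero) (h4.const_mul 2),
      integral_const_mul, h3]
    simp only [integral_const, probReal_univ, one_smul]
    nlinarith [sq_nonneg ‖m‖]
  have hn' : (0 : ℝ) < n := by exact_mod_cast hn
  have havg : ∀ ω, (n : ℝ)⁻¹ • ∑ i : Fin n, Φ (ξ i ω) - m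
      = (n : ℝ)⁻¹ • ∑ i : Fin n, (Φ (ξ i ω) - m) := by
    intro ω
    rw [Finset.sum_sub_distrib, smul_sub]
    congr 1
    simp [← Nat.cast_smul_eq_nsmul ℝ, smul_smul, inv_mul_cancel₀ hn'.ne']
  have hexp : ∀ ω, ‖(n : ℝ)⁻¹ • ∑ i : Fin n, Φ (ξ i ω) - m‖ ^ 2
      = ((n : ℝ)⁻¹) ^ 2 * ∑ i : Fin n, ∑ j : Fin n, inner ℝ (Φ (ξ i ω) - m) (Φ (ξ j ω) - m) := by
    intro ω
    rw [havg, norm_smul, mul_pow, Real.norm_eq_abs, sq_abs, ← real_inner_self_eq_norm_sq, sum_inner]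
    simp_rw [inner_sum]
  have hii : ∀ i j : Fin n, Integrable (fun ω => inner ℝ (Φ (ξ i ω) - m) (Φ (ξ j ω) - m)) P :=
    fun i j => integrable_inner_of_memLp (hΨξ i) (hΨξ j)
  have hint : Integrable (fun ω => ‖(n : ℝ)⁻¹ • ∑ i : Fin n, Φ (ξ i ω) - m‖ ^ 2) P := by
    simp_rw [hexp]
    exact (integrable_finsetSum _ fun i _ => integrable_finsetSum _ fun j _ => hii i j).const_mul _
  have hreal : ∫ ω, ‖(n : ℝ)⁻¹ • ∑ i : Fin n, Φ (ξ i ω) - m‖ ^ 2 ∂P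
      ≤ (n : ℝ)⁻¹ * ∫ s, ‖Φ s‖ ^ 2 ∂ν := by
    simp_rw [hexp]
    rw [integral_const_mul, integral_finsetSum _ fun i _ => integrable_finsetSum _ fun j _ => hii i j]
    simp_rw [integral_finsetSum _ fun j _ => hii _ j, hcross, Fin.val_inj]
    simp only [Finset.sum_ite_eq, Finset.mem_univ, if_true, Finset.sum_const, Finset.card_univ,
      Fintype.card_fin, nsmul_eq_mul]
    rw [sq, mul_assoc, ← mul_assoc _ (n : ℝ), inv_mul_cancel₀ hn'.ne', one_mul]
    gcongr
  have hconv : ∀ x : H, ‖x‖ₑ ^ 2 = ENNReal.ofReal (‖x‖ ^ 2) := fun x => by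
    rw [← ofReal_norm, ENNReal.ofReal_pow (norm_nonneg _)]
  simp_rw [hconv]
  rw [← ofReal_integral_eq_lintegral_ofReal hint (Eventually.of_forall fun _ => by positivity),
    ← ofReal_integral_eq_lintegral_ofReal (hΦ.integrable_norm_pow two_ne_zero)
      (Eventually.of_forall fun _ => by positivity)]
  refine (ENNReal.ofReal_le_ofReal hreal).trans (le_of_eq ?_)
  rw [ENNReal.ofReal_mul (by positivity), ENNReal.ofReal_inv_of_pos hn', ENNReal.ofReal_natCast]

/-- The previous bound for a family `Φ · t`, integrated over the parameter `t`. -/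
theorem lintegral_lintegral_average_sub_mean_sq_le {P : Measure Ω} [IsProbabilityMeasure P]
    {ξ : ℕ → Ω → S} (hξ : ∀ i, Measurable (ξ i))
    (hind : Pairwise fun i j => IndepFun (ξ i) (ξ j) P) {ν : Measure S}
    (hν : ∀ i, P.map (ξ i) = ν) {μ : Measure T} [IsProbabilityMeasure μ] {Φ : S → T → H}
    (hΦ : StronglyMeasurable (Function.uncurry Φ)) {b : S → ℝ≥0∞}
    (hb : ∀ s t, ‖Φ s t‖ₑ ^ 2 ≤ b s) (hbi : ∫⁻ s, b s ∂ν ≠ ∞) {n : ℕ} (hn : 0 < n) :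
    AEMeasurable (fun ω => ∫⁻ t, ‖(n : ℝ)⁻¹ • ∑ i : Fin n, Φ (ξ i ω) t - ∫ s, Φ s t ∂ν‖ₑ ^ 2 ∂μ) P ∧
    ∫⁻ ω, ∫⁻ t, ‖(n : ℝ)⁻¹ • ∑ i : Fin n, Φ (ξ i ω) t - ∫ s, Φ s t ∂ν‖ₑ ^ 2 ∂μ ∂P
      ≤ (n : ℝ≥0∞)⁻¹ * ∫⁻ s, b s ∂ν := by
  have hνp : IsProbabilityMeasure ν := by
    rw [← hν 0]; exact Measure.isProbabilityMeasure_map (hξ 0).aemeasurable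
  have hsm : StronglyMeasurable fun x : Ω × T =>
      (n : ℝ)⁻¹ • ∑ i : Fin n, Φ (ξ i x.1) x.2 - ∫ s, Φ s x.2 ∂ν := by
    refine StronglyMeasurable.sub (StronglyMeasurable.const_smul
      (Finset.stronglyMeasurable_fun_sum _ fun i _ => ?_) _) ?_
    · exact hΦ.comp_measurable (((hξ i).comp measurable_fst).prodMk measurable_snd)
    · have h1 : StronglyMeasurable (Function.uncurry fun (t : T) (s : S) => Φ s t) :=
        hΦ.comp_measurable measurable_swap
      exact (h1.integral_prod_right (ν := ν)).comp_measurable measurable_snd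
  have hmeas : Measurable fun x : Ω × T =>
      ‖(n : ℝ)⁻¹ • ∑ i : Fin n, Φ (ξ i x.1) x.2 - ∫ s, Φ s x.2 ∂ν‖ₑ ^ 2 := hsm.enorm.pow_const 2
  refine ⟨hmeas.lintegral_prod_right'.aemeasurable, ?_⟩
  rw [lintegral_lintegral_swap hmeas.aemeasurable]
  have hbound : ∀ t, ∫⁻ ω, ‖(n : ℝ)⁻¹ • ∑ i : Fin n, Φ (ξ i ω) t - ∫ s, Φ s t ∂ν‖ₑ ^ 2 ∂P
      ≤ (n : ℝ≥0∞)⁻¹ * ∫⁻ s, b s ∂ν := by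
    intro t
    have hΦt : StronglyMeasurable fun s => Φ s t :=
      hΦ.comp_measurable (measurable_id.prodMk measurable_const)
    have h1 : ∫⁻ s, ‖Φ s t‖ₑ ^ 2 ∂ν ≤ ∫⁻ s, b s ∂ν := lintegral_mono fun s => hb s t
    have hL : MemLp (fun s => Φ s t) 2 ν := by
      refine ⟨hΦt.aestronglyMeasurable, ?_⟩
      rw [eLpNorm_lt_top_iff_lintegral_rpow_enorm_lt_top two_ne_zero ENNReal.ofNat_ne_top]
      simpa using h1.trans_lt hbi.lt_top
    exact (lintegral_average_sub_mean_sq_le hξ hind hν hL hn).trans (by gcongr)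
  calc _ ≤ ∫⁻ _ : T, (n : ℝ≥0∞)⁻¹ * ∫⁻ s, b s ∂ν ∂μ := lintegral_mono hbound
    _ = _ := by simp

end MeanSquare

/-! ### The operator `g ↦ E[g(Z) exp(i Wᵀ ·)]` -/

section Operators

variable {Ω : Type*} [MeasurableSpace Ω] {p : ℕ} {P : Measure Ω}
  {W : Ω → EuclideanSpace ℝ (Fin p)}

theorem norm_exp_inner (w t : EuclideanSpace ℝ (Fin p)) :
    ‖Complex.exp (Complex.I * ((inner ℝ w t : ℝ) : ℂ))‖ = 1 := by
  rw [mul_comm Complex.I, Complex.norm_exp_ofReal_mul_I]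

theorem integrable_mul_exp (hW : Measurable W) {V : Ω → ℝ} (hV : Integrable V P)
    (t : EuclideanSpace ℝ (Fin p)) :
    Integrable (fun ω => (V ω : ℂ) * Complex.exp (Complex.I * ((inner ℝ (W ω) t : ℝ) : ℂ))) P := by
  refine hV.ofReal.mul_bdd (c := 1) ?_ (Eventually.of_forall fun ω => (norm_exp_inner _ _).le)
  have : Measurable fun ω => Complex.exp (Complex.I * ((inner ℝ (W ω) t : ℝ) : ℂ)) := by fun_prop
  exact this.aestronglyMeasurable

theorem charMoment_add (hW : Measurable W) {V₁ V₂ : Ω → ℝ} (h₁ : Integrable V₁ P)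
    (h₂ : Integrable V₂ P) :
    charMoment P W (fun ω => V₁ ω + V₂ ω) = charMoment P W V₁ + charMoment P W V₂ := by
  funext t
  rw [Pi.add_apply, charMoment, charMoment, charMoment,
    ← integral_add (integrable_mul_exp hW h₁ t) (integrable_mul_exp hW h₂ t)]
  congr 1; funext ω; push_cast; ring

theorem charMoment_smul (c : ℝ) (V : Ω → ℝ) :
    charMoment P W (fun ω => c * V ω) = c • charMoment P W V := by
  funext t
  rw [Pi.smul_apply, charMoment, charMoment, Complex.real_smul, ← integral_const_mul]
  congr 1; funext ω; push_cast; ring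

theorem charMoment_congr {V₁ V₂ : Ω → ℝ} (h : V₁ =ᵐ[P] V₂) :
    charMoment P W V₁ = charMoment P W V₂ := by
  funext t
  refine integral_congr_ae ?_
  filter_upwards [h] with ω hω
  rw [hω]

theorem norm_charMoment_le [IsProbabilityMeasure P] {V : Ω → ℝ} {C : ℝ} (hC : ∀ᵐ ω ∂P, |V ω| ≤ C)
    (t : EuclideanSpace ℝ (Fin p)) : ‖charMoment P W V t‖ ≤ C := by
  refine (norm_integral_le_of_norm_le_const (C := C) ?_).trans (by simp)
  filter_upwards [hC] with ω hω
  rwa [norm_mul, norm_exp_inner, mul_one, Complex.norm_real]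

theorem charMoment_eq_cos_sin (hW : Measurable W) {V : Ω → ℝ} (hV : Integrable V P)
    (t : EuclideanSpace ℝ (Fin p)) :
    charMoment P W V t = ((∫ ω, Real.cos (inner ℝ (W ω) t) * V ω ∂P : ℝ) : ℂ)
      + ((∫ ω, Real.sin (inner ℝ (W ω) t) * V ω ∂P : ℝ) : ℂ) * Complex.I := by
  have hi := integrable_mul_exp hW hV t
  have hre : ∀ ω, ((V ω : ℂ) * Complex.exp (Complex.I * ((inner ℝ (W ω) t : ℝ) : ℂ))).re
      = Real.cos (inner ℝ (W ω) t) * V ω := fun ω => by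
    rw [Complex.re_ofReal_mul, mul_comm Complex.I, Complex.exp_ofReal_mul_I_re, mul_comm]
  have him : ∀ ω, ((V ω : ℂ) * Complex.exp (Complex.I * ((inner ℝ (W ω) t : ℝ) : ℂ))).im
      = Real.sin (inner ℝ (W ω) t) * V ω := fun ω => by
    rw [Complex.im_ofReal_mul, mul_comm Complex.I, Complex.exp_ofReal_mul_I_im, mul_comm]
  rw [← Complex.re_add_im (charMoment P W V t)]
  congr 3
  · rw [charMoment, ← RCLike.re_eq_complex_re, ← integral_re hi]
    exact integral_congr_ae (Eventually.of_forall hre)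
  · rw [charMoment, ← RCLike.im_eq_complex_im, ← integral_im hi]
    exact integral_congr_ae (Eventually.of_forall him)

theorem enorm_lp_sq {μ : Measure (EuclideanSpace ℝ (Fin p))} (f : Lp ℂ 2 μ) :
    ‖f‖ₑ ^ 2 = ∫⁻ t, ‖f t‖ₑ ^ 2 ∂μ := by
  have := eLpNorm_nnreal_pow_eq_lintegral (p := 2) (μ := μ) (f := f) two_ne_zero
  simpa [Lp.enorm_def] using this

variable (hW : Measurable W) (μ : Measure (EuclideanSpace ℝ (Fin p))) [IsProbabilityMeasure μ]

theorem charVec_ae (V : Ω → ℝ) : charVec P hW μ V =ᵐ[μ] charMoment P W V := MemLp.coeFn_toLp _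

theorem charVec_add {V₁ V₂ : Ω → ℝ} (h₁ : Integrable V₁ P) (h₂ : Integrable V₂ P) :
    charVec P hW μ (fun ω => V₁ ω + V₂ ω) = charVec P hW μ V₁ + charVec P hW μ V₂ := by
  refine Lp.ext ?_
  filter_upwards [charVec_ae hW μ V₁, charVec_ae hW μ V₂, charVec_ae (P := P) hW μ fun ω => V₁ ω + V₂ ω,
    Lp.coeFn_add (charVec P hW μ V₁) (charVec P hW μ V₂)] with t h1 h2 h3 h4
  rw [h3, h4, Pi.add_apply, h1, h2, charMoment_add hW h₁ h₂, Pi.add_apply]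

theorem charVec_smul (c : ℝ) (V : Ω → ℝ) :
    charVec P hW μ (fun ω => c * V ω) = c • charVec P hW μ V := by
  refine Lp.ext ?_
  filter_upwards [charVec_ae hW μ V, charVec_ae (P := P) hW μ fun ω => c * V ω,
    Lp.coeFn_smul c (charVec P hW μ V)] with t h1 h2 h3
  rw [h2, h3, Pi.smul_apply, h1, charMoment_smul, Pi.smul_apply]

theorem charVec_congr {V₁ V₂ : Ω → ℝ} (h : V₁ =ᵐ[P] V₂) :
    charVec P hW μ V₁ = charVec P hW μ V₂ := by
  simp only [charVec, charMoment_congr h]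

theorem enorm_charVec_sq (V : Ω → ℝ) :
    ‖charVec P hW μ V‖ₑ ^ 2 = ∫⁻ t, ‖charMoment P W V t‖ₑ ^ 2 ∂μ := by
  rw [enorm_lp_sq]
  refine lintegral_congr_ae ?_
  filter_upwards [charVec_ae (P := P) hW μ V] with t ht
  rw [ht]

theorem norm_charVec_le [IsProbabilityMeasure P] {V : Ω → ℝ} {C : ℝ} (hC0 : 0 ≤ C)
    (hC : ∀ᵐ ω ∂P, |V ω| ≤ C) : ‖charVec P hW μ V‖ ≤ C := by
  have h1 : measureUnivNNReal μ = 1 := by simp [measureUnivNNReal]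
  have := Lp.norm_le_of_ae_bound (f := charVec P hW μ V) hC0 (by
    filter_upwards [charVec_ae (P := P) hW μ V] with t ht
    rw [ht]; exact norm_charMoment_le hC t)
  simpa [h1] using this

variable {Z : Ω → ℝ} (hZ : Measurable Z) (hZI : ∀ᵐ ω ∂P, Z ω ∈ Set.Icc (0 : ℝ) 1)

include hZ hZI in
theorem memLp_toFun [IsFiniteMeasure P] (g : Sob) (q : ℝ≥0∞) : MemLp (fun ω => g.toFun (Z ω)) q P := by
  refine MemLp.of_bound (g.continuous_toFun.measurable.comp hZ).aestronglyMeasurable (2 * ‖g‖) ?_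
  filter_upwards [hZI] with ω hω using g.abs_toFun_le hω

include hZ hZI in
theorem integrable_toFun [IsFiniteMeasure P] (g : Sob) : Integrable (fun ω => g.toFun (Z ω)) P :=
  (memLp_toFun hZ hZI g 1).integrable le_rfl

/-- The operator `g ↦ E[g(Z) exp(i Wᵀ ·)]` on the Hilbert space model of `𝒢`. -/
def opK [IsProbabilityMeasure P] : Sob →L[ℝ] Lp ℂ 2 μ :=
  LinearMap.mkContinuous
    { toFun := fun g => charVec P hW μ fun ω => g.toFun (Z ω)
      map_add' := fun g h => by
        simp only [Sob.toFun_add]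
        exact charVec_add hW μ (integrable_toFun hZ hZI g) (integrable_toFun hZ hZI h)
      map_smul' := fun c g => by
        simp only [Sob.toFun_smul]
        exact charVec_smul hW μ c _ } 2 fun g =>
    norm_charVec_le hW μ (by positivity) (by
      filter_upwards [hZI] with ω hω using g.abs_toFun_le hω)

theorem opK_apply [IsProbabilityMeasure P] (g : Sob) :
    opK hW μ hZ hZI g = charVec P hW μ fun ω => g.toFun (Z ω) := rfl

/-- The Hilbert space valued moments `E[c(Wᵀ t) k_Z]`, where `k_z` represents the evaluation at
`z` and `c` is the cosine or the sine. -/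
def trigMoment (P : Measure Ω) (W : Ω → EuclideanSpace ℝ (Fin p)) (Z : Ω → ℝ) (c : ℝ → ℝ)
    (t : EuclideanSpace ℝ (Fin p)) : Sob :=
  ∫ ω, c (inner ℝ (W ω) t) • sobEval (Z ω) ∂P

include hW hZ hZI in
theorem integrable_trig [IsFiniteMeasure P] {c : ℝ → ℝ} (hc : Continuous c) (hc1 : ∀ x, |c x| ≤ 1)
    (t : EuclideanSpace ℝ (Fin p)) :
    Integrable (fun ω => c (inner ℝ (W ω) t) • sobEval (Z ω)) P := by
  refine Integrable.of_bound (C := 2) ?_ ?_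
  · have h1 : Measurable fun ω => c (inner ℝ (W ω) t) := hc.measurable.comp (by fun_prop)
    exact (h1.stronglyMeasurable.smul
      (continuous_sobEval.stronglyMeasurable.comp_measurable hZ)).aestronglyMeasurable
  · filter_upwards [hZI] with ω hω
    rw [norm_smul, Real.norm_eq_abs]
    calc |c (inner ℝ (W ω) t)| * ‖sobEval (Z ω)‖ ≤ 1 * 2 :=
          mul_le_mul (hc1 _) (norm_sobEval_le hω) (norm_nonneg _) zero_le_one
      _ = 2 := one_mul 2

include hW hZ hZI in
theorem inner_trigMoment [IsFiniteMeasure P] {c : ℝ → ℝ} (hc : Continuous c)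
    (hc1 : ∀ x, |c x| ≤ 1) (t : EuclideanSpace ℝ (Fin p)) (g : Sob) :
    inner ℝ (trigMoment P W Z c t) g = ∫ ω, c (inner ℝ (W ω) t) * g.toFun (Z ω) ∂P := by
  rw [real_inner_comm, trigMoment, ← integral_inner (integrable_trig hW hZ hZI hc hc1 t)]
  congr 1; funext ω
  rw [real_inner_smul_right, Sob.toFun, real_inner_comm g]

theorem enorm_add_mul_I_sq (a b : ℝ) : ‖(a : ℂ) + b * Complex.I‖ₑ ^ 2 = ‖a‖ₑ ^ 2 + ‖b‖ₑ ^ 2 := by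
  have hconv : ∀ {E : Type} [NormedAddCommGroup E] (x : E), ‖x‖ₑ ^ 2 = ENNReal.ofReal (‖x‖ ^ 2) :=
    fun x => by rw [← ofReal_norm, ENNReal.ofReal_pow (norm_nonneg _)]
  rw [hconv, hconv, hconv, ← ENNReal.ofReal_add (by positivity) (by positivity), ← Complex.normSq_eq_norm_sq,
    Complex.normSq_add_mul_I, Real.norm_eq_abs, Real.norm_eq_abs, sq_abs, sq_abs]

include hW hZ hZI in
theorem charMoment_toFun [IsFiniteMeasure P] (g : Sob) (t : EuclideanSpace ℝ (Fin p)) :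
    charMoment P W (fun ω => g.toFun (Z ω)) t
      = ((inner ℝ (trigMoment P W Z Real.cos t) g : ℝ) : ℂ)
        + ((inner ℝ (trigMoment P W Z Real.sin t) g : ℝ) : ℂ) * Complex.I := by
  rw [charMoment_eq_cos_sin hW (integrable_toFun hZ hZI g),
    inner_trigMoment hW hZ hZI Real.continuous_cos Real.abs_cos_le_one,
    inner_trigMoment hW hZ hZI Real.continuous_sin Real.abs_sin_le_one]

/-- The distance of two operators `opK` is controlled by the distance of the trigonometric moments
from which they are built. -/
theorem enorm_opK_sub_sq_le [IsProbabilityMeasure P] {Ω' : Type*} [MeasurableSpace Ω']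
    {P' : Measure Ω'} [IsProbabilityMeasure P'] {W' : Ω' → EuclideanSpace ℝ (Fin p)}
    (hW' : Measurable W') {Z' : Ω' → ℝ} (hZ' : Measurable Z')
    (hZI' : ∀ᵐ ω ∂P', Z' ω ∈ Set.Icc (0 : ℝ) 1) (g : Sob) :
    ‖opK hW' μ hZ' hZI' g - opK hW μ hZ hZI g‖ₑ ^ 2 ≤
      (∫⁻ t, (‖trigMoment P' W' Z' Real.cos t - trigMoment P W Z Real.cos t‖ₑ ^ 2
        + ‖trigMoment P' W' Z' Real.sin t - trigMoment P W Z Real.sin t‖ₑ ^ 2) ∂μ) * ‖g‖ₑ ^ 2 := by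
  have h1 : ‖opK hW' μ hZ' hZI' g - opK hW μ hZ hZI g‖ₑ ^ 2
      = ∫⁻ t, ‖charMoment P' W' (fun ω => g.toFun (Z' ω)) t
        - charMoment P W (fun ω => g.toFun (Z ω)) t‖ₑ ^ 2 ∂μ := by
    rw [enorm_lp_sq]
    refine lintegral_congr_ae ?_
    filter_upwards [charVec_ae (P := P) hW μ fun ω => g.toFun (Z ω),
      charVec_ae (P := P') hW' μ fun ω => g.toFun (Z' ω),
      Lp.coeFn_sub (opK hW' μ hZ' hZI' g) (opK hW μ hZ hZI g)] with t h1 h2 h3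
    rw [h3, Pi.sub_apply, opK_apply, opK_apply, h1, h2]
  rw [h1, ← lintegral_mul_const' _ _ (by simp)]
  refine lintegral_mono fun t => ?_
  have hin : ∀ x : Sob, ‖(inner ℝ x g : ℝ)‖ₑ ^ 2 ≤ ‖x‖ₑ ^ 2 * ‖g‖ₑ ^ 2 := fun x => by
    rw [← mul_pow]
    gcongr
    rw [← ofReal_norm, ← ofReal_norm, ← ofReal_norm, ← ENNReal.ofReal_mul (norm_nonneg _)]
    exact ENNReal.ofReal_le_ofReal (norm_inner_le_norm x g)
  rw [charMoment_toFun hW hZ hZI, charMoment_toFun hW' hZ' hZI', add_sub_add_comm, ← sub_mul,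
    ← Complex.ofReal_sub, ← Complex.ofReal_sub, ← inner_sub_left, ← inner_sub_left,
    enorm_add_mul_I_sq, add_mul]
  exact add_le_add (hin _) (hin _)

end Operators

section Empirical

/-- The uniform probability measure on `Fin n`: an empirical distribution is an image of it. -/
def unifMeas (n : ℕ) : Measure (Fin n) := (n : ℝ≥0∞)⁻¹ • Measure.count

theorem isProbabilityMeasure_unifMeas {n : ℕ} (hn : 0 < n) : IsProbabilityMeasure (unifMeas n) :=
  ⟨by
    rw [unifMeas, Measure.smul_apply, Measure.count_univ, smul_eq_mul]
    simp only [ENat.card_eq_coe_fintype_card, Fintype.card_fin, ENat.toENNReal_coe]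
    exact ENNReal.inv_mul_cancel (by exact_mod_cast hn.ne') (ENNReal.natCast_ne_top n)⟩

theorem integral_unifMeas {E : Type*} [NormedAddCommGroup E] [NormedSpace ℝ E] [CompleteSpace E]
    {n : ℕ} (f : Fin n → E) : ∫ i, f i ∂unifMeas n = (n : ℝ)⁻¹ • ∑ i, f i := by
  rw [unifMeas, integral_smul_measure, integral_count]
  simp

end Empirical

/-! ### The sampling error -/

section Sampling

variable {Ω : Type*} [MeasurableSpace Ω] {p : ℕ} {P : Measure Ω} [IsProbabilityMeasure P]
  {Y Z : Ω → ℝ} {W : Ω → EuclideanSpace ℝ (Fin p)}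

/-- A function of `W` is orthogonal to a variable with vanishing conditional expectation. -/
theorem integral_trig_mul_eq_zero (hW : Measurable W) {ε : Ω → ℝ} (hε : Integrable ε P)
    (h0 : P[ε | MeasurableSpace.comap W inferInstance] =ᵐ[P] 0) {c : ℝ → ℝ} (hc : Continuous c)
    (hc1 : ∀ x, |c x| ≤ 1) (t : EuclideanSpace ℝ (Fin p)) :
    ∫ ω, c (inner ℝ (W ω) t) * ε ω ∂P = 0 := by
  have hle : MeasurableSpace.comap W inferInstance ≤ (inferInstance : MeasurableSpace Ω) :=
    hW.comap_le
  have hmeas : Measurable fun w : EuclideanSpace ℝ (Fin p) => c (inner ℝ w t) :=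
    hc.measurable.comp (by fun_prop)
  have hsm : StronglyMeasurable[MeasurableSpace.comap W inferInstance]
      fun ω => c (inner ℝ (W ω) t) :=
    (hmeas.comp (comap_measurable W)).stronglyMeasurable
  have hint : Integrable (fun ω => c (inner ℝ (W ω) t) * ε ω) P :=
    hε.bdd_mul (c := 1) (hmeas.comp hW).aestronglyMeasurable (Eventually.of_forall fun ω => hc1 _)
  have h1 := condExp_mul_of_stronglyMeasurable_left hsm hint hε
  have h2 : ∫ ω, c (inner ℝ (W ω) t) * ε ω ∂P
      = ∫ ω, (P[fun ω => c (inner ℝ (W ω) t) * ε ω | MeasurableSpace.comap W inferInstance]) ω ∂P :=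
    (integral_condExp hle).symm
  rw [h2]
  refine integral_eq_zero_of_ae ?_
  filter_upwards [h1, h0] with ω h3 h4
  refine Eq.trans h3 ?_
  rw [Pi.mul_apply, h4]; simp

variable {Ys Zs : ℕ → Ω → ℝ} {Ws : ℕ → Ω → EuclideanSpace ℝ (Fin p)}

/-- Mean square error of the empirical version of `trigMoment`. -/
theorem lintegral_trigMoment_sub_sq_le (hY : Measurable Y) (hZ : Measurable Z) (hW : Measurable W)
    (hZI : ∀ᵐ ω ∂P, Z ω ∈ Set.Icc (0 : ℝ) 1)
    (hYs : ∀ i, Measurable (Ys i)) (hZs : ∀ i, Measurable (Zs i)) (hWs : ∀ i, Measurable (Ws i))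
    (hindep : iIndepFun (fun i ω => (Ys i ω, Zs i ω, Ws i ω)) P)
    (hident : ∀ i, IdentDistrib (fun ω => (Ys i ω, Zs i ω, Ws i ω))
      (fun ω => (Y ω, Z ω, W ω)) P P)
    (μ : Measure (EuclideanSpace ℝ (Fin p))) [IsProbabilityMeasure μ]
    {c : ℝ → ℝ} (hc : Continuous c) (hc1 : ∀ x, |c x| ≤ 1) {n : ℕ} (hn : 0 < n) :
    AEMeasurable (fun ω => ∫⁻ t, ‖(n : ℝ)⁻¹ • ∑ i : Fin n,
      c (inner ℝ (Ws i ω) t) • sobEval (Zs i ω) - trigMoment P W Z c t‖ₑ ^ 2 ∂μ) P ∧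
    ∫⁻ ω, ∫⁻ t, ‖(n : ℝ)⁻¹ • ∑ i : Fin n,
      c (inner ℝ (Ws i ω) t) • sobEval (Zs i ω) - trigMoment P W Z c t‖ₑ ^ 2 ∂μ ∂P
      ≤ (n : ℝ≥0∞)⁻¹ * 4 := by
  have hX : Measurable fun ω => (Y ω, Z ω, W ω) := hY.prodMk (hZ.prodMk hW)
  let Φ : ℝ × ℝ × EuclideanSpace ℝ (Fin p) → EuclideanSpace ℝ (Fin p) → Sob :=
    fun s t => c (inner ℝ s.2.2 t) • sobEval s.2.1
  have hΦ : StronglyMeasurable (Function.uncurry Φ) := by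
    have h1 : Measurable fun x : (ℝ × ℝ × EuclideanSpace ℝ (Fin p)) × EuclideanSpace ℝ (Fin p) =>
        c (inner ℝ x.1.2.2 x.2) := hc.measurable.comp (by fun_prop)
    exact h1.stronglyMeasurable.smul (continuous_sobEval.stronglyMeasurable.comp_measurable
      (measurable_fst.comp (measurable_snd.comp measurable_fst)))
  have hb : ∀ s t, ‖Φ s t‖ₑ ^ 2 ≤ ‖sobEval s.2.1‖ₑ ^ 2 := fun s t => by
    have : ‖Φ s t‖ₑ ≤ ‖sobEval s.2.1‖ₑ := by
      rw [enorm_le_iff_norm_le, norm_smul]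
      exact mul_le_of_le_one_left (norm_nonneg _) (hc1 _)
    gcongr
  have hbi : ∫⁻ s, ‖sobEval s.2.1‖ₑ ^ 2 ∂(P.map fun ω => (Y ω, Z ω, W ω)) ≤ 4 := by
    have hm : Measurable fun s : ℝ × ℝ × EuclideanSpace ℝ (Fin p) => ‖sobEval s.2.1‖ₑ ^ 2 :=
      ((continuous_sobEval.enorm.measurable).comp
        (measurable_fst.comp measurable_snd)).pow_const 2
    rw [lintegral_map hm hX]
    calc _ ≤ ∫⁻ _, (4 : ℝ≥0∞) ∂P := by
          refine lintegral_mono_ae ?_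
          filter_upwards [hZI] with ω hω
          have h2 : ‖sobEval (Z ω)‖ₑ ≤ 2 := by
            rw [← ofReal_norm]
            exact ENNReal.ofReal_le_of_le_toReal (by simpa using norm_sobEval_le hω)
          calc ‖sobEval (Z ω)‖ₑ ^ 2 ≤ 2 ^ 2 := by gcongr
            _ = 4 := by norm_num
      _ = 4 := by simp
  have hmean : ∀ t, ∫ s, Φ s t ∂(P.map fun ω => (Y ω, Z ω, W ω)) = trigMoment P W Z c t :=
    fun t => by
      have h1 : Measurable fun s : ℝ × ℝ × EuclideanSpace ℝ (Fin p) => c (inner ℝ s.2.2 t) :=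
        hc.measurable.comp (by fun_prop)
      have hΦt : StronglyMeasurable fun s => Φ s t :=
        h1.stronglyMeasurable.smul (continuous_sobEval.stronglyMeasurable.comp_measurable
          (measurable_fst.comp measurable_snd))
      rw [integral_map hX.aemeasurable hΦt.aestronglyMeasurable]
      rfl
  have := lintegral_lintegral_average_sub_mean_sq_le (P := P) (μ := μ)
    (fun i => (hYs i).prodMk ((hZs i).prodMk (hWs i)))
    (fun i j h => hindep.indepFun h) (fun i => (hident i).map_eq) hΦ hb
    (hbi.trans_lt (by simp)).ne hn
  simp only [hmean] at this
  exact ⟨this.1, this.2.trans (by gcongr)⟩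

/-- Mean square error of the empirical version of `E[ε c(Wᵀ t)] = 0`. -/
theorem lintegral_noise_sq_le (hY : Measurable Y) (hZ : Measurable Z) (hW : Measurable W)
    (hYs : ∀ i, Measurable (Ys i)) (hZs : ∀ i, Measurable (Zs i)) (hWs : ∀ i, Measurable (Ws i))
    (hindep : iIndepFun (fun i ω => (Ys i ω, Zs i ω, Ws i ω)) P)
    (hident : ∀ i, IdentDistrib (fun ω => (Ys i ω, Zs i ω, Ws i ω))
      (fun ω => (Y ω, Z ω, W ω)) P P)
    (μ : Measure (EuclideanSpace ℝ (Fin p))) [IsProbabilityMeasure μ]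
    {c : ℝ → ℝ} (hc : Continuous c) (hc1 : ∀ x, |c x| ≤ 1) (γ : Sob)
    (hε : MemLp (fun ω => Y ω - γ.toFun (Z ω)) 2 P)
    (hmodel : P[fun ω => Y ω - γ.toFun (Z ω) | MeasurableSpace.comap W inferInstance] =ᵐ[P] 0)
    {n : ℕ} (hn : 0 < n) :
    AEMeasurable (fun ω => ∫⁻ t, ‖(n : ℝ)⁻¹ • ∑ i : Fin n,
      c (inner ℝ (Ws i ω) t) * (Ys i ω - γ.toFun (Zs i ω))‖ₑ ^ 2 ∂μ) P ∧
    ∫⁻ ω, ∫⁻ t, ‖(n : ℝ)⁻¹ • ∑ i : Fin n,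
      c (inner ℝ (Ws i ω) t) * (Ys i ω - γ.toFun (Zs i ω))‖ₑ ^ 2 ∂μ ∂P
      ≤ (n : ℝ≥0∞)⁻¹ * ∫⁻ ω, ‖Y ω - γ.toFun (Z ω)‖ₑ ^ 2 ∂P := by
  have hX : Measurable fun ω => (Y ω, Z ω, W ω) := hY.prodMk (hZ.prodMk hW)
  let Φ : ℝ × ℝ × EuclideanSpace ℝ (Fin p) → EuclideanSpace ℝ (Fin p) → ℝ :=
    fun s t => c (inner ℝ s.2.2 t) * (s.1 - γ.toFun s.2.1)
  have hγ : Measurable γ.toFun := γ.continuous_toFun.measurable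
  have hΦ : StronglyMeasurable (Function.uncurry Φ) := by
    refine Measurable.stronglyMeasurable ?_
    have h1 : Measurable fun x : (ℝ × ℝ × EuclideanSpace ℝ (Fin p)) × EuclideanSpace ℝ (Fin p) =>
        c (inner ℝ x.1.2.2 x.2) := hc.measurable.comp (by fun_prop)
    exact h1.mul (by fun_prop)
  have hb : ∀ s t, ‖Φ s t‖ₑ ^ 2 ≤ ‖s.1 - γ.toFun s.2.1‖ₑ ^ 2 := fun s t => by
    have : ‖Φ s t‖ₑ ≤ ‖s.1 - γ.toFun s.2.1‖ₑ := by
      rw [enorm_le_iff_norm_le, norm_mul]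
      exact mul_le_of_le_one_left (norm_nonneg _) (hc1 _)
    gcongr
  have hbi : ∫⁻ s, ‖s.1 - γ.toFun s.2.1‖ₑ ^ 2 ∂(P.map fun ω => (Y ω, Z ω, W ω))
      = ∫⁻ ω, ‖Y ω - γ.toFun (Z ω)‖ₑ ^ 2 ∂P := by
    rw [lintegral_map (by fun_prop) hX]
  have hfin : ∫⁻ ω, ‖Y ω - γ.toFun (Z ω)‖ₑ ^ 2 ∂P ≠ ∞ := by
    have := hε.2
    rw [eLpNorm_lt_top_iff_lintegral_rpow_enorm_lt_top two_ne_zero ENNReal.ofNat_ne_top] at this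
    simpa using this.ne
  have hmean : ∀ t, ∫ s, Φ s t ∂(P.map fun ω => (Y ω, Z ω, W ω)) = 0 :=
    fun t => by
      have h1 : Measurable fun s : ℝ × ℝ × EuclideanSpace ℝ (Fin p) => c (inner ℝ s.2.2 t) :=
        hc.measurable.comp (by fun_prop)
      have hΦt : StronglyMeasurable fun s => Φ s t :=
        (h1.mul (by fun_prop)).stronglyMeasurable
      rw [integral_map hX.aemeasurable hΦt.aestronglyMeasurable]
      exact integral_trig_mul_eq_zero hW (hε.integrable one_le_two) hmodel hc hc1 t
  have := lintegral_lintegral_average_sub_mean_sq_le (P := P) (μ := μ)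
    (fun i => (hYs i).prodMk ((hZs i).prodMk (hWs i)))
    (fun i j h => hindep.indepFun h) (fun i => (hident i).map_eq) hΦ hb
    (hbi ▸ hfin) hn
  simp only [hmean, sub_zero, hbi] at this
  exact this

/-- The total squared sampling error: the squared distances of the empirical trigonometric moments
from the true ones, and the squared norm of the empirical noise `n⁻¹ ∑ᵢ εᵢ exp(i Wᵢᵀ ·)`. -/
def samplingError (P : Measure Ω) (W : Ω → EuclideanSpace ℝ (Fin p)) (Z : Ω → ℝ)
    (μ : Measure (EuclideanSpace ℝ (Fin p))) (γ : Sob) {n : ℕ} (y z : Fin n → ℝ)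
    (w : Fin n → EuclideanSpace ℝ (Fin p)) : ℝ≥0∞ :=
  (∫⁻ t, ‖(n : ℝ)⁻¹ • ∑ i : Fin n, Real.cos (inner ℝ (w i) t) • sobEval (z i)
      - trigMoment P W Z Real.cos t‖ₑ ^ 2 ∂μ)
  + (∫⁻ t, ‖(n : ℝ)⁻¹ • ∑ i : Fin n, Real.sin (inner ℝ (w i) t) • sobEval (z i)
      - trigMoment P W Z Real.sin t‖ₑ ^ 2 ∂μ)
  + ((∫⁻ t, ‖(n : ℝ)⁻¹ • ∑ i : Fin n, Real.cos (inner ℝ (w i) t) * (y i - γ.toFun (z i))‖ₑ ^ 2 ∂μ)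
  + (∫⁻ t, ‖(n : ℝ)⁻¹ • ∑ i : Fin n, Real.sin (inner ℝ (w i) t) * (y i - γ.toFun (z i))‖ₑ ^ 2 ∂μ))

/-- The sampling error is of the order `1/n` in probability, by Markov's inequality. -/
theorem exists_measure_samplingError_le (hY : Measurable Y) (hZ : Measurable Z) (hW : Measurable W)
    (hZI : ∀ᵐ ω ∂P, Z ω ∈ Set.Icc (0 : ℝ) 1)
    (hYs : ∀ i, Measurable (Ys i)) (hZs : ∀ i, Measurable (Zs i)) (hWs : ∀ i, Measurable (Ws i))
    (hindep : iIndepFun (fun i ω => (Ys i ω, Zs i ω, Ws i ω)) P)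
    (hident : ∀ i, IdentDistrib (fun ω => (Ys i ω, Zs i ω, Ws i ω))
      (fun ω => (Y ω, Z ω, W ω)) P P)
    (μ : Measure (EuclideanSpace ℝ (Fin p))) [IsProbabilityMeasure μ] (γ : Sob)
    (hε : MemLp (fun ω => Y ω - γ.toFun (Z ω)) 2 P)
    (hmodel : P[fun ω => Y ω - γ.toFun (Z ω) | MeasurableSpace.comap W inferInstance] =ᵐ[P] 0) :
    ∃ M : ℝ, 0 ≤ M ∧ ∀ n : ℕ, 0 < n → ∀ R : ℝ, 0 < R →
      P {ω | ENNReal.ofReal (R ^ 2 / n) < samplingError P W Z μ γ (fun i : Fin n => Ys i ω)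
        (fun i => Zs i ω) (fun i => Ws i ω)} ≤ ENNReal.ofReal (M / R ^ 2) := by
  set e := ∫⁻ ω, ‖Y ω - γ.toFun (Z ω)‖ₑ ^ 2 ∂P with he
  have hfin : e ≠ ∞ := by
    have := hε.2
    rw [eLpNorm_lt_top_iff_lintegral_rpow_enorm_lt_top two_ne_zero ENNReal.ofNat_ne_top] at this
    simpa using this.ne
  -- `8 = 2 * 4`, where `4` bounds `‖sobEval z‖²` on `[0,1]`
  refine ⟨8 + 2 * e.toReal, by positivity, fun n hn R hR => ?_⟩
  have h1 := lintegral_trigMoment_sub_sq_le hY hZ hW hZI hYs hZs hWs hindep hident μ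
    Real.continuous_cos Real.abs_cos_le_one hn
  have h2 := lintegral_trigMoment_sub_sq_le hY hZ hW hZI hYs hZs hWs hindep hident μ
    Real.continuous_sin Real.abs_sin_le_one hn
  have h3 := lintegral_noise_sq_le hY hZ hW hYs hZs hWs hindep hident μ
    Real.continuous_cos Real.abs_cos_le_one γ hε hmodel hn
  have h4 := lintegral_noise_sq_le hY hZ hW hYs hZs hWs hindep hident μ
    Real.continuous_sin Real.abs_sin_le_one γ hε hmodel hn
  have hmeas := (h1.1.add h2.1).add (h3.1.add h4.1)
  have hint : ∫⁻ ω, samplingError P W Z μ γ (fun i : Fin n => Ys i ω)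
        (fun i => Zs i ω) (fun i => Ws i ω) ∂P ≤ (n : ℝ≥0∞)⁻¹ * (8 + 2 * e) := by
    have hadd : ∀ a b c d : Ω → ℝ≥0∞, AEMeasurable a P → AEMeasurable b P → AEMeasurable c P →
        ∫⁻ ω, (a ω + b ω + (c ω + d ω)) ∂P
          = ∫⁻ ω, a ω ∂P + ∫⁻ ω, b ω ∂P + (∫⁻ ω, c ω ∂P + ∫⁻ ω, d ω ∂P) := fun a b c d ha hb hc => by
      exact (lintegral_add_left' (ha.add hb) fun ω => c ω + d ω).trans
        (congrArg₂ _ (lintegral_add_left' ha _) (lintegral_add_left' hc _))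
    refine (hadd _ _ _ _ h1.1 h2.1 h3.1).trans_le ?_
    refine (add_le_add (add_le_add h1.2 h2.2) (add_le_add h3.2 h4.2)).trans (le_of_eq ?_)
    rw [← he]
    ring
  have hn' : (0 : ℝ) < n := by exact_mod_cast hn
  have hpos : ENNReal.ofReal (R ^ 2 / n) ≠ 0 := by
    rw [Ne, ENNReal.ofReal_eq_zero, not_le]; positivity
  calc _ ≤ P {ω | ENNReal.ofReal (R ^ 2 / n) ≤ samplingError P W Z μ γ (fun i : Fin n => Ys i ω)
        (fun i => Zs i ω) (fun i => Ws i ω)} := by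
          gcongr with ω
          exact le_of_lt
    _ ≤ (∫⁻ ω, samplingError P W Z μ γ (fun i : Fin n => Ys i ω)
        (fun i => Zs i ω) (fun i => Ws i ω) ∂P) / ENNReal.ofReal (R ^ 2 / n) :=
      meas_ge_le_lintegral_div hmeas hpos ENNReal.ofReal_ne_top
    _ ≤ ((n : ℝ≥0∞)⁻¹ * (8 + 2 * e)) / ENNReal.ofReal (R ^ 2 / n) := by gcongr
    _ = ENNReal.ofReal ((8 + 2 * e.toReal) / R ^ 2) := by
      have h5 : (n : ℝ≥0∞)⁻¹ * (8 + 2 * e) = ENNReal.ofReal ((n : ℝ)⁻¹ * (8 + 2 * e.toReal)) := by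
        rw [ENNReal.ofReal_mul (by positivity), ENNReal.ofReal_inv_of_pos hn',
          ENNReal.ofReal_natCast, ENNReal.ofReal_add (by norm_num) (by positivity),
          ENNReal.ofReal_mul (by norm_num), ENNReal.ofReal_toReal hfin]
        simp
      rw [h5, ← ENNReal.ofReal_div_of_pos (by positivity)]
      congr 1
      field_simp

end Sampling

/-! ### Injectivity and coercivity -/

section Identification

variable {Ω : Type*} [MeasurableSpace Ω] {p : ℕ} {P : Measure Ω}
  {W : Ω → EuclideanSpace ℝ (Fin p)}

theorem continuous_charMoment (hW : Measurable W) {V : Ω → ℝ} (hV : Integrable V P) :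
    Continuous (charMoment P W V) := by
  refine continuous_of_dominated (bound := fun ω => ‖V ω‖)
    (fun t => (integrable_mul_exp hW hV t).1) (fun t => Eventually.of_forall fun ω => ?_) hV.norm
    (Eventually.of_forall fun ω => by fun_prop)
  rw [norm_mul, norm_exp_inner, mul_one, Complex.norm_real]

/-- The conditional expectation given `W` vanishes as soon as all `E[V exp(i Wᵀ t)]` vanish: the
finite measures `E[(C + V) 1{W ∈ ·}]` and `E[C 1{W ∈ ·}]` have the same characteristic function. -/
theorem condExp_eq_zero_of_charMoment_eq_zero [IsProbabilityMeasure P] (hW : Measurable W)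
    {V : Ω → ℝ} (hV : Measurable V) {C : ℝ} (hC : ∀ᵐ ω ∂P, |V ω| ≤ C) (h0 : ∀ t, charMoment P W V t = 0) :
    P[V | MeasurableSpace.comap W inferInstance] =ᵐ[P] 0 := by
  have hVi : Integrable V P := Integrable.of_bound hV.aestronglyMeasurable C hC
  have hC0 : 0 ≤ C := by
    obtain ⟨ω, hω⟩ := hC.exists
    exact (abs_nonneg _).trans hω
  have hnn : ∀ᵐ ω ∂P, 0 ≤ C + V ω := by
    filter_upwards [hC] with ω hω
    linarith [neg_abs_le (V ω)]
  have hm1 : Measurable fun ω => ENNReal.ofReal (C + V ω) := by fun_prop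
  have hCV : Integrable (fun ω => C + V ω) P := (integrable_const C).add hVi
  let ν₁ := P.withDensity fun ω => ENNReal.ofReal (C + V ω)
  let ν₂ := P.withDensity fun _ => ENNReal.ofReal C
  have hf1 : IsFiniteMeasure ν₁ := isFiniteMeasure_withDensity_ofReal hCV.2
  have hf2 : IsFiniteMeasure ν₂ := isFiniteMeasure_withDensity_ofReal (integrable_const C).2
  have hexpm : ∀ t : EuclideanSpace ℝ (Fin p), Measurable fun x : EuclideanSpace ℝ (Fin p) =>
      Complex.exp ((inner ℝ x t : ℝ) * Complex.I) := fun t => by fun_prop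
  have hmap : ν₁.map W = ν₂.map W := by
    have hfm1 : IsFiniteMeasure (ν₁.map W) := Measure.isFiniteMeasure_map ν₁ W
    have hfm2 : IsFiniteMeasure (ν₂.map W) := Measure.isFiniteMeasure_map ν₂ W
    refine Measure.ext_of_charFun (funext fun t => ?_)
    rw [charFun_apply, charFun_apply, integral_map hW.aemeasurable (hexpm t).aestronglyMeasurable,
      integral_map hW.aemeasurable (hexpm t).aestronglyMeasurable,
      integral_withDensity_eq_integral_toReal_smul hm1 (by simp),
      integral_withDensity_eq_integral_toReal_smul measurable_const (by simp)]
    have h1 : ∫ ω, (ENNReal.ofReal (C + V ω)).toReal •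
        Complex.exp ((inner ℝ (W ω) t : ℝ) * Complex.I) ∂P
        = charMoment P W (fun ω => C + V ω) t := by
      refine integral_congr_ae ?_
      filter_upwards [hnn] with ω hω
      rw [ENNReal.toReal_ofReal hω, Complex.real_smul, mul_comm Complex.I]
    have h2 : ∫ ω, (ENNReal.ofReal C).toReal •
        Complex.exp ((inner ℝ (W ω) t : ℝ) * Complex.I) ∂P = charMoment P W (fun _ => C) t := by
      refine integral_congr_ae (Eventually.of_forall fun ω => ?_)
      simp only [ENNReal.toReal_ofReal hC0, Complex.real_smul, mul_comm Complex.I]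
    rw [h1, h2, charMoment_add hW (integrable_const C) hVi, Pi.add_apply, h0, add_zero]
  symm
  refine ae_eq_condExp_of_forall_setIntegral_eq hW.comap_le hVi
    (fun s _ _ => integrableOn_zero) ?_ aestronglyMeasurable_zero
  rintro s ⟨B, hB, rfl⟩ -
  have h3 : ν₁ (W ⁻¹' B) = ν₂ (W ⁻¹' B) := by
    rw [← Measure.map_apply hW hB, ← Measure.map_apply hW hB, hmap]
  rw [withDensity_apply _ (hW hB), withDensity_apply _ (hW hB),
    ← ofReal_integral_eq_lintegral_ofReal hCV.integrableOn (ae_restrict_of_ae hnn),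
    ← ofReal_integral_eq_lintegral_ofReal (integrable_const C)
      (Eventually.of_forall fun _ => hC0),
    ENNReal.ofReal_eq_ofReal_iff (integral_nonneg_of_ae (ae_restrict_of_ae hnn))
      (integral_nonneg fun _ => hC0),
    integral_add (integrable_const C) hVi.integrableOn] at h3
  rw [eq_comm]
  simpa using h3

/-- Completeness makes the operator `g ↦ E[g(Z) exp(i Wᵀ ·)]` injective on `𝒢`; the full support of
`μ` turns equality `μ`-almost everywhere into equality of continuous functions. -/
theorem injective_opK [IsProbabilityMeasure P] {Z : Ω → ℝ} (hW : Measurable W)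
    (μ : Measure (EuclideanSpace ℝ (Fin p))) [IsProbabilityMeasure μ] [μ.IsOpenPosMeasure]
    (hZ : Measurable Z) (hZI : ∀ᵐ ω ∂P, Z ω ∈ Set.Icc (0 : ℝ) 1) (hcomplete : Completeness P Z W) :
    Function.Injective (opK hW μ hZ hZI) := by
  rw [injective_iff_map_eq_zero]
  intro g hg
  have h1 : charMoment P W (fun ω => g.toFun (Z ω)) = 0 := by
    refine ((continuous_charMoment hW (integrable_toFun hZ hZI g)).ae_eq_iff_eq μ
      continuous_zero).1 ?_
    have h2 := charVec_ae (P := P) hW μ fun ω => g.toFun (Z ω)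
    rw [← opK_apply hW μ hZ hZI, hg] at h2
    exact h2.symm.trans (Lp.coeFn_zero ℂ 2 μ)
  have h3 := condExp_eq_zero_of_charMoment_eq_zero hW
    (g.continuous_toFun.measurable.comp hZ) (C := 2 * ‖g‖)
    (by filter_upwards [hZI] with ω hω using g.abs_toFun_le hω) fun t => congrFun h1 t
  have hz : (0 : Sob).toFun = fun _ => 0 := funext fun z => inner_zero_right _
  have h4 := hcomplete g.toFun (0 : Sob).toFun g.memG_toFun (0 : Sob).memG_toFun (by
    have h5 : P[fun ω => (0 : Sob).toFun (Z ω) | MeasurableSpace.comap W inferInstance] = 0 := by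
      simp only [hz]
      exact condExp_zero
    rw [h5]
    exact h3)
  rw [hz] at h4
  exact Sob.eq_zero_of_eqOn h4

end Identification

/-- The penalty `‖g''‖²` does not see the two-dimensional space of affine functions, on which an
injective operator is bounded below. -/
theorem exists_coercive {F : Type*} [NormedAddCommGroup F] [InnerProductSpace ℝ F]
    {K : Sob →L[ℝ] F} (hK : Function.Injective K) :
    ∃ c : ℝ, 0 ≤ c ∧ ∀ g, ‖g‖ ^ 2 ≤ c ^ 2 * (‖K g‖ ^ 2 + ‖sobD g‖ ^ 2) := by
  let B : EuclideanSpace ℝ (Fin 2) →ₗ[ℝ] F :=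
    { toFun := fun β => K (WithLp.toLp 2 (β, 0))
      map_add' := fun x y => by
        rw [← map_add]
        exact congrArg K (WithLp.ofLp_injective 2 (Prod.ext rfl (add_zero _).symm))
      map_smul' := fun r x => by
        rw [RingHom.id_apply, ← map_smul]
        exact congrArg K (WithLp.ofLp_injective 2 (Prod.ext rfl (smul_zero _).symm)) }
  have hB : LinearMap.ker B = ⊥ := by
    rw [LinearMap.ker_eq_bot]
    intro x y hxy
    have h1 := hK hxy
    have h2 := congrArg WithLp.fst h1
    exact h2
  obtain ⟨k, -, hk⟩ := B.exists_antilipschitzWith hB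
  have hk' : ∀ β, ‖β‖ ≤ k * ‖B β‖ := fun β => by
    have := hk.le_mul_dist β 0
    simpa [dist_eq_norm] using this
  refine ⟨√(2 * k ^ 2 * (1 + ‖K‖ ^ 2) + 1), Real.sqrt_nonneg _, fun g => ?_⟩
  rw [Real.sq_sqrt (by positivity), sob_norm_sq]
  change ‖g.fst‖ ^ 2 + ‖g.snd‖ ^ 2 ≤ _ * (‖K g‖ ^ 2 + ‖g.snd‖ ^ 2)
  have hsplit : B g.fst = K g - K (WithLp.toLp 2 (0, g.snd)) := by
    rw [← map_sub]
    change K _ = K _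
    congr 1
    refine WithLp.ofLp_injective 2 (Prod.ext ?_ ?_)
    · change g.fst = g.fst - 0
      rw [sub_zero]
    · change 0 = g.snd - g.snd
      rw [sub_self]
  have hnorm : ‖(WithLp.toLp 2 ((0 : EuclideanSpace ℝ (Fin 2)), g.snd) : Sob)‖ = ‖g.snd‖ := by
    rw [← sq_eq_sq₀ (norm_nonneg _) (norm_nonneg _), sob_norm_sq]
    simp
  have h1 : ‖B g.fst‖ ≤ ‖K g‖ + ‖K‖ * ‖g.snd‖ := by
    rw [hsplit, ← hnorm]
    exact (norm_sub_le _ _).trans (by gcongr; exact K.le_opNorm _)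
  have h2 : ‖g.fst‖ ^ 2 ≤ k ^ 2 * (2 * ‖K g‖ ^ 2 + 2 * (‖K‖ * ‖g.snd‖) ^ 2) := by
    calc ‖g.fst‖ ^ 2 ≤ (k * (‖K g‖ + ‖K‖ * ‖g.snd‖)) ^ 2 := by
          gcongr; exact (hk' _).trans (by gcongr)
      _ = k ^ 2 * (‖K g‖ + ‖K‖ * ‖g.snd‖) ^ 2 := by ring
      _ ≤ _ := by
        gcongr
        nlinarith [sq_nonneg (‖K g‖ - ‖K‖ * ‖g.snd‖)]
  have h3 : 0 ≤ (k : ℝ) ^ 2 * ‖g.snd‖ ^ 2 := by positivity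
  have h4 : 0 ≤ (k : ℝ) ^ 2 * ‖K‖ ^ 2 * ‖K g‖ ^ 2 := by positivity
  nlinarith [sq_nonneg ‖K g‖]

/-! ### Cubic splines and the kernel matrix -/

section SplineCalculus

variable {n : ℕ}

theorem hasDerivAt_mul_abs (x : ℝ) : HasDerivAt (fun x : ℝ => x * |x|) (2 * |x|) x := by
  rcases eq_or_ne x 0 with rfl | hx
  · rw [hasDerivAt_iff_tendsto_slope, abs_zero, mul_zero]
    have h1 : Tendsto (fun x : ℝ => |x|) (𝓝[≠] 0) (𝓝 0) := by
      have := (continuous_abs (G := ℝ)).tendsto 0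
      rw [abs_zero] at this
      exact this.mono_left nhdsWithin_le_nhds
    refine h1.congr' ?_
    filter_upwards [self_mem_nhdsWithin] with y hy
    rw [slope_def_field]
    have : y ≠ 0 := hy
    field_simp
    simp
  · refine ((hasDerivAt_id x).mul (hasDerivAt_abs hx)).congr_deriv ?_
    simp only [id, one_mul, mul_comm x, sign_mul_self]
    ring

theorem hasDerivAt_abs_cube (x : ℝ) : HasDerivAt (fun x : ℝ => |x| ^ 3) (3 * (x * |x|)) x := by
  have h1 : (fun x : ℝ => |x| ^ 3) = fun x => x * (x * |x|) := by
    funext y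
    rw [pow_succ, sq_abs]
    ring
  rw [h1]
  refine ((hasDerivAt_id x).mul (hasDerivAt_mul_abs x)).congr_deriv ?_
  simp only [id]
  ring

/-- The cubic spline `x ↦ a₀ + a₁ x + (1/12) ∑ᵢ δᵢ |x - zᵢ|³`; the coefficients `(δ, a)` are stored
in one vector `θ`. -/
def cubicSpline (z : Fin n → ℝ) (θ : Fin n ⊕ Fin 2 → ℝ) (x : ℝ) : ℝ :=
  θ (Sum.inr 0) + θ (Sum.inr 1) * x + (1 / 12 : ℝ) * ∑ i, θ (Sum.inl i) * |x - z i| ^ 3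

/-- The first derivative of `cubicSpline`. -/
def cubicSplineDeriv (z : Fin n → ℝ) (θ : Fin n ⊕ Fin 2 → ℝ) (x : ℝ) : ℝ :=
  θ (Sum.inr 1) + (1 / 12 : ℝ) * ∑ i, θ (Sum.inl i) * (3 * ((x - z i) * |x - z i|))

/-- The second derivative of `cubicSpline`. -/
def cubicSplineDeriv2 (z : Fin n → ℝ) (θ : Fin n ⊕ Fin 2 → ℝ) (x : ℝ) : ℝ :=
  (1 / 12 : ℝ) * ∑ i, θ (Sum.inl i) * (3 * (2 * |x - z i|))

theorem hasDerivAt_cubicSpline (z : Fin n → ℝ) (θ : Fin n ⊕ Fin 2 → ℝ) (x : ℝ) :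
    HasDerivAt (cubicSpline z θ) (cubicSplineDeriv z θ x) x := by
  have h1 : ∀ i ∈ Finset.univ, HasDerivAt (fun x => θ (Sum.inl i) * |x - z i| ^ 3)
      (θ (Sum.inl i) * (3 * ((x - z i) * |x - z i|))) x := fun i _ =>
    ((hasDerivAt_abs_cube (x - z i)).comp_sub_const x (z i)).const_mul _
  have h2 := HasDerivAt.fun_sum h1
  refine ((((hasDerivAt_id x).const_mul (θ (Sum.inr 1))).const_add (θ (Sum.inr 0))).add
    (h2.const_mul (1 / 12 : ℝ))).congr_deriv ?_
  rw [cubicSplineDeriv, mul_one]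

theorem hasDerivAt_cubicSplineDeriv (z : Fin n → ℝ) (θ : Fin n ⊕ Fin 2 → ℝ) (x : ℝ) :
    HasDerivAt (cubicSplineDeriv z θ) (cubicSplineDeriv2 z θ x) x := by
  have h1 : ∀ i ∈ Finset.univ, HasDerivAt
      (fun x => θ (Sum.inl i) * (3 * ((x - z i) * |x - z i|)))
      (θ (Sum.inl i) * (3 * (2 * |x - z i|))) x := fun i _ =>
    (((hasDerivAt_mul_abs (x - z i)).comp_sub_const x (z i)).const_mul 3).const_mul _
  exact ((HasDerivAt.fun_sum h1).const_mul (1 / 12 : ℝ)).const_add _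

theorem cubicSpline_memG (z : Fin n → ℝ) (θ : Fin n ⊕ Fin 2 → ℝ) :
    MemG (cubicSpline z θ) ∧
      Set.EqOn (d1 (cubicSpline z θ)) (cubicSplineDeriv z θ) (Set.Icc 0 1) ∧
      Set.EqOn (d2 (cubicSpline z θ)) (cubicSplineDeriv2 z θ) (Set.Icc 0 1) :=
  MemG.of_hasDerivAt (hasDerivAt_cubicSpline z θ) (hasDerivAt_cubicSplineDeriv z θ) (by
    unfold cubicSplineDeriv2; fun_prop)

/-- The element of `Sob` given by a cubic spline. -/
def splineSob (z : Fin n → ℝ) (θ : Fin n ⊕ Fin 2 → ℝ) : Sob := (cubicSpline_memG z θ).1.lift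

theorem splineSob_toFun (z : Fin n → ℝ) (θ : Fin n ⊕ Fin 2 → ℝ) {x : ℝ}
    (hx : x ∈ Set.Icc (0 : ℝ) 1) : (splineSob z θ).toFun x = cubicSpline z θ x :=
  (cubicSpline_memG z θ).1.toFun_lift hx

theorem splineSob_dFun (z : Fin n → ℝ) (θ : Fin n ⊕ Fin 2 → ℝ) {x : ℝ}
    (hx : x ∈ Set.Icc (0 : ℝ) 1) : (splineSob z θ).dFun x = deriv (cubicSpline z θ) x := by
  rw [(hasDerivAt_cubicSpline z θ x).deriv, ← (cubicSpline_memG z θ).2.1 hx]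
  exact (cubicSpline_memG z θ).1.dFun_lift hx

/-- A natural spline represents a combination of point evaluations: if `δ` is orthogonal to the
affine functions, then `∫₀¹ s'' g'' = ∑ᵢ δᵢ g(zᵢ)`. -/
theorem inner_splineSob_snd (z : Fin n → ℝ) (θ : Fin n ⊕ Fin 2 → ℝ)
    (h0 : ∑ i, θ (Sum.inl i) = 0) (h1 : ∑ i, θ (Sum.inl i) * z i = 0) (g : Sob) :
    inner ℝ (splineSob z θ).snd g.snd = ∑ i, θ (Sum.inl i) * g.toFun (z i) := by
  have hramp : ∀ i, Integrable (fun s => max (z i - s) 0 * g.snd s) unitVol := fun i => by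
    obtain ⟨C, hC⟩ := isCompact_Icc.exists_bound_of_continuousOn
      (f := fun s => max (z i - s) 0) (s := Set.Icc (0 : ℝ) 1) (by fun_prop)
    refine (integrableOn_snd g.snd).bdd_mul (c := C) (by fun_prop) ?_
    filter_upwards [ae_restrict_mem measurableSet_Icc] with s hs using hC s hs
  have hsum : ∑ i, θ (Sum.inl i) * g.toFun (z i)
      = ∫ s in Set.Icc (0 : ℝ) 1, ∑ i, θ (Sum.inl i) * (max (z i - s) 0 * g.snd s) := by
    rw [integral_finsetSum _ fun i _ => (hramp i).const_mul _]
    simp_rw [g.toFun_eq, mul_add, Finset.sum_add_distrib, integral_const_mul]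
    rw [← Finset.sum_mul, h0, zero_mul, zero_add]
    have : ∑ i, θ (Sum.inl i) * (g.fst 1 * z i) = g.fst 1 * ∑ i, θ (Sum.inl i) * z i := by
      rw [Finset.mul_sum]
      exact Finset.sum_congr rfl fun i _ => by ring
    rw [this, h1, mul_zero, zero_add]
  rw [hsum, inner_unitVol]
  refine integral_congr_ae ?_
  filter_upwards [(cubicSpline_memG z θ).1.lift_snd, ae_restrict_mem measurableSet_Icc] with s hs hm
  change (splineSob z θ).snd s = _ at hs
  rw [hs, (cubicSpline_memG z θ).2.2 hm, cubicSplineDeriv2]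
  -- `|s - z| / 2 = (z - s)₊ + (s - z) / 2`, and the last term does not contribute
  have habs : ∀ i, θ (Sum.inl i) * (3 * (2 * |s - z i|)) = 12 * (θ (Sum.inl i) * max (z i - s) 0)
      + 6 * s * θ (Sum.inl i) - 6 * (θ (Sum.inl i) * z i) := fun i => by
    rcases le_total (z i) s with h | h
    · rw [abs_of_nonneg (by linarith), max_eq_right (by linarith)]; ring
    · rw [abs_of_nonpos (by linarith), max_eq_left (by linarith)]; ring
  simp_rw [habs]
  rw [Finset.sum_sub_distrib, Finset.sum_add_distrib, ← Finset.mul_sum, ← Finset.mul_sum,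
    ← Finset.mul_sum, h0, h1, Finset.mul_sum, mul_zero, mul_zero, add_zero, sub_zero,
    Finset.mul_sum, Finset.sum_mul]
  exact Finset.sum_congr rfl fun i _ => by ring

end SplineCalculus

section KernelMatrix

variable {p n : ℕ} (μ : Measure (EuclideanSpace ℝ (Fin p))) [IsProbabilityMeasure μ]
  {w : Fin n → EuclideanSpace ℝ (Fin p)}

/-- The element `n⁻¹ ∑ᵢ vᵢ exp(i wᵢᵀ ·)` of `L²_μ`. -/
def empVec (w : Fin n → EuclideanSpace ℝ (Fin p)) (v : Fin n → ℝ) : Lp ℂ 2 μ :=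
  charVec (unifMeas n) (measurable_of_countable w) μ v

theorem integrable_unifMeas (hn : 0 < n) (v : Fin n → ℝ) : Integrable v (unifMeas n) := by
  have := isProbabilityMeasure_unifMeas hn
  exact Integrable.of_finite

theorem charMoment_unifMeas_eq (hn : 0 < n) (w : Fin n → EuclideanSpace ℝ (Fin p)) (v : Fin n → ℝ)
    (t : EuclideanSpace ℝ (Fin p)) : charMoment (unifMeas n) w v t
      = (((n : ℝ)⁻¹ • ∑ i, Real.cos (inner ℝ (w i) t) * v i : ℝ) : ℂ)
        + (((n : ℝ)⁻¹ • ∑ i, Real.sin (inner ℝ (w i) t) * v i : ℝ) : ℂ) * Complex.I := by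
  rw [charMoment_eq_cos_sin (measurable_of_countable w) (integrable_unifMeas hn v),
    integral_unifMeas, integral_unifMeas]

/-- The matrix `Ω` is the Gram matrix of the functions `n⁻¹ exp(i wᵢᵀ ·)`. -/
theorem inner_empVec (hn : 0 < n) (x y : Fin n → ℝ) :
    inner ℝ (empVec μ w x) (empVec μ w y) = x ⬝ᵥ (omegaMatrix μ w *ᵥ y) := by
  have h1 : inner ℝ (empVec μ w x) (empVec μ w y) = ∫ t, ∑ i, ∑ j,
      (x i * ((n : ℝ) ^ 2)⁻¹ * y j) * Real.cos (inner ℝ t (w i - w j)) ∂μ := by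
    rw [L2.inner_def]
    refine integral_congr_ae ?_
    filter_upwards [charVec_ae (P := unifMeas n) (measurable_of_countable w) μ x,
      charVec_ae (P := unifMeas n) (measurable_of_countable w) μ y] with t hx hy
    change inner ℝ (charVec (unifMeas n) (measurable_of_countable w) μ x t)
      (charVec (unifMeas n) (measurable_of_countable w) μ y t) = _
    rw [hx, hy, charMoment_unifMeas_eq hn, charMoment_unifMeas_eq hn, Complex.inner]
    simp only [smul_eq_mul, map_add, map_mul, Complex.conj_ofReal, Complex.conj_I,
      Complex.mul_re, Complex.add_re, Complex.add_im, Complex.mul_im, Complex.ofReal_re,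
      Complex.ofReal_im, Complex.neg_re, Complex.neg_im, Complex.I_re, Complex.I_im]
    have h2 : ∀ i j, (x i * ((n : ℝ) ^ 2)⁻¹ * y j) * Real.cos (inner ℝ t (w i - w j))
        = ((n : ℝ)⁻¹ * (Real.cos (inner ℝ (w i) t) * x i))
            * ((n : ℝ)⁻¹ * (Real.cos (inner ℝ (w j) t) * y j))
          + ((n : ℝ)⁻¹ * (Real.sin (inner ℝ (w i) t) * x i))
            * ((n : ℝ)⁻¹ * (Real.sin (inner ℝ (w j) t) * y j)) := fun i j => by
      rw [inner_sub_right, Real.cos_sub, real_inner_comm (w i), real_inner_comm (w j)]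
      ring
    simp_rw [h2, Finset.sum_add_distrib, ← Finset.sum_mul_sum, ← Finset.mul_sum]
    ring
  have hint : ∀ i j, Integrable (fun t => Real.cos (inner ℝ t (w i - w j))) μ := fun i j =>
    Integrable.of_bound (C := 1) (by fun_prop)
      (Eventually.of_forall fun t => Real.abs_cos_le_one _)
  rw [h1, integral_finsetSum _ fun i _ => integrable_finsetSum _ fun j _ => (hint i j).const_mul _]
  simp_rw [integral_finsetSum _ fun j _ => (hint _ j).const_mul _, integral_const_mul]
  simp only [dotProduct, Matrix.mulVec, omegaMatrix, Matrix.of_apply, omegaFun, Finset.mul_sum]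
  exact Finset.sum_congr rfl fun i _ => Finset.sum_congr rfl fun j _ => by ring

theorem empVec_sub (hn : 0 < n) (x y : Fin n → ℝ) :
    empVec μ w (fun i => x i - y i) = empVec μ w x - empVec μ w y := by
  rw [eq_sub_iff_add_eq, empVec, empVec, empVec,
    ← charVec_add _ _ (integrable_unifMeas hn _) (integrable_unifMeas hn _)]
  simp

/-- The exponentials `exp(i wᵢᵀ ·)` with distinct frequencies are linearly independent in `L²_μ`:
under the uniform measure on `Fin n` the conditional expectation given the injective `w` is the
variable itself. -/
theorem eq_zero_of_empVec_eq_zero [μ.IsOpenPosMeasure] (hn : 0 < n) (hw : Function.Injective w)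
    {v : Fin n → ℝ} (hv : empVec μ w v = 0) : v = 0 := by
  have := isProbabilityMeasure_unifMeas hn
  have hwm : Measurable w := measurable_of_countable w
  have h1 : charMoment (unifMeas n) w v = 0 := by
    refine ((continuous_charMoment hwm (integrable_unifMeas hn v)).ae_eq_iff_eq μ
      continuous_zero).1 ?_
    have h2 := charVec_ae (P := unifMeas n) hwm μ v
    rw [show charVec (unifMeas n) hwm μ v = 0 from hv] at h2
    exact h2.symm.trans (Lp.coeFn_zero ℂ 2 μ)
  have h3 := condExp_eq_zero_of_charMoment_eq_zero hwm (measurable_of_countable v)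
    (C := ∑ j, |v j|) (Eventually.of_forall fun i =>
      Finset.single_le_sum (f := fun j => |v j|) (fun j _ => abs_nonneg _) (Finset.mem_univ i))
    fun t => congrFun h1 t
  funext i
  have hs : MeasurableSet[MeasurableSpace.comap w inferInstance] {i} :=
    ⟨{w i}, measurableSet_singleton _, by
      ext j
      simp only [Set.mem_preimage, Set.mem_singleton_iff]
      exact hw.eq_iff⟩
  have h4 := setIntegral_condExp hwm.comap_le (integrable_unifMeas hn v) hs
  rw [integral_congr_ae (ae_restrict_of_ae h3)] at h4
  simp only [Pi.zero_apply, integral_zero] at h4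
  rw [integral_singleton] at h4
  have h5 : (unifMeas n).real {i} = (n : ℝ)⁻¹ := by
    simp [unifMeas, Measure.real]
  rw [h5] at h4
  simpa [hn.ne'] using h4.symm

theorem posDef_omegaMatrix [μ.IsOpenPosMeasure] (hn : 0 < n) (hw : Function.Injective w) :
    (omegaMatrix μ w).PosDef := by
  refine Matrix.PosDef.of_dotProduct_mulVec_pos ?_ fun x hx => ?_
  · ext i j
    simp only [Matrix.conjTranspose_apply, omegaMatrix, Matrix.of_apply, star_trivial, omegaFun]
    congr 2
    funext t
    rw [← neg_sub, inner_neg_right, Real.cos_neg]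
  · rw [star_trivial, ← inner_empVec μ hn, real_inner_self_eq_norm_sq]
    have : empVec μ w x ≠ 0 := fun h => hx (eq_zero_of_empVec_eq_zero μ hn hw h)
    positivity

end KernelMatrix

/-! ### The normal equations of the smoothing spline -/

section NormalEquations

variable {p n : ℕ} (μ : Measure (EuclideanSpace ℝ (Fin p)))
  {lam : ℝ} {z : Fin n → ℝ} {w : Fin n → EuclideanSpace ℝ (Fin p)}

theorem splineFit_eq_cubicSpline (v : Fin n → ℝ) :
    splineFit μ lam z w v = cubicSpline z (splineCoef μ lam z w v) := rfl

theorem splineCoef_smul (c : ℝ) (v : Fin n → ℝ) :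
    splineCoef μ lam z w (fun i => c * v i) = c • splineCoef μ lam z w v := by
  rw [splineCoef, splineCoef, ← Matrix.mulVec_smul]
  congr 1
  funext i
  rcases i with i | i <;> simp

theorem deriv_splineFit_smul (c : ℝ) (v : Fin n → ℝ) (x : ℝ) :
    deriv (splineFit μ lam z w fun i => c * v i) x = c * deriv (splineFit μ lam z w v) x := by
  rw [splineFit_eq_cubicSpline, splineFit_eq_cubicSpline, (hasDerivAt_cubicSpline _ _ x).deriv,
    (hasDerivAt_cubicSpline _ _ x).deriv, splineCoef_smul]
  simp only [cubicSplineDeriv, Pi.smul_apply, smul_eq_mul, mul_add, mul_assoc, Finset.mul_sum]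
  congr 1
  exact Finset.sum_congr rfl fun i _ => by ring

theorem bordered_mulVec_inl (θ : Fin n ⊕ Fin 2 → ℝ) (i : Fin n) :
    (Matrix.fromBlocks (cubicMatrix z + lam • (omegaMatrix μ w)⁻¹) (designMatrix z)
      (designMatrix z)ᵀ 0 *ᵥ θ) (Sum.inl i)
      = cubicSpline z θ (z i) + lam * ((omegaMatrix μ w)⁻¹ *ᵥ (θ ∘ Sum.inl)) i := by
  rw [Matrix.fromBlocks_mulVec, Sum.elim_inl, Pi.add_apply, Matrix.add_mulVec, Pi.add_apply,
    Matrix.smul_mulVec, Pi.smul_apply, smul_eq_mul, cubicSpline]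
  simp only [Matrix.mulVec, dotProduct, cubicMatrix, designMatrix, Matrix.of_apply,
    Fin.sum_univ_two, Function.comp_apply, Matrix.cons_val_zero, Matrix.cons_val_one,
    Finset.mul_sum]
  have : ∑ j, 1 / 12 * |z i - z j| ^ 3 * θ (Sum.inl j)
      = ∑ j, 1 / 12 * (θ (Sum.inl j) * |z i - z j| ^ 3) :=
    Finset.sum_congr rfl fun j _ => by ring
  rw [this]
  ring

theorem bordered_mulVec_inr (θ : Fin n ⊕ Fin 2 → ℝ) :
    (Matrix.fromBlocks (cubicMatrix z + lam • (omegaMatrix μ w)⁻¹) (designMatrix z)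
      (designMatrix z)ᵀ 0 *ᵥ θ) (Sum.inr 0) = ∑ i, θ (Sum.inl i) ∧
    (Matrix.fromBlocks (cubicMatrix z + lam • (omegaMatrix μ w)⁻¹) (designMatrix z)
      (designMatrix z)ᵀ 0 *ᵥ θ) (Sum.inr 1) = ∑ i, θ (Sum.inl i) * z i := by
  constructor <;>
  · rw [Matrix.fromBlocks_mulVec]
    simp [Matrix.mulVec, dotProduct, designMatrix, mul_comm]

/-- The bordered matrix is invertible: a vector `(δ, a)` in its kernel satisfies
`∫ (s'')² + lam δᵀ Ω⁻¹ δ = 0` for the corresponding spline `s`. -/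
theorem isUnit_bordered [IsProbabilityMeasure μ] [μ.IsOpenPosMeasure] (hlam : 0 < lam)
    (hw : Function.Injective w) (hz : ∀ i, z i ∈ Set.Icc (0 : ℝ) 1) (hne : ∃ i j, z i ≠ z j) :
    IsUnit (Matrix.fromBlocks (cubicMatrix z + lam • (omegaMatrix μ w)⁻¹) (designMatrix z)
      (designMatrix z)ᵀ 0) := by
  have hn : 0 < n := by
    obtain ⟨i, -⟩ := hne
    exact i.pos
  rw [← Matrix.mulVec_injective_iff_isUnit, ← Matrix.coe_mulVecLin, injective_iff_map_eq_zero]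
  intro θ hθ
  rw [Matrix.mulVecLin_apply] at hθ
  obtain ⟨h0, h1⟩ := bordered_mulVec_inr μ (lam := lam) (z := z) (w := w) θ
  rw [hθ] at h0 h1
  have hrow := bordered_mulVec_inl μ (lam := lam) (z := z) (w := w) θ
  rw [hθ] at hrow
  simp only [Pi.zero_apply] at h0 h1 hrow
  have hpos := (posDef_omegaMatrix μ hn hw).inv
  have hsq : ‖(splineSob z θ).snd‖ ^ 2 = ∑ i, θ (Sum.inl i) * cubicSpline z θ (z i) := by
    rw [← real_inner_self_eq_norm_sq, inner_splineSob_snd z θ h0.symm h1.symm]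
    exact Finset.sum_congr rfl fun i _ => by rw [splineSob_toFun z θ (hz i)]
  have hquad : ‖(splineSob z θ).snd‖ ^ 2
      + lam * ((θ ∘ Sum.inl) ⬝ᵥ ((omegaMatrix μ w)⁻¹ *ᵥ (θ ∘ Sum.inl))) = 0 := by
    rw [hsq, dotProduct, Finset.mul_sum, ← Finset.sum_add_distrib]
    refine Finset.sum_eq_zero fun i _ => ?_
    have := hrow i
    simp only [Function.comp_apply]
    linear_combination -(θ (Sum.inl i)) * this
  have hδ : θ ∘ Sum.inl = 0 := by
    by_contra hne
    have h2 := hpos.dotProduct_mulVec_pos hne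
    rw [star_trivial] at h2
    nlinarith [mul_pos hlam h2, sq_nonneg ‖(splineSob z θ).snd‖]
  have hδi : ∀ i, θ (Sum.inl i) = 0 := fun i => congrFun hδ i
  have haff : ∀ i, θ (Sum.inr 0) + θ (Sum.inr 1) * z i = 0 := fun i => by
    have := hrow i
    rw [hδ, Matrix.mulVec_zero] at this
    simpa [cubicSpline, hδi] using this.symm
  obtain ⟨i, j, hij⟩ := hne
  have ha1 : θ (Sum.inr 1) = 0 := by
    have h2 : θ (Sum.inr 1) * (z i - z j) = 0 := by linear_combination haff i - haff j
    exact (mul_eq_zero.1 h2).resolve_right (sub_ne_zero.2 hij)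
  have ha0 : θ (Sum.inr 0) = 0 := by
    have := haff i
    rwa [ha1, zero_mul, add_zero] at this
  funext k
  rcases k with k | k
  · exact hδi k
  · fin_cases k
    · exact ha0
    · exact ha1

/-- The smoothing spline solves the normal equations of penalized least squares in `L²_μ`. -/
theorem splineFit_normal_equations [IsProbabilityMeasure μ] [μ.IsOpenPosMeasure] (hlam : 0 < lam)
    (hw : Function.Injective w) (hz : ∀ i, z i ∈ Set.Icc (0 : ℝ) 1) (hne : ∃ i j, z i ≠ z j)
    (v : Fin n → ℝ) (x : Sob) :
    inner ℝ (empVec μ w (fun i => (splineSob z (splineCoef μ lam z w v)).toFun (z i))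
        - empVec μ w v) (empVec μ w fun i => x.toFun (z i))
      + lam * inner ℝ (sobD (splineSob z (splineCoef μ lam z w v))) (sobD x) = 0 := by
  have hn : 0 < n := by
    obtain ⟨i, -⟩ := hne
    exact i.pos
  set θ := splineCoef μ lam z w v with hθ
  have hsolve : Matrix.fromBlocks (cubicMatrix z + lam • (omegaMatrix μ w)⁻¹) (designMatrix z)
      (designMatrix z)ᵀ 0 *ᵥ θ = Sum.elim v 0 := by
    rw [hθ, splineCoef, smootherMatrix, Matrix.mulVec_mulVec, Matrix.mul_nonsing_inv _
      ((Matrix.isUnit_iff_isUnit_det _).1 (isUnit_bordered μ hlam hw hz hne)), Matrix.one_mulVec]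
  obtain ⟨h0, h1⟩ := bordered_mulVec_inr μ (lam := lam) (z := z) (w := w) θ
  rw [hsolve] at h0 h1
  simp only [Sum.elim_inr, Pi.zero_apply] at h0 h1
  have hrow := bordered_mulVec_inl μ (lam := lam) (z := z) (w := w) θ
  rw [hsolve] at hrow
  simp only [Sum.elim_inl] at hrow
  set δ := θ ∘ Sum.inl with hδ
  have hres : (fun i => (splineSob z θ).toFun (z i) - v i)
      = -(lam • ((omegaMatrix μ w)⁻¹ *ᵥ δ)) := by
    funext i
    rw [splineSob_toFun z θ (hz i), hrow i]
    simp
  have hunit := (Matrix.isUnit_iff_isUnit_det _).1 (posDef_omegaMatrix μ hn hw).isUnit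
  have hsymm : (omegaMatrix μ w)ᵀ = omegaMatrix μ w := by
    have := (posDef_omegaMatrix μ hn hw).isHermitian
    rwa [Matrix.IsHermitian, Matrix.conjTranspose_eq_transpose_of_trivial] at this
  rw [← empVec_sub μ hn, hres, inner_empVec μ hn, Matrix.dotProduct_mulVec,
    ← Matrix.mulVec_transpose, hsymm, Matrix.mulVec_neg, Matrix.mulVec_smul, Matrix.mulVec_mulVec,
    Matrix.mul_nonsing_inv _ hunit, Matrix.one_mulVec, neg_dotProduct, smul_dotProduct]
  change -(lam • _) + lam * inner ℝ (splineSob z θ).snd x.snd = 0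
  rw [inner_splineSob_snd z θ h0.symm h1.symm, smul_eq_mul]
  simp [hδ, dotProduct]

end NormalEquations

section DeterministicBound

variable {Ω : Type*} [MeasurableSpace Ω] {p n : ℕ} {P : Measure Ω}
  {W : Ω → EuclideanSpace ℝ (Fin p)} {Z : Ω → ℝ}

theorem norm_le_of_enorm_sq_le {E : Type*} [NormedAddCommGroup E] {x : E} {r : ℝ} (hr : 0 ≤ r)
    (h : ‖x‖ₑ ^ 2 ≤ ENNReal.ofReal (r ^ 2)) : ‖x‖ ≤ r := by
  rw [ENNReal.ofReal_pow hr, ENNReal.pow_le_pow_left_iff two_ne_zero, ← ofReal_norm,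
    ENNReal.ofReal_le_ofReal_iff hr] at h
  exact h

theorem stronglyMeasurable_trigMoment [SFinite P] (hW : Measurable W) (hZ : Measurable Z) {c : ℝ → ℝ}
    (hc : Continuous c) : StronglyMeasurable (trigMoment P W Z c) := by
  have h1 : Measurable fun x : EuclideanSpace ℝ (Fin p) × Ω => c (inner ℝ (W x.2) x.1) :=
    hc.measurable.comp (by fun_prop)
  have h2 : StronglyMeasurable fun x : EuclideanSpace ℝ (Fin p) × Ω => sobEval (Z x.2) :=
    continuous_sobEval.stronglyMeasurable.comp_measurable (hZ.comp measurable_snd)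
  exact StronglyMeasurable.integral_prod_right (ν := P) (h1.stronglyMeasurable.smul h2)

/-- Error bound for the smoothing spline in the norm of `𝒢`, given the size `r²` of the sampling
error; `u` is the deterministic regularization bias. -/
theorem norm_splineSob_error_le [IsProbabilityMeasure P] (hW : Measurable W) (hZ : Measurable Z)
    (hZI : ∀ᵐ ω ∂P, Z ω ∈ Set.Icc (0 : ℝ) 1)
    (μ : Measure (EuclideanSpace ℝ (Fin p))) [IsProbabilityMeasure μ] [μ.IsOpenPosMeasure]
    {c : ℝ} (hc0 : 0 ≤ c)
    (hc : ∀ g, ‖g‖ ^ 2 ≤ c ^ 2 * (‖opK hW μ hZ hZI g‖ ^ 2 + ‖sobD g‖ ^ 2)) {γ u : Sob} {lam : ℝ}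
    (hu : IsTikhonovBias (opK hW μ hZ hZI) sobD γ lam u) (hlam : 0 < lam) (hlam1 : lam ≤ 1)
    {y z : Fin n → ℝ} {w : Fin n → EuclideanSpace ℝ (Fin p)}
    (hw : Function.Injective w) (hz : ∀ i, z i ∈ Set.Icc (0 : ℝ) 1) (hne : ∃ i j, z i ≠ z j)
    {r : ℝ} (hr : 0 ≤ r) (hrc : 4 * c ^ 2 * r ^ 2 ≤ 1)
    (hs : samplingError P W Z μ γ y z w ≤ ENNReal.ofReal (r ^ 2)) :
    √lam * ‖(γ - splineSob z (splineCoef μ lam z w y)) - u‖ ≤ 2 * c * (1 + 4 * c * ‖sobD γ‖) * r := by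
  have hn : 0 < n := by
    obtain ⟨i, -⟩ := hne
    exact i.pos
  have hprob := isProbabilityMeasure_unifMeas hn
  -- the sample operator is `opK` for the uniform measure on `Fin n`
  set K' := opK (P := unifMeas n) (measurable_of_countable w) μ (measurable_of_countable z)
    (Eventually.of_forall hz) with hK'
  have hK'app : ∀ g : Sob, K' g = empVec μ w fun i => g.toFun (z i) := fun g => rfl
  have hs1 := (le_add_right le_rfl : _ ≤ samplingError P W Z μ γ y z w).trans hs
  have hs2 := (le_add_left le_rfl : _ ≤ samplingError P W Z μ γ y z w).trans hs
  have hδ : ∀ g, ‖K' g - opK hW μ hZ hZI g‖ ≤ r * ‖g‖ := fun g => by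
    refine norm_le_of_enorm_sq_le (by positivity) ?_
    refine (enorm_opK_sub_sq_le hW μ hZ hZI (measurable_of_countable w)
      (measurable_of_countable z) (Eventually.of_forall hz) g).trans ?_
    rw [mul_pow, ENNReal.ofReal_mul (by positivity)]
    refine mul_le_mul' ?_ (le_of_eq ?_)
    · have hmeas := ((stronglyMeasurable_trigMoment (P := unifMeas n) (measurable_of_countable w)
        (measurable_of_countable z) Real.continuous_cos).sub
        (stronglyMeasurable_trigMoment (P := P) hW hZ Real.continuous_cos)).enorm.pow_const 2
      refine (lintegral_add_left hmeas _).trans_le ?_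
      refine le_trans (le_of_eq ?_) hs1
      simp only [Pi.sub_apply, trigMoment, integral_unifMeas]
    · rw [← ofReal_norm, ENNReal.ofReal_pow (norm_nonneg _)]
  set ε := empVec μ w fun i => y i - γ.toFun (z i) with hε
  have hεn : ‖ε‖ ≤ r := by
    refine norm_le_of_enorm_sq_le hr (le_trans (le_of_eq ?_) hs2)
    rw [hε, empVec, enorm_charVec_sq]
    simp_rw [charMoment_unifMeas_eq hn, enorm_add_mul_I_sq]
    rw [lintegral_add_left']
    have : Measurable fun t : EuclideanSpace ℝ (Fin p) =>
        (n : ℝ)⁻¹ • ∑ i, Real.cos (inner ℝ (w i) t) * (y i - γ.toFun (z i)) := by fun_prop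
    exact (this.enorm.pow_const 2).aemeasurable
  have hmain := hu.norm_perturbation_le hc0 hc hlam hlam1 hr hδ hrc (ε := ε)
    (g := splineSob z (splineCoef μ lam z w y)) fun x => by
      have h1 : K' γ + ε = empVec μ w y := by
        rw [hε, empVec_sub μ hn, hK'app]
        abel
      rw [h1, hK'app, hK'app]
      exact splineFit_normal_equations μ hlam hw hz hne y x
  refine hmain.trans ?_
  rw [mul_assoc (2 * c)]
  gcongr
  linarith

end DeterministicBound

/-! ### The bias under a source condition -/

section Source

variable {Ω : Type*} [MeasurableSpace Ω] {p : ℕ} {P : Measure Ω}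
  {W : Ω → EuclideanSpace ℝ (Fin p)} {Z : Ω → ℝ}

theorem charMoment_neg (V : Ω → ℝ) (t : EuclideanSpace ℝ (Fin p)) :
    charMoment P W V (-t) = (starRingEnd ℂ) (charMoment P W V t) := by
  rw [charMoment, charMoment, ← integral_conj]
  congr 1
  funext ω
  rw [map_mul, Complex.conj_ofReal, ← Complex.exp_conj, map_mul, Complex.conj_I,
    Complex.conj_ofReal, inner_neg_right]
  push_cast
  ring_nf

theorem real_inner_eq_re (μ : Measure (EuclideanSpace ℝ (Fin p))) (f g : Lp ℂ 2 μ) :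
    inner ℝ f g = (inner ℂ f g).re := by
  rw [L2.inner_def, L2.inner_def, ← RCLike.re_eq_complex_re, ← integral_re (L2.integrable_inner f g)]
  rfl

/-- The functions `E[V exp(i Wᵀ ·)]` are Hermitian, so that their inner products are real when `μ`
is symmetric. -/
theorem inner_charVec_eq_ofReal (hW : Measurable W) (μ : Measure (EuclideanSpace ℝ (Fin p)))
    [IsProbabilityMeasure μ] (hμ : μ.map (fun t => -t) = μ) (V V' : Ω → ℝ) :
    inner ℂ (charVec P hW μ V) (charVec P hW μ V')
      = ((inner ℝ (charVec P hW μ V) (charVec P hW μ V') : ℝ) : ℂ) := by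
  have h1 : inner ℂ (charVec P hW μ V) (charVec P hW μ V')
      = ∫ t, inner ℂ (charMoment P W V t) (charMoment P W V' t) ∂μ := by
    rw [L2.inner_def]
    refine integral_congr_ae ?_
    filter_upwards [charVec_ae (P := P) hW μ V, charVec_ae (P := P) hW μ V'] with t h1 h2
    rw [h1, h2]
  rw [real_inner_eq_re]
  refine (Complex.conj_eq_iff_re.1 ?_).symm
  rw [h1]
  nth_rw 2 [← hμ]
  have h2 := integral_map_equiv (MeasurableEquiv.neg (EuclideanSpace ℝ (Fin p)))
    (fun t => inner ℂ (charMoment P W V t) (charMoment P W V' t)) (μ := μ)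
  refine Eq.trans ?_ h2.symm
  rw [← integral_conj]
  congr 1
  funext t
  change _ = inner ℂ (charMoment P W V (-t)) (charMoment P W V' (-t))
  simp [charMoment_neg]

/-- The affine function with coefficients `β`. -/
def affSob (β : EuclideanSpace ℝ (Fin 2)) : Sob := WithLp.toLp 2 (β, 0)

/-- The element of `ℋ` with second derivative `f`. -/
def pureSob (f : Lp ℝ 2 unitVol) : Sob := WithLp.toLp 2 (0, f)

theorem affSob_toFun (β : EuclideanSpace ℝ (Fin 2)) (z : ℝ) :
    (affSob β).toFun z = β 0 + β 1 * z := by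
  rw [Sob.toFun_eq]
  have : ∫ s in Set.Icc (0 : ℝ) 1, max (z - s) 0 * (affSob β).snd s = 0 := by
    refine integral_eq_zero_of_ae ?_
    filter_upwards [Lp.coeFn_zero ℝ 2 unitVol] with s hs
    change _ * (0 : Lp ℝ 2 unitVol) s = _
    rw [hs]
    simp
  rw [this, add_zero]
  rfl

theorem affSob_add_pureSob (β : EuclideanSpace ℝ (Fin 2)) (f : Lp ℝ 2 unitVol) :
    affSob β + pureSob f = WithLp.toLp 2 (β, f) :=
  WithLp.ofLp_injective 2 (Prod.ext (add_zero β) (zero_add f))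

theorem pureSob_memH (f : Lp ℝ 2 unitVol) : MemH (pureSob f).toFun := by
  have h0 : (0 : ℝ) ∈ Set.Icc (0 : ℝ) 1 := by simp
  refine ⟨(pureSob f).memG_toFun, ?_, ?_⟩
  · rw [Sob.toFun_eq_integral _ h0]
    simp [pureSob]
  · rw [Sob.d1_toFun _ h0, Sob.dFun_eq _ h0]
    simp [pureSob]

theorem innerH_pureSob (f : Lp ℝ 2 unitVol) {h : ℝ → ℝ} (hh : MemG h) :
    innerH (pureSob f).toFun h = inner ℝ f hh.lift.snd := by
  rw [← inner_lift_snd (pureSob f).memG_toFun hh]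
  congr 1
  exact Lp.ext ((MemG.lift_snd _).trans (Sob.d2_toFun _))

variable [IsProbabilityMeasure P] (hW : Measurable W) (hZ : Measurable Z)
  (hZI : ∀ᵐ ω ∂P, Z ω ∈ Set.Icc (0 : ℝ) 1)
  (μ : Measure (EuclideanSpace ℝ (Fin p))) [IsProbabilityMeasure μ]

theorem opB_eq_opK (β : Fin 2 → ℝ) :
    opB P Z hW μ β = opK hW μ hZ hZI (affSob (WithLp.toLp 2 β)) := by
  rw [opK_apply, opB]
  congr 1
  funext ω
  rw [affSob_toFun]

include hZI in
theorem opA_eq_opK {h : ℝ → ℝ} (hh : MemG h) : opA P Z hW μ h = opK hW μ hZ hZI hh.lift := by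
  rw [opK_apply, opA]
  refine charVec_congr hW μ ?_
  filter_upwards [hZI] with ω hω
  exact (hh.toFun_lift hω).symm

/-- Real orthogonality to the images of affine functions implies complex orthogonality. -/
theorem opK_mem_orthogonal (hμ : μ.map (fun t => -t) = μ) {g : Sob}
    (hg : ∀ β, inner ℝ (opK hW μ hZ hZI g) (opK hW μ hZ hZI (affSob β)) = 0) :
    opK hW μ hZ hZI g ∈ (Submodule.span ℂ (Set.range (opB P Z hW μ)))ᗮ := by
  rw [Submodule.mem_orthogonal']
  intro x hx
  induction hx using Submodule.span_induction with
  | mem x hx =>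
    obtain ⟨β, rfl⟩ := hx
    have := inner_charVec_eq_ofReal (P := P) hW μ hμ (fun ω => g.toFun (Z ω))
      (fun ω => (affSob (WithLp.toLp 2 β)).toFun (Z ω))
    rw [← opK_apply hW μ hZ hZI, ← opK_apply hW μ hZ hZI, hg] at this
    rw [opB_eq_opK hW hZ hZI, this, Complex.ofReal_zero]
  | zero => exact inner_zero_right _
  | add x y _ _ hx hy => rw [inner_add_right, hx, hy, add_zero]
  | smul a x _ hx => rw [inner_smul_right, hx, mul_zero]

/-- `T` ignores the affine part: it agrees with `opK` where the latter is orthogonal to the range of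
`B`. -/
theorem opT_pureSob {β : EuclideanSpace ℝ (Fin 2)} {f : Lp ℝ 2 unitVol}
    (hg : opK hW μ hZ hZI (WithLp.toLp 2 (β, f)) ∈
      (Submodule.span ℂ (Set.range (opB P Z hW μ)))ᗮ) :
    opT P Z hW μ (pureSob f).toFun = opK hW μ hZ hZI (WithLp.toLp 2 (β, f)) := by
  have h1 : opA P Z hW μ (pureSob f).toFun = opK hW μ hZ hZI (pureSob f) := rfl
  have h2 : opK hW μ hZ hZI (pureSob f)
      = opK hW μ hZ hZI (WithLp.toLp 2 (β, f)) - opK hW μ hZ hZI (affSob β) := by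
    rw [← affSob_add_pureSob, map_add, add_sub_cancel_left]
  have h3 : opK hW μ hZ hZI (affSob β) ∈ (Submodule.span ℂ (Set.range (opB P Z hW μ)))ᗮᗮ := by
    refine Submodule.le_orthogonal_orthogonal _ (Submodule.subset_span ⟨β, ?_⟩)
    exact opB_eq_opK hW hZ hZI μ β
  rw [opT, h1, h2, map_sub, Submodule.starProjection_eq_self_iff.2 hg,
    (Submodule.starProjection_apply_eq_zero_iff _).2 h3, sub_zero]

variable {σ : ℕ → ℝ} {φ : ℕ → ℝ → ℝ} {ψ : ℕ → Lp ℂ 2 μ}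

omit [IsProbabilityMeasure P] in
theorem opT_singular (hS : IsSingularSystem P Z hW μ σ φ ψ) (j : ℕ) :
    opT P Z hW μ (φ j) = (σ j : ℂ) • ψ j := by
  refine (hS.expansion _ (hS.memH j)).unique ?_
  convert hasSum_single j fun k hk => ?_ using 1
  · simp [hS.orthonormal_left]
  · simp [hS.orthonormal_left, hk.symm]

omit [IsProbabilityMeasure P] in
theorem inner_singular_opT (hS : IsSingularSystem P Z hW μ σ φ ψ) (j : ℕ) {h : ℝ → ℝ}
    (hh : MemH h) : inner ℂ (ψ j) (opT P Z hW μ h) = ((σ j * innerH h (φ j) : ℝ) : ℂ) := by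
  have h1 := (hS.expansion h hh).mapL (innerSL ℂ (ψ j))
  refine h1.unique ?_
  have hψ := orthonormal_iff_ite.1 hS.orthonormal_right
  convert hasSum_single j fun k hk => ?_ using 1
  · rw [innerSL_apply_apply, inner_smul_right, hψ, if_pos rfl, mul_one]
  · rw [innerSL_apply_apply, inner_smul_right, hψ, if_neg hk.symm, mul_zero]

/-- On the singular functions the normal equations are diagonal. -/
theorem inner_opK_singular (hμ : μ.map (fun t => -t) = μ)
    (hS : IsSingularSystem P Z hW μ σ φ ψ) {g : Sob}
    (hg : ∀ β, inner ℝ (opK hW μ hZ hZI g) (opK hW μ hZ hZI (affSob β)) = 0) (j : ℕ) :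
    inner ℝ (opK hW μ hZ hZI g) (opK hW μ hZ hZI (hS.memH j).toMemG.lift)
      = σ j ^ 2 * inner ℝ g.snd (hS.memH j).toMemG.lift.snd := by
  have hmem := opK_mem_orthogonal hW hZ hZI μ hμ hg
  have hT : opT P Z hW μ (pureSob g.snd).toFun = opK hW μ hZ hZI g :=
    opT_pureSob hW hZ hZI μ (β := g.fst) hmem
  have h1 : inner ℂ (opK hW μ hZ hZI (hS.memH j).toMemG.lift) (opK hW μ hZ hZI g)
      = inner ℂ (opT P Z hW μ (φ j)) (opT P Z hW μ (pureSob g.snd).toFun) := by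
    rw [hT, opT, opA_eq_opK hW hZ hZI μ (hS.memH j).toMemG,
      Submodule.inner_starProjection_left_eq_right, Submodule.starProjection_eq_self_iff.2 hmem]
  rw [real_inner_comm, real_inner_eq_re, h1, opT_singular hW μ hS, inner_smul_left,
    inner_singular_opT hW μ hS j (pureSob_memH _), innerH_pureSob g.snd (hS.memH j).toMemG,
    Complex.conj_ofReal, ← Complex.ofReal_mul, Complex.ofReal_re]
  ring

/-- Injectivity of `opK` makes the right singular functions complete. -/
theorem eq_zero_of_inner_singular_eq_zero (hμ : μ.map (fun t => -t) = μ)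
    (hK : Function.Injective (opK hW μ hZ hZI)) (hS : IsSingularSystem P Z hW μ σ φ ψ)
    {f : Lp ℝ 2 unitVol} (hf : ∀ j, inner ℝ f (hS.memH j).toMemG.lift.snd = 0) : f = 0 := by
  -- subtract from `f` the affine function that makes its image orthogonal to the range of `B`
  let B : EuclideanSpace ℝ (Fin 2) →ₗ[ℝ] Lp ℂ 2 μ :=
    { toFun := fun β => opK hW μ hZ hZI (affSob β)
      map_add' := fun x y => by
        rw [← map_add]
        exact congrArg _ (WithLp.ofLp_injective 2 (Prod.ext rfl (add_zero _).symm))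
      map_smul' := fun r x => by
        rw [RingHom.id_apply, ← map_smul]
        exact congrArg _ (WithLp.ofLp_injective 2 (Prod.ext rfl (smul_zero _).symm)) }
  obtain ⟨β, hβ⟩ := LinearMap.mem_range.1
    (Submodule.starProjection_apply_mem (LinearMap.range B) (opK hW μ hZ hZI (pureSob f)))
  set g : Sob := WithLp.toLp 2 (-β, f) with hg
  have hKg : opK hW μ hZ hZI g = opK hW μ hZ hZI (pureSob f) - B β := by
    rw [hg, ← affSob_add_pureSob, map_add]
    have : opK hW μ hZ hZI (affSob (-β)) = -B β := by rw [← map_neg]; rfl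
    rw [this]
    abel
  have horth : ∀ β', inner ℝ (opK hW μ hZ hZI g) (opK hW μ hZ hZI (affSob β')) = 0 := fun β' => by
    rw [hKg, hβ]
    exact Submodule.starProjection_inner_eq_zero _ _ (LinearMap.mem_range_self B β')
  have hmem := opK_mem_orthogonal hW hZ hZI μ hμ horth
  have hT := opT_pureSob hW hZ hZI μ hmem
  have h0 : opT P Z hW μ (pureSob f).toFun = 0 := by
    refine (hS.expansion _ (pureSob_memH f)).unique ?_
    convert hasSum_zero using 2 with j
    rw [innerH_pureSob f (hS.memH j).toMemG, hf, mul_zero, Complex.ofReal_zero, zero_smul]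
  have hg0 : g = 0 := by
    refine hK ?_
    rw [map_zero, ← h0, hT]
  have := congrArg WithLp.snd hg0
  exact this

theorem lift_snd_hPart {g₀ : ℝ → ℝ} (hg₀ : MemG g₀) : hg₀.lift.snd =ᵐ[unitVol] d2 (hPart g₀) := by
  have hd1 : Set.EqOn (d1 (hPart g₀)) (fun z => d1 g₀ z - d1 g₀ 0) (Set.Icc 0 1) := fun z hz => by
    have h1 := ((hg₀.hasDerivWithinAt hz).sub_const (g₀ 0)).sub
      ((hasDerivWithinAt_id z (Set.Icc (0 : ℝ) 1)).const_mul (d1 g₀ 0))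
    rw [mul_one] at h1
    exact h1.derivWithin (uniqueDiffOn_Icc zero_lt_one z hz)
  filter_upwards [hg₀.lift_snd, ae_restrict_mem measurableSet_Icc] with z hz hm
  rw [hz, d2, d2, derivWithin_congr hd1 (hd1 hm), derivWithin_sub_const]

theorem div_add_le_rpow {s lam θ : ℝ} (hs : 0 < s) (hlam : 0 < lam) (hθ0 : 0 ≤ θ) (hθ1 : θ ≤ 1) :
    lam / (s + lam) ≤ lam ^ θ * s ^ (-θ) := by
  have h0 : 0 < lam / (s + lam) := by positivity
  have h1 : lam / (s + lam) ≤ 1 := (div_le_one (by positivity)).2 (by linarith)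
  calc lam / (s + lam) = (lam / (s + lam)) ^ (1 : ℝ) := (Real.rpow_one _).symm
    _ ≤ (lam / (s + lam)) ^ θ := Real.rpow_le_rpow_of_exponent_ge h0 h1 hθ1
    _ ≤ (lam / s) ^ θ := by
      refine Real.rpow_le_rpow h0.le ?_ hθ0
      gcongr
      linarith
    _ = lam ^ θ * s ^ (-θ) := by
      rw [Real.div_rpow hlam.le hs.le, Real.rpow_neg hs.le, div_eq_mul_inv]

/-- The regularization bias under a source condition: in the singular basis, Tikhonov regularization
multiplies the `j`-th coefficient by `lam / (σⱼ² + lam) ≤ (lam / σⱼ²)^θ` for `θ ≤ 1`. -/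
theorem exists_norm_bias_le (hμ : μ.map (fun t => -t) = μ)
    (hK : Function.Injective (opK hW μ hZ hZI)) {g₀ : ℝ → ℝ} (hg₀ : MemG g₀) {q : ℝ} (hq : 0 < q)
    (hsource : SourceCondition P Z hW μ g₀ q) :
    ∃ C : ℝ, 0 ≤ C ∧ ∀ lam : ℝ, 0 < lam → ∀ u,
      IsTikhonovBias (opK hW μ hZ hZI) sobD hg₀.lift lam u →
        ‖sobD u‖ ≤ C * lam ^ (min q 2 / 2) := by
  obtain ⟨σ, φ, ψ, hS, hsum⟩ := hsource
  set r := min q 2 with hr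
  have hr0 : 0 < r := lt_min hq two_pos
  have hr2 : r ≤ 2 := min_le_right _ _
  have hrq : r ≤ q := min_le_left _ _
  set e : ℕ → Lp ℝ 2 unitVol := fun j => (hS.memH j).toMemG.lift.snd with he
  have heo : Orthonormal ℝ e := by
    rw [orthonormal_iff_ite]
    intro j k
    rw [he, inner_lift_snd, hS.orthonormal_left]
  have hbot : (Submodule.span ℝ (Set.range e))ᗮ = ⊥ := by
    rw [Submodule.eq_bot_iff]
    intro f hf
    refine eq_zero_of_inner_singular_eq_zero hW hZ hZI μ hμ hK hS fun j => ?_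
    exact (Submodule.mem_orthogonal' _ _).1 hf _ (Submodule.subset_span ⟨j, rfl⟩)
  let b := HilbertBasis.mkOfOrthogonalEqBot heo hbot
  have hb : ∀ j, b j = e j := fun j => by
    rw [HilbertBasis.coe_mkOfOrthogonalEqBot]
  have hfst : ∀ j, (hS.memH j).toMemG.lift.fst = 0 := fun j => by
    ext i
    fin_cases i
    · exact (hS.memH j).apply_zero
    · exact (hS.memH j).d1_zero
  -- `σ` is bounded, so the source condition with exponent `q` implies the one with `min q 2`
  have hσ : ∀ j, σ j ≤ ‖opK hW μ hZ hZI‖ := fun j => by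
    have h1 : ‖opT P Z hW μ (φ j)‖ = σ j := by
      rw [opT_singular hW μ hS, norm_smul, hS.orthonormal_right.1 j, mul_one, Complex.norm_real,
        Real.norm_of_nonneg (hS.pos j).le]
    have h2 : ‖(hS.memH j).toMemG.lift‖ = 1 := by
      rw [← sq_eq_sq₀ (norm_nonneg _) zero_le_one, sob_norm_sq, hfst j]
      have : ‖(hS.memH j).toMemG.lift.snd‖ = 1 := heo.1 j
      rw [this]; simp
    rw [← h1, opT, opA_eq_opK hW hZ hZI μ (hS.memH j).toMemG]
    refine (Submodule.norm_starProjection_apply_le _ _).trans ?_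
    simpa [h2] using (opK hW μ hZ hZI).le_opNorm (hS.memH j).toMemG.lift
  set c : ℕ → ℝ := fun j => inner ℝ hg₀.lift.snd (e j) with hcdef
  have hc : ∀ j, c j = innerH (hPart g₀) (φ j) := fun j => by
    rw [hcdef, he]
    dsimp only
    rw [inner_unitVol, innerH, intervalIntegral.integral_of_le zero_le_one,
      ← integral_Icc_eq_integral_Ioc]
    refine integral_congr_ae ?_
    filter_upwards [lift_snd_hPart hg₀, (hS.memH j).toMemG.lift_snd] with s h1 h2
    rw [h1, h2]
  have hsum2 : Summable fun j => σ j ^ (-2 * r) * c j ^ 2 := by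
    refine Summable.of_nonneg_of_le (fun j => mul_nonneg (Real.rpow_nonneg (hS.pos j).le _)
      (sq_nonneg _)) (fun j => ?_) (hsum.mul_left (‖opK hW μ hZ hZI‖ ^ (2 * (q - r))))
    rw [← hc j, sq_abs, ← mul_assoc]
    gcongr
    rw [show -2 * r = 2 * (q - r) + -2 * q by ring, Real.rpow_add (hS.pos j)]
    have := (hS.pos j).le
    gcongr
    exact hσ j
  set A := ∑' j, σ j ^ (-2 * r) * c j ^ 2 with hA
  have hA0 : 0 ≤ A := tsum_nonneg fun j => mul_nonneg (Real.rpow_nonneg (hS.pos j).le _)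
      (sq_nonneg _)
  refine ⟨√A, Real.sqrt_nonneg _, fun lam hlam u hu => ?_⟩
  have horth : ∀ β, inner ℝ (opK hW μ hZ hZI u) (opK hW μ hZ hZI (affSob β)) = 0 := fun β => by
    have h1 := hu (affSob β)
    have h2 : sobD (affSob β) = 0 := rfl
    rwa [h2, inner_zero_right, inner_zero_right, mul_zero, add_zero] at h1
  -- the coefficients of the bias in the singular basis
  have hx : ∀ j, inner ℝ u.snd (e j) = lam / (σ j ^ 2 + lam) * c j := fun j => by
    have h1 := hu (hS.memH j).toMemG.lift
    rw [inner_opK_singular hW hZ hZI μ hμ hS horth j] at h1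
    change σ j ^ 2 * inner ℝ u.snd (e j) + lam * inner ℝ u.snd (e j) = lam * c j at h1
    have h2 : 0 < σ j ^ 2 + lam := by have := hS.pos j; positivity
    field_simp
    linarith
  have hpars : HasSum (fun j => (inner ℝ u.snd (e j)) ^ 2) (‖u.snd‖ ^ 2) := by
    rw [← real_inner_self_eq_norm_sq]
    have h1 : (fun j => inner ℝ u.snd (e j) ^ 2)
        = fun j => inner ℝ u.snd (b j) * inner ℝ (b j) u.snd := by
      funext j
      rw [hb, real_inner_comm u.snd (e j), sq]
    rw [h1]
    exact b.hasSum_inner_mul_inner u.snd u.snd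
  have hle : ‖u.snd‖ ^ 2 ≤ lam ^ r * A := by
    refine hasSum_le (fun j => ?_) hpars (hsum2.hasSum.mul_left (lam ^ r))
    have hσj := hS.pos j
    have h1 := div_add_le_rpow (s := σ j ^ 2) (θ := r / 2) (by positivity) hlam (by positivity)
      (by linarith)
    have h2 : (lam ^ (r / 2) * (σ j ^ 2) ^ (-(r / 2))) ^ 2 = lam ^ r * σ j ^ (-2 * r) := by
      rw [mul_pow, ← Real.rpow_natCast, ← Real.rpow_natCast (_ ^ (-(r / 2))),
        ← Real.rpow_natCast (σ j) 2, ← Real.rpow_mul hlam.le, ← Real.rpow_mul hσj.le,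
        ← Real.rpow_mul hσj.le]
      congr 2 <;> push_cast <;> ring
    rw [hx, mul_pow, ← mul_assoc, ← h2]
    gcongr
  change ‖u.snd‖ ≤ _
  refine abs_le_of_sq_le_sq' ?_ (by positivity) |>.2
  rw [mul_pow, Real.sq_sqrt hA0, ← Real.rpow_natCast (lam ^ (r / 2)), ← Real.rpow_mul hlam.le]
  have : r / 2 * ((2 : ℕ) : ℝ) = r := by push_cast; ring
  rw [this, mul_comm]
  exact hle

end Source

/-! ### The tilting programme when the unconstrained fit is monotone -/

section Tilting

variable {p n : ℕ} {μ : Measure (EuclideanSpace ℝ (Fin p))} {lam : ℝ} {y z : Fin n → ℝ}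
  {w : Fin n → EuclideanSpace ℝ (Fin p)} {q : Fin n → ℝ}

theorem tiltObjective_eq (hsum : ∑ i, q i = 1) (hq : ∀ i, 0 ≤ q i) :
    2 * tiltObjective q = ∑ i, (√((n : ℝ) * q i) - 1) ^ 2 := by
  have h1 : ∀ i, (√((n : ℝ) * q i) - 1) ^ 2 = n * q i - 2 * √((n : ℝ) * q i) + 1 := fun i => by
    have h2 : (0 : ℝ) ≤ n * q i := mul_nonneg n.cast_nonneg (hq i)
    rw [sub_sq, Real.sq_sqrt h2]
    ring
  simp_rw [h1, Finset.sum_add_distrib, Finset.sum_sub_distrib, ← Finset.mul_sum, hsum, tiltObjective]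
  simp
  ring

theorem tiltObjective_uniform (hn : 0 < n) : tiltObjective (fun _ : Fin n => (n : ℝ)⁻¹) = 0 := by
  have hn' : (n : ℝ) ≠ 0 := by positivity
  simp [tiltObjective, hn']

theorem eq_uniform_of_tiltObjective_le (hn : 0 < n) (hsum : ∑ i, q i = 1) (hq : ∀ i, 0 ≤ q i)
    (h : tiltObjective q ≤ 0) : q = fun _ => (n : ℝ)⁻¹ := by
  have hn' : (n : ℝ) ≠ 0 := by positivity
  have h1 := tiltObjective_eq hsum hq
  have h2 : ∑ i, (√((n : ℝ) * q i) - 1) ^ 2 = 0 :=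
    le_antisymm (by linarith) (Finset.sum_nonneg fun i _ => sq_nonneg _)
  funext i
  have h3 := (Finset.sum_eq_zero_iff_of_nonneg fun i _ => sq_nonneg _).1 h2 i (Finset.mem_univ i)
  have h4 : √((n : ℝ) * q i) = 1 := by
    have := pow_eq_zero_iff two_ne_zero |>.1 h3
    linarith
  rw [Real.sqrt_eq_one] at h4
  exact eq_inv_of_mul_eq_one_right h4

/-- If the unconstrained fit is nondecreasing at the design points, the uniform weights are feasible,
and they are the only optimal ones. -/
theorem isTiltingSolution_iff (hn : 0 < n)
    (h : ∀ i, 0 ≤ deriv (splineFit μ lam z w y) (z i)) :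
    IsTiltingSolution μ lam y z w q ↔ q = fun _ => (n : ℝ)⁻¹ := by
  have hn' : (n : ℝ) ≠ 0 := by positivity
  have hfeas : IsFeasible μ lam y z w fun _ => (n : ℝ)⁻¹ := by
    refine ⟨by simp [hn'], fun i => by positivity, fun i => ?_⟩
    rw [deriv_splineFit_smul]
    exact mul_nonneg (by positivity) (h i)
  constructor
  · rintro ⟨hq, hmin⟩
    refine eq_uniform_of_tiltObjective_le hn hq.sum_eq_one hq.nonneg ?_
    rw [← tiltObjective_uniform hn]
    exact hmin _ hfeas
  · rintro rfl
    refine ⟨hfeas, fun q' hq' => ?_⟩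
    have h1 := tiltObjective_eq hq'.sum_eq_one hq'.nonneg
    have h2 : 0 ≤ ∑ i, (√((n : ℝ) * q' i) - 1) ^ 2 := Finset.sum_nonneg fun i _ => sq_nonneg _
    rw [tiltObjective_uniform hn]
    linarith

theorem reweightedFit_uniform (hn : 0 < n) :
    reweightedFit μ lam y z w (fun _ => (n : ℝ)⁻¹) = splineFit μ lam z w y := by
  have hn' : (n : ℝ) ≠ 0 := by positivity
  simp [reweightedFit, hn']

theorem supNorm_le_of_abs_le {f : ℝ → ℝ} {b : ℝ} (h : ∀ x ∈ Set.Icc (0 : ℝ) 1, |f x| ≤ b) :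
    supNorm f ≤ ENNReal.ofReal b :=
  iSup₂_le fun x hx => by
    rw [Real.enorm_eq_ofReal_abs]
    exact ENNReal.ofReal_le_ofReal (h x hx)

variable {g₀ : ℝ → ℝ} (hg₀ : MemG g₀)

include hg₀ in
theorem supNorm_splineFit_sub_le :
    supNorm (fun x => splineFit μ lam z w y x - g₀ x)
      ≤ ENNReal.ofReal (2 * ‖hg₀.lift - splineSob z (splineCoef μ lam z w y)‖) := by
  refine supNorm_le_of_abs_le fun x hx => ?_
  rw [splineFit_eq_cubicSpline, ← splineSob_toFun z _ hx, ← hg₀.toFun_lift hx, abs_sub_comm,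
    ← Sob.toFun_sub]
  exact Sob.abs_toFun_le _ hx

theorem abs_deriv_splineFit_sub_le {x : ℝ} (hx : x ∈ Set.Icc (0 : ℝ) 1) :
    |deriv (splineFit μ lam z w y) x - d1 g₀ x|
      ≤ 2 * ‖hg₀.lift - splineSob z (splineCoef μ lam z w y)‖ := by
  rw [splineFit_eq_cubicSpline, ← splineSob_dFun z _ hx, ← hg₀.dFun_lift hx, abs_sub_comm,
    ← Sob.dFun_sub]
  exact Sob.abs_dFun_le _ x

end Tilting

/-! ### Almost sure properties of the sample -/

section Sample

variable {Ω : Type*} [MeasurableSpace Ω] {P : Measure Ω}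

/-- Independent random variables, one of which has no atoms, almost surely differ. -/
theorem ae_ne_of_indepFun [IsProbabilityMeasure P] {X X' : Ω → ℝ} (hX : Measurable X) (hX' : Measurable X')
    (hind : IndepFun X X' P) (h : ∀ x, P {ω | X ω = x} = 0) : ∀ᵐ ω ∂P, X ω ≠ X' ω := by
  have hm : MeasurableSet {x : ℝ × ℝ | x.1 = x.2} := measurableSet_eq_fun measurable_fst measurable_snd
  rw [ae_iff]
  have h1 : {ω | ¬ X ω ≠ X' ω} = (fun ω => (X ω, X' ω)) ⁻¹' {x | x.1 = x.2} := by
    ext ω; simp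
  have := Measure.isProbabilityMeasure_map (μ := P) hX.aemeasurable
  have := Measure.isProbabilityMeasure_map (μ := P) hX'.aemeasurable
  rw [h1, ← Measure.map_apply (hX.prodMk hX') hm,
    (indepFun_iff_map_prod_eq_prod_map_map hX.aemeasurable hX'.aemeasurable).1 hind,
    Measure.prod_apply_symm hm]
  refine (lintegral_congr fun y => ?_).trans lintegral_zero
  rw [Measure.map_apply hX (measurable_prodMk_right hm)]
  exact h y

theorem ae_mem_Icc_of_map_eq {Z : Ω → ℝ} (hZ : Measurable Z) {f : ℝ → ℝ≥0∞}
    (h : P.map Z = (volume.restrict (Set.Icc (0 : ℝ) 1)).withDensity f) :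
    ∀ᵐ ω ∂P, Z ω ∈ Set.Icc (0 : ℝ) 1 := by
  refine ae_of_ae_map hZ.aemeasurable ?_
  rw [h]
  exact (withDensity_absolutelyContinuous _ _).ae_le (ae_restrict_mem measurableSet_Icc)

theorem measure_eq_zero_of_map_eq {Z : Ω → ℝ} (hZ : Measurable Z) {f : ℝ → ℝ≥0∞}
    (h : P.map Z = (volume.restrict (Set.Icc (0 : ℝ) 1)).withDensity f) (x : ℝ) :
    P {ω | Z ω = x} = 0 := by
  have h1 : P {ω | Z ω = x} = P.map Z {x} := (Measure.map_apply hZ (measurableSet_singleton x)).symm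
  rw [h1, h]
  refine withDensity_absolutelyContinuous _ _ ?_
  simp

end Sample

/-! ### Stochastic orders and the error of the estimator -/

section Asymptotics

/-- Under a rate for the penalized part of the regularization bias, the same rate holds in norm. -/
theorem IsTikhonovBias.norm_le_rpow {G V F : Type*} [NormedAddCommGroup G] [InnerProductSpace ℝ G]
    [NormedAddCommGroup V] [InnerProductSpace ℝ V] [NormedAddCommGroup F] [InnerProductSpace ℝ F]
    {K : G →L[ℝ] F} {D : G →L[ℝ] V} {c : ℝ} (hc0 : 0 ≤ c)
    (hc : ∀ g, ‖g‖ ^ 2 ≤ c ^ 2 * (‖K g‖ ^ 2 + ‖D g‖ ^ 2)) {γ u : G} {lam : ℝ}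
    (hu : IsTikhonovBias K D γ lam u) (hlam : 0 < lam) (hlam1 : lam ≤ 1) {C θ : ℝ} (hC : 0 ≤ C)
    (hθ : θ ≤ 1) (hD : ‖D u‖ ≤ C * lam ^ θ) :
    ‖u‖ ≤ c * (C + ‖D γ‖) * lam ^ θ := by
  have hθ0 : 0 ≤ lam ^ θ := Real.rpow_nonneg hlam.le _
  have hle : lam ≤ lam ^ θ := by
    simpa using Real.rpow_le_rpow_of_exponent_ge hlam hlam1 hθ
  refine abs_le_of_sq_le_sq' ?_ (by positivity) |>.2
  have hK : ‖K u‖ ^ 2 ≤ ‖D γ‖ * C * (lam ^ θ) ^ 2 := by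
    calc ‖K u‖ ^ 2 ≤ lam * (‖D γ‖ * ‖D u‖) := by
          have h1 := hu.energy
          have h2 := mul_le_mul_of_nonneg_left (real_inner_le_norm (D γ) (D u)) hlam.le
          nlinarith [sq_nonneg ‖D u‖]
      _ ≤ lam ^ θ * (‖D γ‖ * (C * lam ^ θ)) := by gcongr
      _ = ‖D γ‖ * C * (lam ^ θ) ^ 2 := by ring
  calc ‖u‖ ^ 2 ≤ c ^ 2 * (‖K u‖ ^ 2 + ‖D u‖ ^ 2) := hc u
    _ ≤ c ^ 2 * (‖D γ‖ * C * (lam ^ θ) ^ 2 + (C * lam ^ θ) ^ 2) := by gcongr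
    _ ≤ (c * (C + ‖D γ‖) * lam ^ θ) ^ 2 := by
      have : 0 ≤ c ^ 2 * (lam ^ θ) ^ 2 * (‖D γ‖ * C + ‖D γ‖ ^ 2) := by positivity
      nlinarith

variable {Ω : Type*} [MeasurableSpace Ω] {P : Measure Ω}

theorem tendsto_measure_of_le_div_sq {A : ℕ → Set Ω} {M : ℝ}
    (h : ∀ R : ℝ, 0 < R → ∀ᶠ n in atTop, P (A n) ≤ ENNReal.ofReal (M / R ^ 2)) :
    Tendsto (fun n => P (A n)) atTop (𝓝 0) := by
  rw [ENNReal.tendsto_nhds_zero]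
  intro ε hε
  have h1 : Tendsto (fun R : ℝ => ENNReal.ofReal (M / R ^ 2)) atTop (𝓝 0) := by
    have : Tendsto (fun R : ℝ => M / R ^ 2) atTop (𝓝 0) :=
      tendsto_const_nhds.div_atTop (tendsto_pow_atTop two_ne_zero)
    simpa using ENNReal.tendsto_ofReal this
  obtain ⟨R, hR, hR0⟩ := ((ENNReal.tendsto_nhds_zero.1 h1 ε hε).and (eventually_gt_atTop 0)).exists
  filter_upwards [h R hR0] with n hn using hn.trans hR

theorem measure_not_le_of_imp {A B : Ω → Prop} (h : ∀ ω, A ω → B ω) {r : ℝ≥0∞}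
    (hA : P {ω | ¬ A ω} ≤ r) : P {ω | ¬ B ω} ≤ r :=
  (measure_mono fun ω (hω : ¬ B ω) (hA : A ω) => hω (h ω hA)).trans hA

variable {X : ℕ → Ω → ℝ≥0∞} {b s : ℕ → ℝ} {C M : ℝ}

theorem isLittleOPOne_of_bound (hb : Tendsto b atTop (𝓝 0)) (hs : Tendsto s atTop (𝓝 0))
    (h : ∀ R : ℝ, 0 < R → ∀ᶠ n in atTop,
      P {ω | ¬ X n ω ≤ ENNReal.ofReal (2 * (b n + C * R * s n))} ≤ ENNReal.ofReal (M / R ^ 2)) :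
    IsLittleOPOne P X := by
  intro ε hε
  refine tendsto_measure_of_le_div_sq (M := M) fun R hR => ?_
  have hlim : Tendsto (fun n => 2 * (b n + C * R * s n)) atTop (𝓝 0) := by
    simpa using (hb.add (hs.const_mul (C * R))).const_mul 2
  filter_upwards [h R hR, hlim.eventually_le_const hε] with n hn hle
  refine (measure_mono fun ω (hω : ENNReal.ofReal ε < X n ω) => ?_).trans hn
  exact not_le.2 ((ENNReal.ofReal_le_ofReal hle).trans_lt hω)

theorem isBigOP_of_bound {a : ℕ → ℝ} {B : ℝ} (hB : 0 ≤ B) (hC : 0 ≤ C) (ha : ∀ᶠ n in atTop, 0 ≤ a n)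
    (hs : ∀ᶠ n in atTop, 0 ≤ s n) (hb : ∀ᶠ n in atTop, b n ≤ B * a n)
    (h : ∀ R : ℝ, 0 < R → ∀ᶠ n in atTop,
      P {ω | ¬ X n ω ≤ ENNReal.ofReal (2 * (b n + C * R * s n))} ≤ ENNReal.ofReal (M / R ^ 2)) :
    IsBigOP P X (fun n => s n + a n) := by
  intro ε hε
  have h1 : Tendsto (fun R : ℝ => M / R ^ 2) atTop (𝓝 0) :=
    tendsto_const_nhds.div_atTop (tendsto_pow_atTop two_ne_zero)
  obtain ⟨R, hR, hR0⟩ := ((h1.eventually_le_const hε).and (eventually_gt_atTop 0)).exists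
  refine ⟨2 * (B + C * R), ?_⟩
  filter_upwards [h R hR0, ha, hs, hb] with n hn ha hs hb
  refine (measure_mono fun ω (hω : ENNReal.ofReal _ < X n ω) => ?_).trans
    (hn.trans (ENNReal.ofReal_le_ofReal hR))
  refine not_le.2 (lt_of_le_of_lt (ENNReal.ofReal_le_ofReal ?_) hω)
  have h2 : 0 ≤ B * s n := mul_nonneg hB hs
  have h3 : 0 ≤ C * R * a n := by positivity
  nlinarith

end Asymptotics

section Estimation

variable {Ω : Type*} [MeasurableSpace Ω] {P : Measure Ω} [IsProbabilityMeasure P] {p : ℕ}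
  {Y Z : Ω → ℝ} {W : Ω → EuclideanSpace ℝ (Fin p)} {g₀ : ℝ → ℝ}

theorem memLp_sub_lift (hZ : Measurable Z) (hZI : ∀ᵐ ω ∂P, Z ω ∈ Set.Icc (0 : ℝ) 1)
    (hg₀ : MemG g₀) (hY2 : MemLp Y 2 P) : MemLp (fun ω => Y ω - hg₀.lift.toFun (Z ω)) 2 P :=
  hY2.sub (memLp_toFun hZ hZI hg₀.lift 2)

variable {Ys Zs : ℕ → Ω → ℝ} {Ws : ℕ → Ω → EuclideanSpace ℝ (Fin p)}

/-- Almost surely the design points lie in `[0,1]` and are not all equal, and the instruments are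
distinct; this makes the linear system of the smoothing spline regular. -/
theorem ae_sample_regular (hZ : Measurable Z)
    {f : ℝ → ℝ≥0∞} (hf : P.map Z = (volume.restrict (Set.Icc (0 : ℝ) 1)).withDensity f)
    (hWcont : ∃ j : Fin p, ∀ x : ℝ, P {ω | W ω j = x} = 0)
    (hZs : ∀ i, Measurable (Zs i)) (hWs : ∀ i, Measurable (Ws i))
    (hindep : iIndepFun (fun i ω => (Ys i ω, Zs i ω, Ws i ω)) P)
    (hident : ∀ i, IdentDistrib (fun ω => (Ys i ω, Zs i ω, Ws i ω))
      (fun ω => (Y ω, Z ω, W ω)) P P) :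
    ∀ᵐ ω ∂P, (∀ i, Zs i ω ∈ Set.Icc (0 : ℝ) 1) ∧ Zs 0 ω ≠ Zs 1 ω ∧
      Function.Injective fun i => Ws i ω := by
  have hidZ : ∀ i, IdentDistrib Z (Zs i) P P := fun i =>
    ((hident i).comp (measurable_fst.comp measurable_snd)).symm
  obtain ⟨j, hj⟩ := hWcont
  have hmW : Measurable fun x : ℝ × ℝ × EuclideanSpace ℝ (Fin p) => x.2.2 j := by fun_prop
  have hidW : ∀ i, IdentDistrib (fun ω => W ω j) (fun ω => Ws i ω j) P P := fun i =>
    ((hident i).comp hmW).symm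
  have h1 : ∀ i, ∀ᵐ ω ∂P, Zs i ω ∈ Set.Icc (0 : ℝ) 1 := fun i =>
    (hidZ i).ae_mem_snd measurableSet_Icc (ae_mem_Icc_of_map_eq hZ hf)
  have h2 : ∀ᵐ ω ∂P, Zs 0 ω ≠ Zs 1 ω := by
    refine ae_ne_of_indepFun (hZs 0) (hZs 1) ((hindep.indepFun zero_ne_one).comp
      (measurable_fst.comp measurable_snd) (measurable_fst.comp measurable_snd)) fun x => ?_
    exact ((hidZ 0).measure_mem_eq (measurableSet_singleton x)).symm.trans
      (measure_eq_zero_of_map_eq hZ hf x)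
  have h3 : ∀ i k, i ≠ k → ∀ᵐ ω ∂P, Ws i ω j ≠ Ws k ω j := fun i k hik => by
    have hm : ∀ i, Measurable fun ω => Ws i ω j := fun i => by
      have := hWs i
      fun_prop
    refine ae_ne_of_indepFun (hm i) (hm k) ((hindep.indepFun hik).comp hmW hmW) fun x => ?_
    exact ((hidW i).measure_mem_eq (measurableSet_singleton x)).symm.trans (hj x)
  have h4 : ∀ᵐ ω ∂P, ∀ i k, i ≠ k → Ws i ω j ≠ Ws k ω j := by
    simp only [ae_all_iff]
    exact h3
  filter_upwards [ae_all_iff.2 h1, h2, h4] with ω h1 h2 h4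
  refine ⟨h1, h2, fun i k hik => ?_⟩
  by_contra hne
  exact h4 i k hne (congrArg (fun v : EuclideanSpace ℝ (Fin p) => v j) hik)

/-- With probability at least `1 - M / R²`, the programme has exactly one solution, and the
constrained estimator and its derivative are within the sum of the regularization bias and a term
of order `R / √(n lam)` of the target. -/
theorem exists_estimator_error_bound
    (hY : Measurable Y) (hZ : Measurable Z) (hW : Measurable W)
    (hmodel : P[fun ω => Y ω - g₀ (Z ω) | MeasurableSpace.comap W inferInstance] =ᵐ[P] 0)
    (hY2 : MemLp Y 2 P) {f : ℝ → ℝ≥0∞}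
    (hf : P.map Z = (volume.restrict (Set.Icc (0 : ℝ) 1)).withDensity f)
    (hZI : ∀ᵐ ω ∂P, Z ω ∈ Set.Icc (0 : ℝ) 1)
    (hWcont : ∃ j : Fin p, ∀ x : ℝ, P {ω | W ω j = x} = 0)
    (μ : Measure (EuclideanSpace ℝ (Fin p))) [IsProbabilityMeasure μ] [μ.IsOpenPosMeasure]
    (hg₀ : MemG g₀) {c : ℝ} (hc0 : 0 ≤ c)
    (hc : ∀ g, ‖g‖ ^ 2 ≤ c ^ 2 * (‖opK hW μ hZ hZI g‖ ^ 2 + ‖sobD g‖ ^ 2))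
    {η : ℝ} (hη : 0 < η) (hmono : ∀ z ∈ Set.Icc (0 : ℝ) 1, η ≤ d1 g₀ z)
    (hYs : ∀ i, Measurable (Ys i)) (hZs : ∀ i, Measurable (Zs i)) (hWs : ∀ i, Measurable (Ws i))
    (hindep : iIndepFun (fun i ω => (Ys i ω, Zs i ω, Ws i ω)) P)
    (hident : ∀ i, IdentDistrib (fun ω => (Ys i ω, Zs i ω, Ws i ω))
      (fun ω => (Y ω, Z ω, W ω)) P P)
    {lam : ℕ → ℝ} (hlam : Tendsto lam atTop (𝓝 0)) (hlam0 : ∀ᶠ n in atTop, 0 < lam n)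
    (hs0 : Tendsto (fun n : ℕ => 1 / √(n * lam n)) atTop (𝓝 0))
    {pstar : ∀ n : ℕ, Ω → Fin n → ℝ}
    (hpstar : ∀ n ω,
      (∃ q, IsTiltingSolution μ (lam n) (fun i : Fin n => Ys i ω) (fun i => Zs i ω)
        (fun i => Ws i ω) q) →
      IsTiltingSolution μ (lam n) (fun i : Fin n => Ys i ω) (fun i => Zs i ω)
        (fun i => Ws i ω) (pstar n ω))
    {ghat : ℕ → Ω → ℝ → ℝ}
    (hghat : ∀ n ω, ghat n ω = reweightedFit μ (lam n) (fun i : Fin n => Ys i ω)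
      (fun i => Zs i ω) (fun i => Ws i ω) (pstar n ω))
    {u : ℕ → Sob} (hu : ∀ᶠ n in atTop, IsTikhonovBias (opK hW μ hZ hZI) sobD hg₀.lift (lam n) (u n))
    (hu0 : Tendsto (fun n => ‖u n‖) atTop (𝓝 0)) :
    ∃ C M : ℝ, 0 ≤ C ∧ ∀ R : ℝ, 0 < R → ∀ᶠ n : ℕ in atTop,
      P {ω | ¬ ((∃! q, IsTiltingSolution μ (lam n) (fun i : Fin n => Ys i ω) (fun i => Zs i ω)
            (fun i => Ws i ω) q) ∧
          supNorm (fun z => ghat n ω z - g₀ z)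
            ≤ ENNReal.ofReal (2 * (‖u n‖ + C * R * (1 / √(n * lam n)))) ∧
          supNorm (fun z => deriv (ghat n ω) z - d1 g₀ z)
            ≤ ENNReal.ofReal (2 * (‖u n‖ + C * R * (1 / √(n * lam n)))))}
        ≤ ENNReal.ofReal (M / R ^ 2) := by
  have hmodel' : P[fun ω => Y ω - hg₀.lift.toFun (Z ω) | MeasurableSpace.comap W inferInstance]
      =ᵐ[P] 0 := by
    refine (condExp_congr_ae ?_).trans hmodel
    filter_upwards [hZI] with ω hω
    rw [hg₀.toFun_lift hω]
  obtain ⟨M, -, hM⟩ := exists_measure_samplingError_le hY hZ hW hZI hYs hZs hWs hindep hident μ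
    hg₀.lift (memLp_sub_lift hZ hZI hg₀ hY2) hmodel'
  refine ⟨2 * c * (1 + 4 * c * ‖sobD hg₀.lift‖), M, by positivity, fun R hR => ?_⟩
  set C := 2 * c * (1 + 4 * c * ‖sobD hg₀.lift‖) with hC
  have hbound : Tendsto (fun n : ℕ => 2 * (‖u n‖ + C * R * (1 / √(n * lam n)))) atTop (𝓝 0) := by
    simpa using (hu0.add (hs0.const_mul (C * R))).const_mul 2
  have hsmall : Tendsto (fun n : ℕ => 4 * c ^ 2 * (R / √n) ^ 2) atTop (𝓝 0) := by
    have : Tendsto (fun n : ℕ => R / √(n : ℝ)) atTop (𝓝 0) :=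
      tendsto_const_nhds.div_atTop (Real.tendsto_sqrt_atTop.comp tendsto_natCast_atTop_atTop)
    simpa using (this.pow 2).const_mul (4 * c ^ 2)
  have hreg := ae_sample_regular hZ hf hWcont hZs hWs hindep hident
  filter_upwards [eventually_ge_atTop 2, hlam0, hlam.eventually_le_const one_pos, hu,
    hbound.eventually_le_const hη, hsmall.eventually_le_const one_pos] with n hn hlam0 hlam1 hu hb hr
  have hn0 : 0 < n := by omega
  refine (measure_mono_ae ?_).trans (hM n hn0 R hR)
  filter_upwards [hreg] with ω hω hbad
  obtain ⟨hzI, hz01, hWinj⟩ := hω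
  change ENNReal.ofReal (R ^ 2 / n) < samplingError P W Z μ hg₀.lift (fun i : Fin n => Ys i ω)
    (fun i => Zs i ω) (fun i => Ws i ω)
  refine not_le.1 fun hle => hbad ?_
  -- off the exceptional event the sampling error is at most `r²` with `r = R / √n`
  have hrn : (R / √n) ^ 2 = R ^ 2 / n := by rw [div_pow, Real.sq_sqrt n.cast_nonneg]
  have herr := norm_splineSob_error_le hW hZ hZI μ hc0 hc hu hlam0 hlam1
    (y := fun i : Fin n => Ys i ω) (z := fun i => Zs i ω) (w := fun i => Ws i ω)
    (fun i k hik => Fin.ext (hWinj hik)) (fun i => hzI i) ⟨⟨0, hn0⟩, ⟨1, by omega⟩, hz01⟩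
    (r := R / √n) (by positivity) hr (by rw [hrn]; exact hle)
  rw [← hC] at herr
  set s := splineSob (fun i : Fin n => Zs i ω)
    (splineCoef μ (lam n) (fun i => Zs i ω) (fun i => Ws i ω) fun i => Ys i ω) with hs
  have hnorm : ‖hg₀.lift - s‖ ≤ ‖u n‖ + C * R * (1 / √(n * lam n)) := by
    have h1 : ‖(hg₀.lift - s) - u n‖ ≤ C * R * (1 / √(n * lam n)) := by
      have h2 := Real.sqrt_pos.2 hlam0
      rw [mul_comm, ← le_div_iff₀ h2] at herr
      refine herr.trans (le_of_eq ?_)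
      rw [Real.sqrt_mul n.cast_nonneg]
      field_simp
    calc ‖hg₀.lift - s‖ = ‖u n + ((hg₀.lift - s) - u n)‖ := by rw [add_sub_cancel]
      _ ≤ _ := (norm_add_le _ _).trans (by gcongr)
  have hnorm2 : 2 * ‖hg₀.lift - s‖ ≤ 2 * (‖u n‖ + C * R * (1 / √(n * lam n))) := by gcongr
  -- `2 ‖lift g₀ - s‖ ≤ η ≤ g₀'` keeps the derivative of the fit nonnegative
  have hderiv : ∀ i : Fin n, 0 ≤ deriv (splineFit μ (lam n) (fun i => Zs i ω) (fun i => Ws i ω)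
      fun i : Fin n => Ys i ω) (Zs i ω) := fun i => by
    have h1 := (abs_le.1 (abs_deriv_splineFit_sub_le (μ := μ) (lam := lam n)
      (y := fun i : Fin n => Ys i ω) (z := fun i => Zs i ω) (w := fun i => Ws i ω) hg₀
      (hzI i))).1
    have h2 := hmono _ (hzI i)
    linarith
  have hsol := fun q => isTiltingSolution_iff (q := q) hn0 hderiv
  have hp := (hsol _).1 (hpstar n ω ⟨_, (hsol _).2 rfl⟩)
  have hg : ghat n ω = splineFit μ (lam n) (fun i => Zs i ω) (fun i => Ws i ω)
      fun i : Fin n => Ys i ω := by rw [hghat, hp, reweightedFit_uniform hn0]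
  refine ⟨⟨_, (hsol _).2 rfl, fun q hq => (hsol q).1 hq⟩, ?_, ?_⟩
  · rw [hg]
    exact (supNorm_splineFit_sub_le hg₀).trans (ENNReal.ofReal_le_ofReal hnorm2)
  · rw [hg]
    exact supNorm_le_of_abs_le fun x hx => (abs_deriv_splineFit_sub_le hg₀ hx).trans hnorm2

end Estimation

end

end NPIV

theorem theorem3 {Ω : Type*} [MeasurableSpace Ω] (P : Measure Ω) [IsProbabilityMeasure P] (p : ℕ)
    -- the population variables and the model `Y = g₀(Z) + ε`, `E(ε | W) = 0`
    (Y Z : Ω → ℝ) (W : Ω → EuclideanSpace ℝ (Fin p))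
    (hY : Measurable Y) (hZ : Measurable Z) (hW : Measurable W)
    (g₀ : ℝ → ℝ)
    (hmodel : P[fun ω => Y ω - g₀ (Z ω) | MeasurableSpace.comap W inferInstance] =ᵐ[P] 0)
    -- square integrability, bounded density on `[0,1]`, a continuous instrument
    (hY2 : MemLp Y 2 P)
    (hZdens : ∃ (f : ℝ → ℝ) (C : ℝ), Measurable f ∧ (∀ z, f z ≤ C) ∧
      P.map Z = (volume.restrict (Set.Icc (0 : ℝ) 1)).withDensity (fun z => ENNReal.ofReal (f z)))
    (hWcont : ∃ j : Fin p, ∀ x : ℝ, P {ω | W ω j = x} = 0)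
    -- `μ` is a symmetric probability measure with full support
    (μ : Measure (EuclideanSpace ℝ (Fin p))) [IsProbabilityMeasure μ] [μ.IsOpenPosMeasure]
    (hμsymm : μ.map (fun t => -t) = μ)
    -- completeness and monotonicity
    (hg₀ : NPIV.MemG g₀) (hcomplete : NPIV.Completeness P Z W)
    (η : ℝ) (hη : 0 < η) (hmono : ∀ z ∈ Set.Icc (0 : ℝ) 1, η ≤ NPIV.d1 g₀ z)
    -- the random sample
    (Ys Zs : ℕ → Ω → ℝ) (Ws : ℕ → Ω → EuclideanSpace ℝ (Fin p))
    (hYs : ∀ i, Measurable (Ys i)) (hZs : ∀ i, Measurable (Zs i)) (hWs : ∀ i, Measurable (Ws i))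
    (hindep : iIndepFun (fun i ω => (Ys i ω, Zs i ω, Ws i ω)) P)
    (hident : ∀ i, IdentDistrib (fun ω => (Ys i ω, Zs i ω, Ws i ω))
      (fun ω => (Y ω, Z ω, W ω)) P P)
    -- the regularization parameter
    (lam : ℕ → ℝ) (hlam : Tendsto lam atTop (𝓝 0))
    (hnlam : Tendsto (fun n : ℕ => (n : ℝ) * lam n) atTop atTop)
    -- the optimal weights (arbitrary where the programme has no solution)
    (pstar : ∀ n : ℕ, Ω → Fin n → ℝ)
    (hpstar : ∀ n ω,
      (∃ q, NPIV.IsTiltingSolution μ (lam n) (fun i : Fin n => Ys i ω) (fun i => Zs i ω)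
        (fun i => Ws i ω) q) →
      NPIV.IsTiltingSolution μ (lam n) (fun i : Fin n => Ys i ω) (fun i => Zs i ω)
        (fun i => Ws i ω) (pstar n ω))
    -- the constrained estimator
    (ghat : ℕ → Ω → ℝ → ℝ)
    (hghat : ∀ n ω, ghat n ω = NPIV.reweightedFit μ (lam n) (fun i : Fin n => Ys i ω)
      (fun i => Zs i ω) (fun i => Ws i ω) (pstar n ω)) :
    -- with probability tending to one the programme has exactly one solution
    Tendsto (fun n : ℕ => P {ω | ¬ ∃! q, NPIV.IsTiltingSolution μ (lam n)
        (fun i : Fin n => Ys i ω) (fun i => Zs i ω) (fun i => Ws i ω) q}) atTop (𝓝 0) ∧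
    -- uniform consistency
    NPIV.IsLittleOPOne P (fun n ω => NPIV.supNorm fun z => ghat n ω z - g₀ z) ∧
    NPIV.IsLittleOPOne P (fun n ω => NPIV.supNorm fun z => deriv (ghat n ω) z - NPIV.d1 g₀ z) ∧
    -- uniform rates under the source condition
    ∀ γ : ℝ, 0 < γ → NPIV.SourceCondition P Z hW μ g₀ γ →
      NPIV.IsBigOP P (fun n ω => NPIV.supNorm fun z => ghat n ω z - g₀ z)
        (fun n => 1 / Real.sqrt (n * lam n) + lam n ^ (min γ 2 / 2)) ∧
      NPIV.IsBigOP P (fun n ω => NPIV.supNorm fun z => deriv (ghat n ω) z - NPIV.d1 g₀ z)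
        (fun n => 1 / Real.sqrt (n * lam n) + lam n ^ (min γ 2 / 2)) := by
  obtain ⟨f, -, -, -, hf⟩ := hZdens
  have hZI := NPIV.ae_mem_Icc_of_map_eq hZ hf
  have hK := NPIV.injective_opK hW μ hZ hZI hcomplete
  obtain ⟨c, hc0, hc⟩ := NPIV.exists_coercive hK
  have hlam0 : ∀ᶠ n in atTop, 0 < lam n := by
    filter_upwards [hnlam.eventually_gt_atTop 0] with n hn
    exact pos_of_mul_pos_right hn n.cast_nonneg
  have hs0 : Tendsto (fun n : ℕ => 1 / √(n * lam n)) atTop (𝓝 0) :=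
    tendsto_const_nhds.div_atTop (Real.tendsto_sqrt_atTop.comp hnlam)
  -- the bias; where `lam n ≤ 0`, which happens for finitely many `n`, its value is irrelevant
  have hex : ∀ n, ∃ u, 0 < lam n → NPIV.IsTikhonovBias (NPIV.opK hW μ hZ hZI) NPIV.sobD hg₀.lift
      (lam n) u := fun n => by
    by_cases h : 0 < lam n
    · obtain ⟨u, hu⟩ := NPIV.exists_isTikhonovBias hc hg₀.lift h
      exact ⟨u, fun _ => hu⟩
    · exact ⟨0, fun h' => absurd h' h⟩
  choose u hu using hex
  have hu' := hlam0.mono hu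
  have hu0 := NPIV.IsTikhonovBias.tendsto_zero hc0 hc hK hlam0 hlam hu'
  obtain ⟨C, M, hC, hbad⟩ := NPIV.exists_estimator_error_bound hY hZ hW hmodel hY2 hf hZI hWcont μ
    hg₀ hc0 hc hη hmono hYs hZs hWs hindep hident hlam hlam0 hs0 hpstar hghat hu' hu0
  have hbad1 := fun R hR => (hbad R hR).mono fun n hn =>
    NPIV.measure_not_le_of_imp (fun _ h => h.2.1) hn
  have hbad2 := fun R hR => (hbad R hR).mono fun n hn =>
    NPIV.measure_not_le_of_imp (fun _ h => h.2.2) hn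
  refine ⟨NPIV.tendsto_measure_of_le_div_sq fun R hR => (hbad R hR).mono fun n hn =>
    NPIV.measure_not_le_of_imp (fun _ h => h.1) hn,
    NPIV.isLittleOPOne_of_bound hu0 hs0 hbad1, NPIV.isLittleOPOne_of_bound hu0 hs0 hbad2,
    fun γ hγ hsource => ?_⟩
  obtain ⟨B, hB, hbias⟩ := NPIV.exists_norm_bias_le hW hZ hZI μ hμsymm hK hg₀ hγ hsource
  have hrate : ∀ᶠ n in atTop, ‖u n‖ ≤ c * (B + ‖NPIV.sobD hg₀.lift‖) * lam n ^ (min γ 2 / 2) := by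
    filter_upwards [hlam0, hlam.eventually_le_const one_pos] with n h0 h1
    exact (hu n h0).norm_le_rpow hc0 hc h0 h1 hB (by linarith [min_le_right γ 2])
      (hbias _ h0 _ (hu n h0))
  have ha : ∀ᶠ n in atTop, 0 ≤ lam n ^ (min γ 2 / 2) := hlam0.mono fun n h => Real.rpow_nonneg h.le _
  have hs : ∀ᶠ n : ℕ in atTop, 0 ≤ 1 / √(n * lam n) := Eventually.of_forall fun n => by positivity
  have hB' : 0 ≤ c * (B + ‖NPIV.sobD hg₀.lift‖) := by positivity
  exact ⟨NPIV.isBigOP_of_bound hB' hC ha hs hrate hbad1,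
    NPIV.isBigOP_of_bound hB' hC ha hs hrate hbad2⟩
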